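/- **Lemma 6.2 (Estimates on the concentration).** *Setting.* Let $T>0$, let $\Omega\subset\mathbb R^d$ be open and bounded, and write $|\Omega|$ for its measure. A mesh of $\Omega$ is a finite family of pairwise disjoint open polytopal cells contained in $\Omega$ (bounded open sets whose boundary is covered by finitely many hyperplanes) whose closures cover $\Omega$. *Data.* Let $q^\pm\in L^\infty(\Omega\times(0,T))$ with $|q^+|\le M_{q^+}$ and $0\le q^-\le M_{q^-}$; let $c_{\rm ini}\in L^\infty(\Omega)$; let $\phi$ be smooth up to the boundary in each cell of a mesh, with $0<\phi_*\le\phi\le\phi^*$; let $A(x,s)$ and $D(x,\zeta)$ ($x\in\Omega$, $s\in\mathbb R$, $\zeta\in\mathbb R^d$) be Carathéodory matrix-valued functions such that, for a.e. $x\in\Omega$ and all $s,\xi,\zeta$, $A(x,s)\xi\cdot\xi\ge\alpha_A|\xi|^2$, $|A(x,s)|\le\Lambda_A$, $D(x,\zeta)\xi\cdot\xi\ge\alpha_D(1+|\zeta|)|\xi|^2$ and $|D(x,\zeta)|\le\Lambda_D(1+|\zeta|)$, with $\alpha_A,\alpha_D>0$. *Discretisation.* A space gradient discretisation is a triple $(X,\Pi,\nabla)$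 with $X$ a finite-dimensional real vector space and $\Pi:X\to L^\infty(\Omega)$, $\nabla:X\to L^\infty(\Omega)^d$ linear, such that $\big(\|\nabla v\|_{L^2(\Omega)}^2+|\int_\Omega\Pi v|^2\big)^{1/2}$ is a norm on $X$. Let $\mathcal P=(X_{\mathcal P},\Pi_{\mathcal P},\nabla_{\mathcal P})$ and $\mathcal C=(X_{\mathcal C},\Pi_{\mathcal C},\nabla_{\mathcal C})$ be two of them, let $0=t^{(0)}<\dots<t^{(N)}=T$, $\delta t_n=t^{(n+1)}-t^{(n)}$, let $\mathcal I_{\mathcal C}:L^\infty(\Omega)\to X_{\mathcal C}$ be any map, and let $w\in[0,1]$. Each of $q=q^+$ and $q=q^-$ is sampled in time either by $q_n=\frac1{\delta t_n}\int_{t^{(n)}}^{t^{(n+1)}}q(\cdot,s)\,ds$ for $n<N$ and $q_N=q_{N-1}$, or, if $q$ is continuous in time on $[0,T]$, by $q_n=q(\cdot,t^{(n)})$ for $n\le N$. *Scheme.* A solution of the GDM–ELLAM scheme is a pair $(p^{(n)})_{1\le n\le N}\subset X_{\mathcal P}$, $(c^{(n)})_{0\le n\le N}\subset X_{\mathcal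 C}$ such that $c^{(0)}=\mathcal I_{\mathcal C}c_{\rm ini}$ and, for $n=0,\dots,N-1$: 1. $\int_\Omega\Pi_{\mathcal P}p^{(n+1)}=0$ and $\int_\Omega A(x,\Pi_{\mathcal C}c^{(n)})\nabla_{\mathcal P}p^{(n+1)}\cdot\nabla_{\mathcal P}z=\int_\Omega(q_n^+-q_n^-)\Pi_{\mathcal P}z$ for all $z\in X_{\mathcal P}$. 2. A Darcy velocity $u^{(n+1)}$ is given with $u^{(n+1)}\in H_{\rm div}(\Omega)$ piecewise polynomial on a mesh, $u^{(n+1)}\cdot n=0$ on $\partial\Omega$ and $|{\rm div}\,u^{(n+1)}|\le M_{\rm div}$. (Membership in $H_{\rm div}(\Omega)$ with zero normal trace means that the Stokes formula holds without boundary term for restrictions to $\Omega$ of functions in $C_c^\infty(\mathbb R^d)$.) $F_t$ denotes its flow: for a.e. $x\in\Omega$, $t\in[-T,T]\mapsto F_t(x)\in\Omega$ is Lipschitz, $F_0(x)=x$ and, except at countably many times, $F_t(x)$ lies in open cells of both the mesh of $\phi$ and the mesh of $u^{(n+1)}$ and $\frac{d}{dt}F_t(x)=\frac{u^{(n+1)}(F_t(x))}{\phi(F_t(x))}$.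 3. With $U^{(n+1)}=-A(x,\Pi_{\mathcal C}c^{(n)})\nabla_{\mathcal P}p^{(n+1)}$, for all $z\in X_{\mathcal C}$, setting $v_z=(\Pi_{\mathcal C}z)\circ F_{\delta t_n}$, $$\int_\Omega\phi\,\Pi_{\mathcal C}c^{(n+1)}\Pi_{\mathcal C}z-\int_\Omega\phi\,\Pi_{\mathcal C}c^{(n)}v_z+\delta t_n\int_\Omega D(x,U^{(n+1)})\nabla_{\mathcal C}c^{(n+1)}\cdot\nabla_{\mathcal C}z+w\,\delta t_n\int_\Omega\Pi_{\mathcal C}c^{(n)}v_zq_n^-+(1-w)\delta t_n\int_\Omega\Pi_{\mathcal C}c^{(n+1)}\Pi_{\mathcal C}z\,q_{n+1}^-$$ $$=w\,\delta t_n\int_\Omega q_n^+v_z+(1-w)\delta t_n\int_\Omega q_{n+1}^+\Pi_{\mathcal C}z.$$ For $t\in(t^{(n)},t^{(n+1)}]$ write $\Pi_{\mathcal C}c(\cdot,t)=\Pi_{\mathcal C}c^{(n+1)}$, $\nabla_{\mathcal C}c(\cdot,t)=\nabla_{\mathcal C}c^{(n+1)}$ and $U_{\mathcal P}(\cdot,t)=U^{(n+1)}$.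 *Claim.* There is a constant $C$, depending only on $|\Omega|$, $T$, $\phi_*$, $\phi^*$, $\alpha_D$, $M_{q^+}$, $M_{q^-}$ and $M_{\rm div}$, such that any solution of the GDM–ELLAM scheme satisfies $$\|\Pi_{\mathcal C}c\|_{L^\infty(0,T;L^2(\Omega))}+\big\|(1+|U_{\mathcal P}|)^{1/2}\nabla_{\mathcal C}c\big\|_{L^2(0,T;L^2(\Omega))}\le C\big(1+\|\Pi_{\mathcal C}\mathcal I_{\mathcal C}c_{\rm ini}\|_{L^2(\Omega)}\big),$$ and, as a consequence, $\|\nabla_{\mathcal C}c\|_{L^2(0,T;L^2(\Omega))}\le C\big(1+\|\Pi_{\mathcal C}\mathcal I_{\mathcal C}c_{\rm ini}\|_{L^2(\Omega)}\big)$. -/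

import Mathlib

open MeasureTheory Set
open scoped ENNReal ContDiff

noncomputable section

namespace Ellam

/-- The Euclidean space `ℝ^d`. -/
abbrev Pt (d : ℕ) := EuclideanSpace ℝ (Fin d)

/-- Lebesgue measure on `Ω`. -/
abbrev leb {d : ℕ} (Ω : Set (Pt d)) : Measure (Pt d) := volume.restrict Ω

/-- The space `L^∞(Ω; B)`. -/
abbrev LInf {d : ℕ} (Ω : Set (Pt d)) (B : Type) [NormedAddCommGroup B] := Lp B ∞ (leb Ω)

/-! ### Meshes, piecewise smooth and piecewise polynomial functions -/

/-- Open polytopal cells (intervals, polygons, polyhedra, ...): bounded open sets whose boundary is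
covered by finitely many affine hyperplanes. Cells need not be convex. -/
structure IsPolytopalCell {d : ℕ} (K : Set (Pt d)) : Prop where
  isOpen : IsOpen K
  bounded : Bornology.IsBounded K
  frontier_subset : ∃ H : Set (Pt d × ℝ), H.Finite ∧ (∀ h ∈ H, h.1 ≠ 0) ∧
    frontier K ⊆ ⋃ h ∈ H, {x | inner ℝ h.1 x = h.2}

/-- A mesh of `Ω`: a finite family of pairwise disjoint open polytopal cells contained in `Ω`, whose
closures cover `Ω`. -/
structure IsMesh {d : ℕ} (Ω : Set (Pt d)) (M : Set (Set (Pt d))) : Prop where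
  finite : M.Finite
  cell : ∀ K ∈ M, IsPolytopalCell K
  subset : ∀ K ∈ M, K ⊆ Ω
  disjoint : M.PairwiseDisjoint id
  cover : Ω ⊆ ⋃ K ∈ M, closure K

/-- In each cell, `f` is (the restriction of a function that is) smooth up to the boundary of the
cell. -/
def PiecewiseSmooth {d : ℕ} (M : Set (Set (Pt d))) (f : Pt d → ℝ) : Prop :=
  ∀ K ∈ M, ∃ g : Pt d → ℝ, ContDiff ℝ ∞ g ∧ EqOn f g K

/-- In each cell, every component of `V` is a polynomial. -/
def PiecewisePolynomial {d : ℕ} (M : Set (Set (Pt d))) (V : Pt d → Pt d) : Prop :=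
  ∀ K ∈ M, ∃ P : Fin d → MvPolynomial (Fin d) ℝ,
    ∀ x ∈ K, ∀ i, V x i = MvPolynomial.eval (fun j => x j) (P i)

/-! ### Velocities in `H_div` and their flow -/

/-- `g` is the weak divergence on `Ω` of `V`, and `V · n = 0` on `∂Ω`: the Stokes formula holds
without boundary term for test functions that are smooth up to the boundary of `Ω`. -/
def HasDivNoFlux {d : ℕ} (Ω : Set (Pt d)) (V : Pt d → Pt d) (g : Pt d → ℝ) : Prop :=
  ∀ ψ : Pt d → ℝ, ContDiff ℝ ∞ ψ → HasCompactSupport ψ →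
    ∫ x in Ω, fderiv ℝ ψ x (V x) = - ∫ x in Ω, g x * ψ x

/-- Admissible reconstructed Darcy velocities: `V ∈ H_div(Ω)` is piecewise polynomial on the mesh
`M`, `V · n = 0` on `∂Ω` and `|div V| ≤ Mdiv`. -/
structure IsAdmissibleVelocity {d : ℕ} (Ω : Set (Pt d)) (M : Set (Set (Pt d))) (Mdiv : ℝ)
    (V : Pt d → Pt d) : Prop where
  memLp : MemLp V 2 (leb Ω)
  piecewise : PiecewisePolynomial M V
  exists_div : ∃ g : Pt d → ℝ, MemLp g 2 (leb Ω) ∧ (∀ᵐ x ∂leb Ω, |g x| ≤ Mdiv) ∧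
    HasDivNoFlux Ω V g

/-- `F` is the flow of `V / φ` on `[-T,T]`: for a.e. `x ∈ Ω`, `t ↦ F t x` is a Lipschitz curve in
`Ω` starting from `x` at time `0` that, except at countably many times, lies in `G` and satisfies
the differential equation there. Here `G` is the union of the open cells in which both `φ` and `V`
are smooth; the excluded times are those at which the curve meets faces, where `V / φ` is not
defined. -/
def IsFlow {d : ℕ} (Ω G : Set (Pt d)) (T : ℝ) (φ : Pt d → ℝ) (V : Pt d → Pt d)
    (F : ℝ → Pt d → Pt d) : Prop :=
  ∀ᵐ x ∂leb Ω, F 0 x = x ∧ (∀ t ∈ Icc (-T) T, F t x ∈ Ω) ∧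
    (∃ L, LipschitzOnWith L (fun t => F t x) (Icc (-T) T)) ∧
    ∃ S : Set ℝ, S.Countable ∧ ∀ t ∈ Ioo (-T) T \ S,
      F t x ∈ G ∧ HasDerivAt (fun r => F r x) ((φ (F t x))⁻¹ • V (F t x)) t

/-! ### Gradient discretisations -/

/-- The quantity `‖v‖_D = (‖∇_D v‖_{L²}² + |∫_Ω Π_D v|²)^{1/2}`. -/
def discreteNorm {d : ℕ} {Ω : Set (Pt d)} {X : Type*} [AddCommGroup X] [Module ℝ X]
    (recon : X →ₗ[ℝ] LInf Ω ℝ) (grad : X →ₗ[ℝ] LInf Ω (Pt d)) (v : X) : ℝ :=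
  Real.sqrt ((∫ x in Ω, ‖grad v x‖ ^ 2) + |∫ x in Ω, recon v x| ^ 2)

/-- Space gradient discretisation (no-flow boundary conditions) with space of unknowns `X`. Since
`discreteNorm` is a seminorm on any `X` (for `Ω` bounded), it is a norm exactly when it vanishes
only at `0`. -/
structure SpaceGD {d : ℕ} (Ω : Set (Pt d)) (X : Type*) [AddCommGroup X] [Module ℝ X] where
  finiteDimensional : FiniteDimensional ℝ X
  recon : X →ₗ[ℝ] LInf Ω ℝ
  grad : X →ₗ[ℝ] LInf Ω (Pt d)
  eq_zero_of_norm : ∀ v, discreteNorm recon grad v = 0 → v = 0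

/-- Space-time gradient discretisation: a space gradient discretisation, time steps
`0 = t 0 < ⋯ < t N = T` (the values `t n` for `n > N` play no role), and an interpolant of initial
conditions. -/
structure SpaceTimeGD {d : ℕ} (Ω : Set (Pt d)) (T : ℝ) (X : Type*) [AddCommGroup X] [Module ℝ X]
    extends SpaceGD Ω X where
  N : ℕ
  t : ℕ → ℝ
  t_zero : t 0 = 0
  t_last : t N = T
  t_lt : ∀ n < N, t n < t (n + 1)
  interp : LInf Ω ℝ → X

/-- The time step `t (n+1) - t n`. -/
def SpaceTimeGD.dt {d : ℕ} {Ω : Set (Pt d)} {T : ℝ} {X : Type*} [AddCommGroup X] [Module ℝ X]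
    (C : SpaceTimeGD Ω T X) (n : ℕ) : ℝ := C.t (n + 1) - C.t n

/-- The function of time and space that is equal to `a n` on `(t n, t (n+1)]`, for `n < N`. -/
def inTime {d : ℕ} {B : Type*} [AddCommMonoid B] (N : ℕ) (t : ℕ → ℝ) (a : ℕ → Pt d → B) :
    ℝ → Pt d → B :=
  fun s x => ∑ n ∈ Finset.range N, (Ioc (t n) (t (n + 1))).indicator (fun _ => a n x) s

/-! ### The model -/

/-- `f(x,s)` is measurable with respect to `x ∈ Ω` and continuous with respect to `s`. -/
def IsCaratheodory {d : ℕ} {S B : Type*} [TopologicalSpace S] [TopologicalSpace B]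
    (Ω : Set (Pt d)) (f : Pt d → S → B) : Prop :=
  (∀ s, AEStronglyMeasurable (fun x => f x s) (leb Ω)) ∧ ∀ᵐ x ∂leb Ω, Continuous (f x)

/-- Data of the miscible displacement model: porosity `φ`, `A = K/μ`, diffusion-dispersion tensor
`D`, injection and production terms `qp`, `qm` (functions of space, then time), initial
concentration `cini`. -/
structure Data (d : ℕ) (Ω : Set (Pt d)) where
  φ : Pt d → ℝ
  A : Pt d → ℝ → (Pt d →L[ℝ] Pt d)
  D : Pt d → Pt d → (Pt d →L[ℝ] Pt d)
  qp : Pt d → ℝ → ℝ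
  qm : Pt d → ℝ → ℝ
  cini : LInf Ω ℝ

/-- A source term in `L^∞(Ω × (0,T))`, bounded by `M`. -/
def IsBoundedSource {d : ℕ} (Ω : Set (Pt d)) (T M : ℝ) (q : Pt d → ℝ → ℝ) : Prop :=
  AEStronglyMeasurable (fun z : Pt d × ℝ => q z.1 z.2)
      ((leb Ω).prod (volume.restrict (Ioo 0 T))) ∧
    ∀ᵐ z ∂(leb Ω).prod (volume.restrict (Ioo (0 : ℝ) T)), |q z.1 z.2| ≤ M

/-- Standing assumptions on the data. Tensors are measured in operator norm. -/
structure Data.Admissible {d : ℕ} {Ω : Set (Pt d)} (P : Data d Ω) (M : Set (Set (Pt d)))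
    (T φlo φhi αA ΛA αD ΛD Mqp Mqm : ℝ) : Prop where
  qp_bdd : IsBoundedSource Ω T Mqp P.qp
  qm_bdd : IsBoundedSource Ω T Mqm P.qm
  qm_nonneg : ∀ᵐ z ∂(leb Ω).prod (volume.restrict (Ioo (0 : ℝ) T)), 0 ≤ P.qm z.1 z.2
  φ_smooth : PiecewiseSmooth M P.φ
  φ_bounds : ∀ᵐ x ∂leb Ω, φlo ≤ P.φ x ∧ P.φ x ≤ φhi
  A_car : IsCaratheodory Ω P.A
  A_bounds : ∀ᵐ x ∂leb Ω, ∀ (s : ℝ) (ξ : Pt d),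
    αA * ‖ξ‖ ^ 2 ≤ inner ℝ (P.A x s ξ) ξ ∧ ‖P.A x s‖ ≤ ΛA
  D_car : IsCaratheodory Ω P.D
  D_bounds : ∀ᵐ x ∂leb Ω, ∀ ξ ζ : Pt d,
    αD * (1 + ‖ζ‖) * ‖ξ‖ ^ 2 ≤ inner ℝ (P.D x ζ ξ) ξ ∧ ‖P.D x ζ‖ ≤ ΛD * (1 + ‖ζ‖)

/-- `qn 0, …, qn N` are discrete values in time of `q`: either the averages of `q` on the time
intervals, with `qn N = qn (N-1)`, or, if `q` is continuous in time, the values at the times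
`t n`. -/
def IsTimeSampling {d : ℕ} (Ω : Set (Pt d)) (T : ℝ) (N : ℕ) (t : ℕ → ℝ) (q : Pt d → ℝ → ℝ)
    (qn : ℕ → Pt d → ℝ) : Prop :=
  ((∀ n < N, ∀ᵐ x ∂leb Ω, qn n x = (t (n + 1) - t n)⁻¹ * ∫ s in (t n)..(t (n + 1)), q x s) ∧
      ∀ᵐ x ∂leb Ω, qn N x = qn (N - 1) x) ∨
  ((∀ᵐ x ∂leb Ω, ContinuousOn (q x) (Icc 0 T)) ∧
      ∀ n ≤ N, ∀ᵐ x ∂leb Ω, qn n x = q x (t n))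

/-! ### The scheme -/

section Scheme

variable {d : ℕ} {Ω : Set (Pt d)} {T : ℝ} {XP XC : Type*}
  [AddCommGroup XP] [Module ℝ XP] [AddCommGroup XC] [Module ℝ XC]

/-- The velocity `U^(n+1) = -A(x, Π_C c^(n)) ∇_P p^(n+1)`. -/
def discreteU (P : Data d Ω) (GP : SpaceGD Ω XP) (GC : SpaceTimeGD Ω T XC)
    (p : ℕ → XP) (c : ℕ → XC) (n : ℕ) (x : Pt d) : Pt d :=
  -(P.A x (GC.recon (c n) x) (GP.grad (p (n + 1)) x))

/-- The pressure equation at step `n`. -/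
def PressureStep (P : Data d Ω) (GP : SpaceGD Ω XP) (GC : SpaceTimeGD Ω T XC)
    (qp qm : ℕ → Pt d → ℝ) (p : ℕ → XP) (c : ℕ → XC) (n : ℕ) : Prop :=
  (∫ x in Ω, GP.recon (p (n + 1)) x) = 0 ∧
  ∀ z : XP, ∫ x in Ω, inner ℝ (P.A x (GC.recon (c n) x) (GP.grad (p (n + 1)) x)) (GP.grad z x)
    = ∫ x in Ω, (qp n x - qm n x) * GP.recon z x

/-- The concentration equation at step `n`, with weight `w` and flow `F` of the velocity
reconstructed at this step. The solution `v` of `φ ∂_t v + u · ∇v = 0` on `(t n, t (n+1))` with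
final value `v(·, t (n+1)) = Π_C z` is understood along characteristics, so that
`v(·, t n) = Π_C z ∘ F_{dt n}`. -/
def ConcentrationStep (P : Data d Ω) (GP : SpaceGD Ω XP) (GC : SpaceTimeGD Ω T XC) (w : ℝ)
    (qp qm : ℕ → Pt d → ℝ) (F : ℝ → Pt d → Pt d) (p : ℕ → XP) (c : ℕ → XC) (n : ℕ) : Prop :=
  ∀ z : XC, ∀ v : Pt d → ℝ, (∀ x, v x = GC.recon z (F (GC.dt n) x)) →
    (∫ x in Ω, P.φ x * GC.recon (c (n + 1)) x * GC.recon z x)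
      - (∫ x in Ω, P.φ x * GC.recon (c n) x * v x)
      + GC.dt n * (∫ x in Ω, inner ℝ
          (P.D x (discreteU P GP GC p c n x) (GC.grad (c (n + 1)) x)) (GC.grad z x))
      + w * GC.dt n * (∫ x in Ω, GC.recon (c n) x * v x * qm n x)
      + (1 - w) * GC.dt n * (∫ x in Ω, GC.recon (c (n + 1)) x * GC.recon z x * qm (n + 1) x)
    = w * GC.dt n * (∫ x in Ω, qp n x * v x)
      + (1 - w) * GC.dt n * (∫ x in Ω, qp (n + 1) x * GC.recon z x)

/-- `(p, c)` is a solution of the GDM-ELLAM scheme, where `u (n+1)` is the Darcy velocity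
reconstructed from `p (n+1)`, piecewise polynomial on the mesh `Mu (n+1)`, and `F (n+1)` is its
flow. Only `p 1, …, p N` and `c 0, …, c N` are used. -/
structure IsSolution (P : Data d Ω) (Mφ : Set (Set (Pt d))) (GP : SpaceGD Ω XP)
    (GC : SpaceTimeGD Ω T XC) (w : ℝ) (qp qm : ℕ → Pt d → ℝ) (Mu : ℕ → Set (Set (Pt d)))
    (u : ℕ → Pt d → Pt d) (F : ℕ → ℝ → Pt d → Pt d) (p : ℕ → XP) (c : ℕ → XC) : Prop where
  qp_sampling : IsTimeSampling Ω T GC.N GC.t P.qp qp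
  qm_sampling : IsTimeSampling Ω T GC.N GC.t P.qm qm
  initial : c 0 = GC.interp P.cini
  pressure : ∀ n < GC.N, PressureStep P GP GC qp qm p c n
  flow : ∀ n < GC.N, IsFlow Ω (⋃₀ Mφ ∩ ⋃₀ Mu (n + 1)) T P.φ (u (n + 1)) (F (n + 1))
  concentration : ∀ n < GC.N, ConcentrationStep P GP GC w qp qm (F (n + 1)) p c n

/-- The space-time reconstruction `Π_C c`. -/
def reconST (GC : SpaceTimeGD Ω T XC) (c : ℕ → XC) : ℝ → Pt d → ℝ :=
  inTime GC.N GC.t (fun n x => GC.recon (c (n + 1)) x)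

/-- The space-time reconstruction delayed by one time step. -/
def reconDelayedST (GC : SpaceTimeGD Ω T XC) (c : ℕ → XC) : ℝ → Pt d → ℝ :=
  inTime GC.N GC.t (fun n x => GC.recon (c n) x)

/-- The space-time reconstructed gradient `∇_C c`. -/
def gradST (GC : SpaceTimeGD Ω T XC) (c : ℕ → XC) : ℝ → Pt d → Pt d :=
  inTime GC.N GC.t (fun n x => GC.grad (c (n + 1)) x)

/-- The space-time velocity `U_P = -A(x, Π̃_C c) ∇_P p`. -/
def velocityST (P : Data d Ω) (GP : SpaceGD Ω XP) (GC : SpaceTimeGD Ω T XC)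
    (p : ℕ → XP) (c : ℕ → XC) : ℝ → Pt d → Pt d :=
  fun s x => -(P.A x (reconDelayedST GC c s x)
    (inTime GC.N GC.t (fun n y => GP.grad (p (n + 1)) y) s x))

end Scheme

/-- The norm of `L^r(0,T; L²(Ω))`, with value `∞` if it is not finite. -/
def normLrL2 {d : ℕ} {B : Type*} [NormedAddCommGroup B] (Ω : Set (Pt d)) (T : ℝ) (r : ℝ≥0∞)
    (f : ℝ → Pt d → B) : ℝ≥0∞ :=
  eLpNorm (fun s => eLpNorm (f s) 2 (leb Ω)) r (volume.restrict (Ioo 0 T))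

end Ellam

end

/-! Testing the scheme with `z = c (n+1)` gives an energy inequality in which everything has the
right sign or size, except that `Π_C c (n+1)` appears composed with the flow. The theorem therefore
rests on one fact, `IsFlow.measure_preimage_le`: for every set `B`, the measure `φ dx` of `{F_t ∈
B}` is at most `exp(|Mdiv| t / φlo)` times that of `B`. The transported test function is then
bounded in `L²(φ dx)` by `exp(|Mdiv| dt / (2 φlo))` times the original one. One step costs a factor
`exp(γ dt)` and a source of size `K dt`, a discrete Gronwall argument bounds the norms, and the
diffusion terms are summed with Young's inequality and a telescoping sum.

For a smooth velocity the compression bound is Liouville's formula. Here `V / φ` may jump across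
faces, and `F` is only a family of trajectories: it is not assumed measurable, nor a semigroup, nor
unique. The substitute is the notion of tame point, near which trajectories depend in a Lipschitz
way on their starting point. Interior points of cells are tame. So are the points of a single face
where the normal component of `V` is nonzero: the Stokes formula forces this component to agree on
both sides, so that all trajectories cross the face in the same direction. Near a tame point `g ∘
F_s` is almost everywhere a Lipschitz function when `g` is Lipschitz; the Stokes formula extends to
Lipschitz test functions, and `∫ φ g ∘ F_s` has right derivative `-∫ (div V) g ∘ F_s`, whence the
bound by Gronwall (`integral_comp_flow_le`). Compactness and iteration carry it to all trajectories
that meet tame points only (`measure_flow_preimage_tame_le`).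

A point of `Ω` that is not tame lies on two distinct faces, or on a face where the normal velocity
vanishes. To reach it within time `η`, a trajectory has to start `O(η)`-close to two faces or
`O(η²)`-close to one, hence in a set of volume `O(η²)`. There are `T / η` time slots, and up to the
slot of the first encounter the trajectory is tame, so the compression bound applies to it. The
starting points that ever meet a bad point thus have measure `O(η)`, that is, zero
(`measure_hits_eq_zero`). Speeds, Lipschitz constants and the geometry of the meshes matter only for
short times and null sets, which is why they are absent from the final constant. -/

namespace Ellam

/-! ### Trajectories of a field given off a null set, and tame points -/

section Curves

variable {E : Type*} [NormedAddCommGroup E] [NormedSpace ℝ E]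

/-- The fundamental theorem of calculus holds for continuous functions differentiable off a
countable set, provided that the derivative is integrable. Integrability comes from the bound `C`
and from the measurability of `deriv f`, which replaces `f'` because nothing is known of `f'` on
`S`. -/
theorem norm_sub_le_of_hasDerivAt_off_countable [CompleteSpace E] {f f' : ℝ → E} {α β C : ℝ} (hαβ : α ≤ β)
    (hf : ContinuousOn f (Icc α β)) {S : Set ℝ} (hS : S.Countable)
    (hd : ∀ t ∈ Ioo α β \ S, HasDerivAt f (f' t) t) (hC : ∀ t ∈ Ioo α β \ S, ‖f' t‖ ≤ C) :
    ‖f β - f α‖ ≤ C * (β - α) := by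
  have hae : ∀ᵐ t : ℝ, t ∈ uIoc α β → ‖deriv f t‖ ≤ C := by
    have h1 : ∀ᵐ t : ℝ, t ∉ S := by
      have := hS.measure_zero volume
      exact compl_mem_ae_iff.mpr this
    have h2 : ∀ᵐ t : ℝ, t ≠ β := by
      have : volume ({β} : Set ℝ) = 0 := by simp
      exact compl_mem_ae_iff.mpr this
    filter_upwards [h1, h2] with t ht1 ht2 ht
    rw [uIoc_of_le hαβ] at ht
    have hmem : t ∈ Ioo α β \ S := ⟨⟨ht.1, lt_of_le_of_ne ht.2 ht2⟩, ht1⟩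
    rw [(hd t hmem).deriv]
    exact hC t hmem
  have hint : IntervalIntegrable (deriv f) volume α β := by
    rw [intervalIntegrable_iff]
    refine Measure.integrableOn_of_bounded (M := C) ?_
      (stronglyMeasurable_deriv f).aestronglyMeasurable ?_
    · simp [uIoc_of_le hαβ]
    · exact (ae_restrict_iff' measurableSet_uIoc).2 hae
  have h := integral_eq_of_hasDerivAt_off_countable_of_le f (deriv f) hαβ hS hf
    (fun t ht => by rw [(hd t ht).deriv]; exact hd t ht) hint
  rw [← h]
  have := intervalIntegral.norm_integral_le_of_norm_le_const_ae hae
  rwa [abs_of_nonneg (sub_nonneg.2 hαβ)] at this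

/-- Subtracting the line of slope `(C + c) / 2` centres the derivative in `[-(C - c) / 2, (C - c) /
2]`, which reduces the one-sided bound to the norm estimate. The value of `C` disappears from the
result. -/
theorem mul_sub_le_of_hasDerivAt_off_countable {f f' : ℝ → ℝ} {α β c C : ℝ} (hαβ : α ≤ β)
    (hf : ContinuousOn f (Icc α β)) {S : Set ℝ} (hS : S.Countable)
    (hd : ∀ t ∈ Ioo α β \ S, HasDerivAt f (f' t) t) (hc : ∀ t ∈ Ioo α β \ S, c ≤ f' t)
    (hC : ∀ t ∈ Ioo α β \ S, f' t ≤ C) :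
    c * (β - α) ≤ f β - f α := by
  have h := norm_sub_le_of_hasDerivAt_off_countable (f := fun t => f t - (C + c) / 2 * t)
    (f' := fun t => f' t - (C + c) / 2) (C := (C - c) / 2) hαβ
    (hf.sub (by fun_prop)) hS (fun t ht => by
      simpa using (hd t ht).fun_sub ((hasDerivAt_id t).const_mul ((C + c) / 2)))
    (fun t ht => by
      have h1 := hc t ht
      have h2 := hC t ht
      rw [Real.norm_eq_abs, abs_le]
      constructor <;> linarith)
  rw [Real.norm_eq_abs, abs_le] at h
  nlinarith [h.1]

/-- `γ` is continuous on `[α,β]` and, except at countably many times, lies in `G` and satisfies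
`γ' = b(γ)`. -/
structure IsFieldCurve (G : Set E) (b : E → E) (α β : ℝ) (γ : ℝ → E) : Prop where
  continuousOn : ContinuousOn γ (Icc α β)
  exists_countable : ∃ S : Set ℝ, S.Countable ∧
    ∀ t ∈ Ioo α β \ S, γ t ∈ G ∧ HasDerivAt γ (b (γ t)) t

variable {G : Set E} {b : E → E} {α β : ℝ} {γ γ₁ γ₂ : ℝ → E}

theorem IsFieldCurve.mono (h : IsFieldCurve G b α β γ) {α' β' : ℝ} (hα : α ≤ α') (hβ : β' ≤ β) :
    IsFieldCurve G b α' β' γ := by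
  obtain ⟨S, hS, hd⟩ := h.exists_countable
  exact ⟨h.continuousOn.mono (Icc_subset_Icc hα hβ), S, hS,
    fun t ht => hd t ⟨Ioo_subset_Ioo hα hβ ht.1, ht.2⟩⟩

theorem IsFieldCurve.comp_add (h : IsFieldCurve G b α β γ) (s : ℝ) :
    IsFieldCurve G b (α - s) (β - s) (fun t => γ (t + s)) := by
  obtain ⟨S, hS, hd⟩ := h.exists_countable
  refine ⟨h.continuousOn.comp (by fun_prop) fun t ht => ⟨by linarith [ht.1], by linarith [ht.2]⟩,
    (fun t => t + s) ⁻¹' S, hS.preimage (add_left_injective s), fun t ht => ?_⟩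
  have := hd (t + s) ⟨⟨by linarith [ht.1.1], by linarith [ht.1.2]⟩, ht.2⟩
  exact ⟨this.1, this.2.comp_add_const t s⟩

theorem IsFieldCurve.norm_sub_le [CompleteSpace E] (h : IsFieldCurve G b α β γ) {M : ℝ} (hM : ∀ x ∈ G, ‖b x‖ ≤ M)
    {s t : ℝ} (hs : α ≤ s) (hst : s ≤ t) (ht : t ≤ β) : ‖γ t - γ s‖ ≤ M * (t - s) := by
  obtain ⟨hc, S, hS, hd⟩ := h.mono hs ht
  exact norm_sub_le_of_hasDerivAt_off_countable hst hc hS (fun t ht => (hd t ht).2)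
    fun t ht => hM _ (hd t ht).1

/-- The equation is not assumed at the endpoint `α`. Continuity of `b` at `γ α` makes the velocity
at later times close to `b (γ α)`, and the mean value inequality for `γ s - s • b (γ α)` recovers
the right derivative. It serves to differentiate the flow at time `0`. -/
theorem IsFieldCurve.hasDerivWithinAt_left [CompleteSpace E] (h : IsFieldCurve G b α β γ) (hαβ : α < β)
    (hG : IsOpen G) (hb : ContinuousOn b G) (hα : γ α ∈ G) :
    HasDerivWithinAt γ (b (γ α)) (Ici α) α := by
  rw [hasDerivWithinAt_iff_isLittleO, Asymptotics.isLittleO_iff]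
  intro ε hε
  have hcont : ContinuousWithinAt (fun t => b (γ t)) (Icc α β) α :=
    (hb.continuousAt (hG.mem_nhds hα)).comp_continuousWithinAt
      (h.continuousOn α (left_mem_Icc.2 hαβ.le))
  have hev := Metric.continuousWithinAt_iff.1 hcont ε hε
  obtain ⟨δ, hδ, hball⟩ := hev
  have hlt : ∀ᶠ t in nhdsWithin α (Ici α), t < min β (α + δ) :=
    nhdsWithin_le_nhds (Iio_mem_nhds (by simp [hαβ, hδ]))
  filter_upwards [hlt, self_mem_nhdsWithin] with t ht hαt
  have ht1 : t < β := ht.trans_le (min_le_left _ _)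
  have ht2 : t < α + δ := ht.trans_le (min_le_right _ _)
  obtain ⟨hc, S, hS, hd⟩ := h.mono le_rfl ht1.le
  have := norm_sub_le_of_hasDerivAt_off_countable (f := fun s => γ s - s • b (γ α))
    (f' := fun s => b (γ s) - b (γ α)) (C := ε) hαt (hc.sub (by fun_prop)) hS
    (fun s hs => by simpa using (hd s hs).2.fun_sub ((hasDerivAt_id s).smul_const (b (γ α))))
    (fun s hs => by
      rw [← dist_eq_norm]
      refine (hball ⟨hs.1.1.le, (hs.1.2.trans ht1).le⟩ ?_).le
      rw [Real.dist_eq, abs_of_pos (by linarith [hs.1.1])]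
      linarith [hs.1.2])
  have e : γ t - γ α - (t - α) • b (γ α) = γ t - t • b (γ α) - (γ α - α • b (γ α)) := by
    rw [sub_smul]; abel
  rw [e, Real.norm_eq_abs, abs_of_nonneg (sub_nonneg.2 hαt)]
  exact this

/-- Two curves driven by the same Lipschitz field separate by at most a factor `2` in short
time. -/
theorem IsFieldCurve.norm_sub_le_of_lipschitz [CompleteSpace E] (h₁ : IsFieldCurve G b α β γ₁)
    (h₂ : IsFieldCurve G b α β γ₂) (hαβ : α ≤ β) {g : E → E} {R : Set E} {K : NNReal}
    (hg : LipschitzOnWith K g R) (hK : K * (β - α) ≤ 1 / 2)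
    (hR₁ : ∀ t ∈ Ioo α β, γ₁ t ∈ G → γ₁ t ∈ R ∧ b (γ₁ t) = g (γ₁ t))
    (hR₂ : ∀ t ∈ Ioo α β, γ₂ t ∈ G → γ₂ t ∈ R ∧ b (γ₂ t) = g (γ₂ t)) :
    ‖γ₁ β - γ₂ β‖ ≤ 2 * ‖γ₁ α - γ₂ α‖ := by
  -- At the time `t₀` of largest gap `m`, the gap is at most its initial value plus `K m (t₀ - α) ≤
  -- m / 2`, and the last term is absorbed.
  obtain ⟨t₀, ht₀, hmax⟩ := isCompact_Icc.exists_isMaxOn (nonempty_Icc.2 hαβ)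
    (h₁.continuousOn.sub h₂.continuousOn).norm
  obtain ⟨S₁, hS₁, hd₁⟩ := h₁.exists_countable
  obtain ⟨S₂, hS₂, hd₂⟩ := h₂.exists_countable
  have hm : ∀ t ∈ Icc α β, ‖γ₁ t - γ₂ t‖ ≤ ‖γ₁ t₀ - γ₂ t₀‖ := fun t ht => hmax ht
  set m := ‖γ₁ t₀ - γ₂ t₀‖ with hmdef
  have h0 : 0 ≤ m := norm_nonneg _
  have hsub : Icc α t₀ ⊆ Icc α β := Icc_subset_Icc le_rfl ht₀.2
  have key := norm_sub_le_of_hasDerivAt_off_countable (f := fun t => γ₁ t - γ₂ t)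
    (f' := fun t => b (γ₁ t) - b (γ₂ t)) (C := K * m) ht₀.1
    ((h₁.continuousOn.mono hsub).sub (h₂.continuousOn.mono hsub)) (hS₁.union hS₂)
    (fun t ht => by
      have ht' : t ∈ Ioo α β := ⟨ht.1.1, ht.1.2.trans_le ht₀.2⟩
      exact (hd₁ t ⟨ht', fun h => ht.2 (Or.inl h)⟩).2.sub
        (hd₂ t ⟨ht', fun h => ht.2 (Or.inr h)⟩).2)
    (fun t ht => by
      have ht' : t ∈ Ioo α β := ⟨ht.1.1, ht.1.2.trans_le ht₀.2⟩
      obtain ⟨r1, e1⟩ := hR₁ t ht' (hd₁ t ⟨ht', fun h => ht.2 (Or.inl h)⟩).1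
      obtain ⟨r2, e2⟩ := hR₂ t ht' (hd₂ t ⟨ht', fun h => ht.2 (Or.inr h)⟩).1
      rw [e1, e2]
      refine (hg.norm_sub_le r1 r2).trans ?_
      exact mul_le_mul_of_nonneg_left (hm t (Ioo_subset_Icc_self ht')) K.2)
  have h3 : (K : ℝ) * m * (t₀ - α) ≤ m / 2 := by
    have : (K : ℝ) * (t₀ - α) ≤ 1 / 2 :=
      (mul_le_mul_of_nonneg_left (by linarith [ht₀.2]) K.2).trans hK
    nlinarith
  have h4 : m ≤ ‖γ₁ α - γ₂ α‖ + ‖γ₁ t₀ - γ₂ t₀ - (γ₁ α - γ₂ α)‖ := by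
    rw [hmdef]
    have := norm_add_le (γ₁ α - γ₂ α) (γ₁ t₀ - γ₂ t₀ - (γ₁ α - γ₂ α))
    simpa using this
  have h5 := hm β (right_mem_Icc.2 hαβ)
  linarith

/-- If `f` keeps one sign, `σ` is an endpoint where `f` need not vanish; this is why the signs at
`σ` are conditional on `α < σ` and `σ < β`. -/
theorem exists_crossing_time {f : ℝ → ℝ} (hαβ : α ≤ β) (hf : ContinuousOn f (Icc α β))
    (hmono : ∀ s ∈ Icc α β, ∀ t ∈ Icc α β, s < t → f s < f t) :
    ∃ σ ∈ Icc α β, (∀ t ∈ Ioo α σ, f t < 0) ∧ (∀ t ∈ Ioo σ β, 0 < f t) ∧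
      (α < σ → f σ ≤ 0) ∧ (σ < β → 0 ≤ f σ) := by
  rcases le_or_gt 0 (f α) with h0 | h0
  · refine ⟨α, left_mem_Icc.2 hαβ, fun t ht => absurd ht (by simp), fun t ht => ?_,
      fun h => absurd h (lt_irrefl _), fun _ => h0⟩
    exact h0.trans_lt (hmono α (left_mem_Icc.2 hαβ) t (Ioo_subset_Icc_self ht) ht.1)
  rcases le_or_gt (f β) 0 with h1 | h1
  · refine ⟨β, right_mem_Icc.2 hαβ, fun t ht => ?_, fun t ht => absurd ht (by simp),
      fun _ => h1, fun h => absurd h (lt_irrefl _)⟩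
    exact (hmono t (Ioo_subset_Icc_self ht) β (right_mem_Icc.2 hαβ) ht.2).trans_le h1
  obtain ⟨σ, hσ, hσ0⟩ := intermediate_value_Icc hαβ hf ⟨h0.le, h1.le⟩
  refine ⟨σ, hσ, fun t ht => ?_, fun t ht => ?_, fun _ => hσ0.le, fun _ => hσ0.ge⟩
  · rw [← hσ0]; exact hmono t ⟨ht.1.le, ht.2.le.trans hσ.2⟩ σ hσ ht.2
  · rw [← hσ0]; exact hmono σ hσ t ⟨hσ.1.trans ht.1.le, ht.2.le⟩ ht.1

/-- Points near which curves depend in a Lipschitz way on their starting point, for short times. -/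
def IsTame (G : Set E) (b : E → E) (y : E) : Prop :=
  ∃ r > 0, ∃ τ > 0, ∃ L : ℝ, 0 ≤ L ∧ ∀ (α β : ℝ) (γ₁ γ₂ : ℝ → E), α ≤ β → β - α ≤ τ →
    IsFieldCurve G b α β γ₁ → IsFieldCurve G b α β γ₂ →
    (∀ t ∈ Icc α β, γ₁ t ∈ Metric.ball y r) → (∀ t ∈ Icc α β, γ₂ t ∈ Metric.ball y r) →
    ‖γ₁ β - γ₂ β‖ ≤ L * ‖γ₁ α - γ₂ α‖

theorem isOpen_isTame : IsOpen {y | IsTame G b y} := by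
  rw [Metric.isOpen_iff]
  rintro y ⟨r, hr, τ, hτ, L, hL, h⟩
  refine ⟨r / 2, by positivity, fun z hz => ⟨r / 2, by positivity, τ, hτ, L, hL, ?_⟩⟩
  have hsub : Metric.ball z (r / 2) ⊆ Metric.ball y r :=
    Metric.ball_subset_ball' (by rw [Metric.mem_ball] at hz; linarith)
  intro α β γ₁ γ₂ hαβ hτ h₁ h₂ hb₁ hb₂
  exact h α β γ₁ γ₂ hαβ hτ h₁ h₂ (fun t ht => hsub (hb₁ t ht)) (fun t ht => hsub (hb₂ t ht))

theorem isTame_of_lipschitzOnWith [CompleteSpace E] {y : E} {r : ℝ} (hr : 0 < r) {g : E → E} {K : NNReal}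
    (hg : LipschitzOnWith K g (Metric.ball y r)) (hb : ∀ x ∈ Metric.ball y r ∩ G, b x = g x) :
    IsTame G b y := by
  refine ⟨r, hr, 1 / (2 * (K + 1)), by positivity, 2, by norm_num, ?_⟩
  intro α β γ₁ γ₂ hαβ hτ h₁ h₂ hb₁ hb₂
  have hK : K * (β - α) ≤ 1 / 2 := by
    have h0 : (0 : ℝ) ≤ K := K.2
    calc K * (β - α) ≤ K * (1 / (2 * (K + 1))) := by gcongr
      _ ≤ 1 / 2 := by
        rw [mul_one_div, div_le_div_iff₀ (by positivity) (by norm_num)]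
        linarith
  exact h₁.norm_sub_le_of_lipschitz h₂ hαβ hg hK
    (fun t ht hG => ⟨hb₁ t (Ioo_subset_Icc_self ht), hb _ ⟨hb₁ t (Ioo_subset_Icc_self ht), hG⟩⟩)
    (fun t ht hG => ⟨hb₂ t (Ioo_subset_Icc_self ht), hb _ ⟨hb₂ t (Ioo_subset_Icc_self ht), hG⟩⟩)

end Curves

/-! ### Transversal crossing of a hyperplane -/

section Transversal

variable {E : Type*} [NormedAddCommGroup E] [InnerProductSpace ℝ E]
variable {G : Set E} {b : E → E} {α β : ℝ} {γ γ₁ γ₂ : ℝ → E}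

theorem IsFieldCurve.le_inner_sub (h : IsFieldCurve G b α β γ) {n : E} {c M : ℝ}
    (hM : ∀ x ∈ G, ‖b x‖ ≤ M)
    (hc : ∀ t ∈ Ioo α β, γ t ∈ G → c ≤ inner ℝ n (b (γ t))) {s t : ℝ} (hs : α ≤ s) (hst : s ≤ t)
    (ht : t ≤ β) : c * (t - s) ≤ inner ℝ n (γ t) - inner ℝ n (γ s) := by
  obtain ⟨hcont, S, hS, hd⟩ := h.mono hs ht
  refine mul_sub_le_of_hasDerivAt_off_countable (f := fun r => inner ℝ n (γ r))
    (f' := fun r => inner ℝ n (b (γ r))) (C := ‖n‖ * M) hst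
    (continuousOn_const.inner hcont) hS (fun r hr => ?_)
    (fun r hr => hc r (Ioo_subset_Ioo hs ht hr.1) (hd r hr).1)
    (fun r hr => (real_inner_le_norm _ _).trans
      (mul_le_mul_of_nonneg_left (hM _ (hd r hr).1) (norm_nonneg _)))
  simpa using (hasDerivAt_const r n).inner ℝ (hd r hr).2

/-- Two curves crossing a hyperplane transversally, in the same direction. -/
theorem IsFieldCurve.norm_sub_le_of_transversal [CompleteSpace E] (h₁ : IsFieldCurve G b α β γ₁)
    (h₂ : IsFieldCurve G b α β γ₂) (hαβ : α ≤ β) {gp gm : E → E} {R : Set E} {K : NNReal}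
    (hgp : LipschitzOnWith K gp R) (hgm : LipschitzOnWith K gm R) (hK : K * (β - α) ≤ 1 / 2)
    {n : E} {a c M : ℝ} (hc0 : 0 < c) (hM0 : 0 ≤ M) (hM : ∀ x ∈ G, ‖b x‖ ≤ M)
    (hc : ∀ x ∈ R ∩ G, c ≤ inner ℝ n (b x))
    (hp : ∀ x ∈ R ∩ G, a < inner ℝ n x → b x = gp x)
    (hm : ∀ x ∈ R ∩ G, inner ℝ n x < a → b x = gm x)
    (hR₁ : ∀ t ∈ Icc α β, γ₁ t ∈ R) (hR₂ : ∀ t ∈ Icc α β, γ₂ t ∈ R) :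
    ‖γ₁ β - γ₂ β‖ ≤ 2 * ((1 + 2 * M * (‖n‖ / c)) * (2 * ‖γ₁ α - γ₂ α‖)) := by
  have inc : ∀ γ, IsFieldCurve G b α β γ → (∀ t ∈ Icc α β, γ t ∈ R) →
      ∀ s t, α ≤ s → s ≤ t → t ≤ β → c * (t - s) ≤ inner ℝ n (γ t) - inner ℝ n (γ s) :=
    fun γ h hR s t hs hst ht => h.le_inner_sub hM
      (fun t ht hG => hc _ ⟨hR t (Ioo_subset_Icc_self ht), hG⟩) hs hst ht
  have cross : ∀ γ, IsFieldCurve G b α β γ → (∀ t ∈ Icc α β, γ t ∈ R) → _ :=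
    fun γ h hR => exists_crossing_time (f := fun t => inner ℝ n (γ t) - a) hαβ
      ((continuousOn_const.inner h.continuousOn).sub continuousOn_const)
      (fun s hs t ht hst => by
        have := inc γ h hR s t hs.1 hst.le ht.2
        have h2 : 0 < c * (t - s) := mul_pos hc0 (sub_pos.2 hst)
        linarith)
  -- Here `γ₁` crosses first. Both curves follow `gm` before `σ₁` and `gp` after `σ₂`, and each of
  -- these phases costs a factor `2`. In between they separate by at most `2 M (σ₂ - σ₁)`. This
  -- delay is controlled by the gap at `σ₁`: from there `γ₂` climbs towards the hyperplane at speed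
  -- at least `c`, and its remaining height is at most `‖n‖ ‖γ₁ σ₁ - γ₂ σ₁‖`.
  have main : ∀ γ₁ γ₂ : ℝ → E, IsFieldCurve G b α β γ₁ → IsFieldCurve G b α β γ₂ →
      (∀ t ∈ Icc α β, γ₁ t ∈ R) → (∀ t ∈ Icc α β, γ₂ t ∈ R) → ∀ σ₁ ∈ Icc α β, ∀ σ₂ ∈ Icc α β,
      σ₁ ≤ σ₂ → (∀ t ∈ Ioo α σ₁, inner ℝ n (γ₁ t) - a < 0) →
      (∀ t ∈ Ioo σ₁ β, 0 < inner ℝ n (γ₁ t) - a) → (σ₁ < β → 0 ≤ inner ℝ n (γ₁ σ₁) - a) →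
      (∀ t ∈ Ioo α σ₂, inner ℝ n (γ₂ t) - a < 0) →
      (∀ t ∈ Ioo σ₂ β, 0 < inner ℝ n (γ₂ t) - a) → (α < σ₂ → inner ℝ n (γ₂ σ₂) - a ≤ 0) →
      ‖γ₁ β - γ₂ β‖ ≤ 2 * ((1 + 2 * M * (‖n‖ / c)) * (2 * ‖γ₁ α - γ₂ α‖)) := by
    intro γ₁ γ₂ h₁ h₂ hR₁ hR₂ σ₁ hσ₁ σ₂ hσ₂ hσ neg₁ pos₁ zero₁ neg₂ pos₂ zero₂
    have hKle : ∀ s t, α ≤ s → t ≤ β → (K : ℝ) * (t - s) ≤ 1 / 2 := fun s t hs ht =>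
      (mul_le_mul_of_nonneg_left (by linarith) K.2).trans hK
    have step1 : ‖γ₁ σ₁ - γ₂ σ₁‖ ≤ 2 * ‖γ₁ α - γ₂ α‖ := by
      refine (h₁.mono le_rfl hσ₁.2).norm_sub_le_of_lipschitz (h₂.mono le_rfl hσ₁.2) hσ₁.1 hgm
        (hKle _ _ le_rfl hσ₁.2) (fun t ht hG => ?_) (fun t ht hG => ?_)
      · have hr := hR₁ t ⟨ht.1.le, ht.2.le.trans hσ₁.2⟩
        exact ⟨hr, hm _ ⟨hr, hG⟩ (by linarith [neg₁ t ht])⟩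
      · have hr := hR₂ t ⟨ht.1.le, ht.2.le.trans hσ₁.2⟩
        exact ⟨hr, hm _ ⟨hr, hG⟩ (by linarith [neg₂ t ⟨ht.1, ht.2.trans_le hσ⟩])⟩
    have step3 : ‖γ₁ β - γ₂ β‖ ≤ 2 * ‖γ₁ σ₂ - γ₂ σ₂‖ := by
      refine (h₁.mono hσ₂.1 le_rfl).norm_sub_le_of_lipschitz (h₂.mono hσ₂.1 le_rfl) hσ₂.2 hgp
        (hKle _ _ hσ₂.1 le_rfl) (fun t ht hG => ?_) (fun t ht hG => ?_)
      · have hr := hR₁ t ⟨hσ₂.1.trans ht.1.le, ht.2.le⟩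
        exact ⟨hr, hp _ ⟨hr, hG⟩ (by linarith [pos₁ t ⟨hσ.trans_lt ht.1, ht.2⟩])⟩
      · have hr := hR₂ t ⟨hσ₂.1.trans ht.1.le, ht.2.le⟩
        exact ⟨hr, hp _ ⟨hr, hG⟩ (by linarith [pos₂ t ht])⟩
    have step2 : ‖γ₁ σ₂ - γ₂ σ₂‖ ≤ (1 + 2 * M * (‖n‖ / c)) * ‖γ₁ σ₁ - γ₂ σ₁‖ := by
      rcases hσ.eq_or_lt with rfl | hlt
      · have : 0 ≤ 2 * M * (‖n‖ / c) * ‖γ₁ σ₁ - γ₂ σ₁‖ := by positivity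
        linarith
      have e1 := h₁.norm_sub_le hM hσ₁.1 hσ hσ₂.2
      have e2 := h₂.norm_sub_le hM hσ₁.1 hσ hσ₂.2
      have e3 := inc γ₂ h₂ hR₂ σ₁ σ₂ hσ₁.1 hσ hσ₂.2
      have e4 := zero₁ (hlt.trans_le hσ₂.2)
      have e5 := zero₂ (hσ₁.1.trans_lt hlt)
      have e6 : inner ℝ n (γ₁ σ₁) - inner ℝ n (γ₂ σ₁) ≤ ‖n‖ * ‖γ₁ σ₁ - γ₂ σ₁‖ := by
        rw [← inner_sub_right]; exact real_inner_le_norm _ _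
      have e7 : σ₂ - σ₁ ≤ ‖n‖ / c * ‖γ₁ σ₁ - γ₂ σ₁‖ := by
        rw [div_mul_eq_mul_div, le_div_iff₀ hc0]; linarith
      have e8 : γ₁ σ₂ - γ₂ σ₂ = (γ₁ σ₁ - γ₂ σ₁) + (γ₁ σ₂ - γ₁ σ₁) - (γ₂ σ₂ - γ₂ σ₁) := by abel
      calc ‖γ₁ σ₂ - γ₂ σ₂‖ ≤ ‖γ₁ σ₁ - γ₂ σ₁‖ + ‖γ₁ σ₂ - γ₁ σ₁‖ + ‖γ₂ σ₂ - γ₂ σ₁‖ := by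
            rw [e8]
            exact (_root_.norm_sub_le _ _).trans (by gcongr; exact norm_add_le _ _)
        _ ≤ ‖γ₁ σ₁ - γ₂ σ₁‖ + 2 * M * (σ₂ - σ₁) := by linarith
        _ ≤ ‖γ₁ σ₁ - γ₂ σ₁‖ + 2 * M * (‖n‖ / c * ‖γ₁ σ₁ - γ₂ σ₁‖) := by gcongr
        _ = _ := by ring
    refine step3.trans (mul_le_mul_of_nonneg_left (step2.trans ?_) (by norm_num))
    exact mul_le_mul_of_nonneg_left step1 (by positivity)
  obtain ⟨σ₁, hσ₁, n₁, p₁, z₁, w₁⟩ := cross γ₁ h₁ hR₁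
  obtain ⟨σ₂, hσ₂, n₂, p₂, z₂, w₂⟩ := cross γ₂ h₂ hR₂
  rcases le_total σ₁ σ₂ with hσ | hσ
  · exact main γ₁ γ₂ h₁ h₂ hR₁ hR₂ σ₁ hσ₁ σ₂ hσ₂ hσ n₁ p₁ w₁ n₂ p₂ z₂
  · rw [norm_sub_rev (γ₁ β), norm_sub_rev (γ₁ α)]
    exact main γ₂ γ₁ h₂ h₁ hR₂ hR₁ σ₂ hσ₂ σ₁ hσ₁ hσ n₂ p₂ w₂ n₁ p₁ z₁

theorem isTame_of_transversal [CompleteSpace E] {y : E} {r : ℝ} (hr : 0 < r) {gp gm : E → E} {K : NNReal}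
    (hgp : LipschitzOnWith K gp (Metric.ball y r)) (hgm : LipschitzOnWith K gm (Metric.ball y r))
    {n : E} {a c M : ℝ} (hc0 : 0 < c) (hM0 : 0 ≤ M) (hM : ∀ x ∈ G, ‖b x‖ ≤ M)
    (hc : ∀ x ∈ Metric.ball y r ∩ G, c ≤ inner ℝ n (b x))
    (hp : ∀ x ∈ Metric.ball y r ∩ G, a < inner ℝ n x → b x = gp x)
    (hm : ∀ x ∈ Metric.ball y r ∩ G, inner ℝ n x < a → b x = gm x) :
    IsTame G b y := by
  refine ⟨r, hr, 1 / (2 * (K + 1)), by positivity, 2 * ((1 + 2 * M * (‖n‖ / c)) * 2),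
    by positivity, ?_⟩
  intro α β γ₁ γ₂ hαβ hτ h₁ h₂ hb₁ hb₂
  have hK : K * (β - α) ≤ 1 / 2 := by
    have h0 : (0 : ℝ) ≤ K := K.2
    calc K * (β - α) ≤ K * (1 / (2 * (K + 1))) := by gcongr
      _ ≤ 1 / 2 := by
        rw [mul_one_div, div_le_div_iff₀ (by positivity) (by norm_num)]
        linarith
  have := h₁.norm_sub_le_of_transversal h₂ hαβ hgp hgm hK hc0 hM0 hM hc hp hm hb₁ hb₂
  linarith

end Transversal

end Ellam

/-! ### The Stokes formula for Lipschitz test functions -/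

namespace Ellam

-- Differentiation under the integral with a Lipschitz domination lets the derivative fall on `ψ`,
-- differentiable almost everywhere by Rademacher's theorem. The gradient of the mollified function
-- is thus an average of `fderiv ℝ ψ`: it inherits the bound `K` and converges at Lebesgue points.
open ContinuousLinearMap in
theorem hasFDerivAt_normed_convolution_of_lipschitz {d : ℕ} (η : ContDiffBump (0 : Pt d))
    {ψ : Pt d → ℝ} {K : NNReal} (hψ : LipschitzWith K ψ) (x : Pt d) :
    HasFDerivAt (convolution (η.normed volume) ψ (lsmul ℝ ℝ) volume)
      (convolution (η.normed volume) (fderiv ℝ ψ) (lsmul ℝ ℝ) volume x) x := by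
  have hint : ∀ y : Pt d, Integrable (fun t => η.normed volume t • ψ (y - t)) := fun y =>
    (η.continuous_normed.smul (hψ.continuous.comp (by fun_prop))).integrable_of_hasCompactSupport
      (η.hasCompactSupport_normed.smul_right)
  refine (hasFDerivAt_integral_of_dominated_loc_of_lip (μ := volume) (𝕜 := ℝ)
    (F := fun y t => η.normed volume t • ψ (y - t))
    (F' := fun t => η.normed volume t • fderiv ℝ ψ (x - t))
    (bound := fun t => η.normed volume t * K) (s := univ) Filter.univ_mem
    (Filter.Eventually.of_forall fun y => (hint y).aestronglyMeasurable) (hint x) ?_ ?_ ?_ ?_).2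
  · refine η.continuous_normed.aestronglyMeasurable.smul ?_
    exact ((measurable_fderiv ℝ ψ).comp (by fun_prop)).aestronglyMeasurable
  · refine Filter.Eventually.of_forall fun t => LipschitzOnWith.of_dist_le_mul fun y _ z _ => ?_
    have h1 := hψ.dist_le_mul (y - t) (z - t)
    have h2 := η.nonneg_normed (μ := volume) t
    rw [dist_sub_right] at h1
    rw [dist_smul₀, Real.norm_of_nonneg h2, Real.coe_nnabs, abs_of_nonneg (by positivity), mul_assoc]
    exact mul_le_mul_of_nonneg_left h1 h2
  · exact (η.continuous_normed.integrable_of_hasCompactSupport η.hasCompactSupport_normed).mul_const _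
  · have h := (Measure.measurePreserving_sub_left volume x).quasiMeasurePreserving.ae
      (hψ.ae_differentiableAt (μ := volume))
    filter_upwards [h] with t ht
    have h2 : HasFDerivAt (fun y => ψ (y - t)) (fderiv ℝ ψ (x - t)) x := by
      have h3 := ht.hasFDerivAt.comp x (hasFDerivAt_sub_const t)
      rwa [ContinuousLinearMap.comp_id] at h3
    exact h2.fun_const_smul _

open ContinuousLinearMap in
/-- The Stokes formula for Lipschitz test functions. -/
theorem HasDivNoFlux.integral_fderiv_of_lipschitz {d : ℕ} {Ω : Set (Pt d)} {V : Pt d → Pt d}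
    {g : Pt d → ℝ} (h : HasDivNoFlux Ω V g) (hV : Integrable V (leb Ω)) (hg : Integrable g (leb Ω))
    {ψ : Pt d → ℝ} {K : NNReal} (hψ : LipschitzWith K ψ) (hc : HasCompactSupport ψ) :
    ∫ x in Ω, fderiv ℝ ψ x (V x) = - ∫ x in Ω, g x * ψ x := by
  obtain ⟨B, hB⟩ := hc.exists_bound_of_continuous hψ.continuous
  -- The outer radius stays twice the inner one, as the Lebesgue differentiation argument in `hlim'`
  -- requires a bounded ratio.
  let η : ℕ → ContDiffBump (0 : Pt d) := fun n =>
    ⟨1 / ((n : ℝ) + 1), 2 * (1 / ((n : ℝ) + 1)), by positivity, by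
      have : 0 < 1 / ((n : ℝ) + 1) := by positivity
      linarith⟩
  have hη : Filter.Tendsto (fun n => (η n).rOut) Filter.atTop (nhds 0) := by
    simpa [η] using (tendsto_one_div_add_atTop_nhds_zero_nat (𝕜 := ℝ)).const_mul 2
  let ψn : ℕ → Pt d → ℝ := fun n => convolution ((η n).normed volume) ψ (lsmul ℝ ℝ) volume
  have hint1 : ∀ n, Integrable ((η n).normed (volume : Measure (Pt d))) := fun n =>
    (η n).continuous_normed.integrable_of_hasCompactSupport (η n).hasCompactSupport_normed
  have bnd : ∀ {F : Type} [NormedAddCommGroup F] [NormedSpace ℝ F] (n : ℕ) (f : Pt d → F) (C : ℝ),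
      (∀ x, ‖f x‖ ≤ C) → ∀ x,
      ‖convolution ((η n).normed volume) f (lsmul ℝ ℝ) volume x‖ ≤ C := by
    intro F _ _ n f C hC x
    rw [convolution_def]
    refine (norm_integral_le_of_norm_le ((hint1 n).mul_const C) ?_).trans_eq ?_
    · refine Filter.Eventually.of_forall fun t => ?_
      have h2 := (η n).nonneg_normed (μ := volume) t
      rw [lsmul_apply, norm_smul, Real.norm_of_nonneg h2]
      exact mul_le_mul_of_nonneg_left (hC _) h2
    · rw [integral_mul_const, (η n).integral_normed, one_mul]
  have hfd : ∀ n x, fderiv ℝ (ψn n) x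
      = convolution ((η n).normed volume) (fderiv ℝ ψ) (lsmul ℝ ℝ) volume x := fun n x =>
    (hasFDerivAt_normed_convolution_of_lipschitz (η n) hψ x).fderiv
  have hsmooth : ∀ n, ContDiff ℝ ∞ (ψn n) := fun n =>
    (η n).hasCompactSupport_normed.contDiff_convolution_left _ (η n).contDiff_normed
      hψ.continuous.locallyIntegrable
  have hcomp : ∀ n, HasCompactSupport (ψn n) := fun n =>
    (η n).hasCompactSupport_normed.convolution _ hc
  have hlim : ∀ x, Filter.Tendsto (fun n => ψn n x) Filter.atTop (nhds (ψ x)) := fun x =>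
    ContDiffBump.convolution_tendsto_right_of_continuous hη hψ.continuous x
  have hlocint : LocallyIntegrable (fderiv ℝ ψ) (volume : Measure (Pt d)) := by
    refine (locallyIntegrable_const (K : ℝ)).mono
      (measurable_fderiv ℝ ψ).aestronglyMeasurable (Filter.Eventually.of_forall fun x => ?_)
    rw [Real.norm_of_nonneg K.coe_nonneg]
    exact norm_fderiv_le_of_lipschitz ℝ hψ
  have hlim' : ∀ᵐ x : Pt d, Filter.Tendsto (fun n => fderiv ℝ (ψn n) x) Filter.atTop
      (nhds (fderiv ℝ ψ x)) := by
    simp_rw [hfd]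
    exact ContDiffBump.ae_convolution_tendsto_right_of_locallyIntegrable hη
      (K := 2) (Filter.Eventually.of_forall fun n => le_rfl) hlocint
  have lhs : Filter.Tendsto (fun n => ∫ x in Ω, fderiv ℝ (ψn n) x (V x)) Filter.atTop
      (nhds (∫ x in Ω, fderiv ℝ ψ x (V x))) := by
    refine tendsto_integral_of_dominated_convergence (fun x => K * ‖V x‖) (fun n => ?_)
      (hV.norm.const_mul _) (fun n => Filter.Eventually.of_forall fun x => ?_) ?_
    · exact isBoundedBilinearMap_apply.continuous.comp_aestronglyMeasurable
        (((hsmooth n).continuous_fderiv (by simp)).aestronglyMeasurable.prodMk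
          hV.aestronglyMeasurable)
    · refine (le_opNorm _ _).trans (mul_le_mul_of_nonneg_right ?_ (norm_nonneg _))
      rw [hfd]
      exact bnd n _ _ (fun x => norm_fderiv_le_of_lipschitz ℝ hψ) x
    · filter_upwards [ae_restrict_of_ae hlim'] with x hx
      exact ((ContinuousLinearMap.apply ℝ ℝ (V x)).continuous.tendsto _).comp hx
  have rhs : Filter.Tendsto (fun n => - ∫ x in Ω, g x * ψn n x) Filter.atTop
      (nhds (- ∫ x in Ω, g x * ψ x)) := by
    refine (tendsto_integral_of_dominated_convergence (fun x => ‖g x‖ * B) (fun n => ?_)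
      (hg.norm.mul_const _) (fun n => Filter.Eventually.of_forall fun x => ?_) ?_).neg
    · exact hg.aestronglyMeasurable.mul (hsmooth n).continuous.aestronglyMeasurable
    · rw [norm_mul]
      exact mul_le_mul_of_nonneg_left (bnd n _ _ hB x) (norm_nonneg _)
    · exact Filter.Eventually.of_forall fun x => (hlim x).const_mul _
  refine tendsto_nhds_unique lhs (rhs.congr fun n => ?_)
  exact (h _ (hsmooth n) (hcomp n)).symm

end Ellam

/-! ### Short-time expansion of volumes near a tame point -/

namespace Ellam

/-- The transporting field `V / φ`. -/
noncomputable def transportField {d : ℕ} (φ : Pt d → ℝ) (V : Pt d → Pt d) (x : Pt d) : Pt d :=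
  (φ x)⁻¹ • V x

/-- The measure `φ dx` on `Ω`. -/
noncomputable def porousMeasure {d : ℕ} (Ω : Set (Pt d)) (φ : Pt d → ℝ) : Measure (Pt d) :=
  (leb Ω).withDensity fun x => ENNReal.ofReal (φ x)

/-- A bounded transporting field `V / φ`, continuous on an open set `G` of full measure in `Ω`, with
bounded weak divergence of `V`, and its flow. -/
structure FlowSetting {d : ℕ} (Ω G : Set (Pt d)) (T lo hi M Cd : ℝ) (φ : Pt d → ℝ)
    (V : Pt d → Pt d) (F : ℝ → Pt d → Pt d) : Prop where
  isOpen : IsOpen Ω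
  isBounded : Bornology.IsBounded Ω
  isOpen_cells : IsOpen G
  subset : G ⊆ Ω
  null : volume (Ω \ G) = 0
  T_pos : 0 < T
  lo_pos : 0 < lo
  φ_bounds : ∀ x ∈ G, lo ≤ φ x ∧ φ x ≤ hi
  φ_cont : ContinuousOn φ G
  V_cont : ContinuousOn V G
  M_nonneg : 0 ≤ M
  speed : ∀ x ∈ G, ‖transportField φ V x‖ ≤ M
  Cd_nonneg : 0 ≤ Cd
  exists_div : ∃ g : Pt d → ℝ, MemLp g 2 (leb Ω) ∧ (∀ᵐ x ∂leb Ω, |g x| ≤ Cd) ∧ HasDivNoFlux Ω V g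
  flow : IsFlow Ω G T φ V F

/-- The points from which the flow is a curve in `Ω` on `[0,T]`. -/
def flowDomain {d : ℕ} (Ω G : Set (Pt d)) (T : ℝ) (φ : Pt d → ℝ) (V : Pt d → Pt d)
    (F : ℝ → Pt d → Pt d) : Set (Pt d) :=
  {x | x ∈ Ω ∧ F 0 x = x ∧ (∀ t ∈ Icc 0 T, F t x ∈ Ω) ∧
    IsFieldCurve G (transportField φ V) 0 T (fun t => F t x)}

/-- The functions `min 1 (k · dist(x, Oᶜ))` do this. They pass the expansion bound from Lipschitz
functions to open sets. -/
theorem exists_lipschitz_approx_indicator {E : Type*} [PseudoMetricSpace E] {O : Set E}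
    (hO : IsOpen O) :
    ∃ g : ℕ → E → ℝ, (∀ k, ∃ K, LipschitzWith K (g k)) ∧ (∀ k x, 0 ≤ g k x) ∧
      (∀ k x, g k x ≤ 1) ∧ (∀ k, ∀ x ∉ O, g k x = 0) ∧ (∀ x, Monotone fun k => g k x) ∧
      ∀ x ∈ O, ∃ k, g k x = 1 := by
  -- `Metric.infDist` to the empty set is `0` by convention, so `O = univ` is treated apart.
  rcases (Oᶜ).eq_empty_or_nonempty with he | hne
  · refine ⟨fun _ _ => 1, fun _ => ⟨0, LipschitzWith.const _⟩, by simp, by simp, ?_,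
      fun _ => monotone_const, fun _ _ => ⟨0, rfl⟩⟩
    intro k x hx
    have : x ∈ Oᶜ := hx
    simp [he] at this
  · refine ⟨fun k x => min 1 ((k : ℝ) * Metric.infDist x Oᶜ), fun k => ⟨k, ?_⟩, fun k x => ?_,
      fun k x => min_le_left _ _, fun k x hx => ?_, fun x i j hij => ?_, fun x hx => ?_⟩
    · have h2 : LipschitzWith k fun x => (k : ℝ) * Metric.infDist x Oᶜ := by
        refine LipschitzWith.of_dist_le_mul fun x y => ?_
        have := (Metric.lipschitz_infDist_pt Oᶜ).dist_le_mul x y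
        rw [Real.dist_eq, ← mul_sub, abs_mul, abs_of_nonneg (by positivity : (0 : ℝ) ≤ k)]
        rw [Real.dist_eq] at this
        simp only [NNReal.coe_one, one_mul] at this
        simpa using mul_le_mul_of_nonneg_left this (by positivity : (0 : ℝ) ≤ k)
      exact h2.const_min 1
    · exact le_min zero_le_one (mul_nonneg (by positivity) Metric.infDist_nonneg)
    · have : Metric.infDist x Oᶜ = 0 := Metric.infDist_zero_of_mem hx
      simp [this]
    · exact min_le_min le_rfl (mul_le_mul_of_nonneg_right (by exact_mod_cast hij)
        Metric.infDist_nonneg)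
    · have hpos : 0 < Metric.infDist x Oᶜ := by
        rw [← hO.isClosed_compl.notMem_iff_infDist_pos hne]
        simpa using hx
      obtain ⟨k, hk⟩ := exists_nat_ge (1 / Metric.infDist x Oᶜ)
      exact ⟨k, min_eq_left (by rwa [div_le_iff₀ hpos] at hk)⟩

namespace FlowSetting

variable {d : ℕ} {Ω G : Set (Pt d)} {T lo hi M Cd : ℝ} {φ : Pt d → ℝ} {V : Pt d → Pt d}
  {F : ℝ → Pt d → Pt d}

theorem ae_mem_cells (h : FlowSetting Ω G T lo hi M Cd φ V F) : ∀ᵐ x ∂leb Ω, x ∈ G := by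
  rw [ae_iff, Measure.restrict_apply₀']
  · convert! h.null using 2
    ext x; simp [and_comm]
  · exact h.isOpen.measurableSet.nullMeasurableSet

theorem isFiniteMeasure (h : FlowSetting Ω G T lo hi M Cd φ V F) : IsFiniteMeasure (leb Ω) :=
  isFiniteMeasure_restrict.2 h.isBounded.measure_lt_top.ne

theorem restrict_cells (h : FlowSetting Ω G T lo hi M Cd φ V F) :
    volume.restrict G = leb Ω :=
  Measure.restrict_congr_set (by
    refine (h.subset.eventuallyLE).antisymm ?_
    rw [ae_le_set]; exact h.null)

theorem aestronglyMeasurable_φ (h : FlowSetting Ω G T lo hi M Cd φ V F) :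
    AEStronglyMeasurable φ (leb Ω) := by
  rw [← h.restrict_cells]
  exact h.φ_cont.aestronglyMeasurable h.isOpen_cells.measurableSet

theorem aestronglyMeasurable_V (h : FlowSetting Ω G T lo hi M Cd φ V F) :
    AEStronglyMeasurable V (leb Ω) := by
  rw [← h.restrict_cells]
  exact h.V_cont.aestronglyMeasurable h.isOpen_cells.measurableSet

theorem V_eq (h : FlowSetting Ω G T lo hi M Cd φ V F) {x : Pt d} (hx : x ∈ G) :
    V x = φ x • transportField φ V x := by
  rw [transportField, smul_smul, mul_inv_cancel₀ (h.lo_pos.trans_le (h.φ_bounds x hx).1).ne',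
    one_smul]

theorem norm_V_le (h : FlowSetting Ω G T lo hi M Cd φ V F) {x : Pt d} (hx : x ∈ G) :
    ‖V x‖ ≤ hi * M := by
  have h1 := h.φ_bounds x hx
  have h0 : 0 ≤ φ x := h.lo_pos.le.trans h1.1
  rw [h.V_eq hx, norm_smul, Real.norm_of_nonneg h0]
  exact mul_le_mul h1.2 (h.speed x hx) (norm_nonneg _) (h0.trans h1.2)

theorem integrable_V (h : FlowSetting Ω G T lo hi M Cd φ V F) : Integrable V (leb Ω) := by
  have := h.isFiniteMeasure
  refine Integrable.of_bound h.aestronglyMeasurable_V (hi * M) ?_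
  filter_upwards [h.ae_mem_cells] with x hx using h.norm_V_le hx

theorem ae_mem_flowDomain (h : FlowSetting Ω G T lo hi M Cd φ V F) :
    ∀ᵐ x ∂leb Ω, x ∈ flowDomain Ω G T φ V F := by
  filter_upwards [h.flow, ae_restrict_mem h.isOpen.measurableSet] with x hx hxΩ
  obtain ⟨h0, hmem, ⟨L, hL⟩, S, hS, hd⟩ := hx
  have hT := h.T_pos
  have hmem' : ∀ t ∈ Icc 0 T, F t x ∈ Ω := fun t ht => hmem t ⟨by linarith [ht.1], ht.2⟩
  refine ⟨hxΩ, h0, hmem', ⟨?_, S, hS, fun t ht => ?_⟩⟩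
  · exact hL.continuousOn.mono (Icc_subset_Icc (by linarith) le_rfl)
  · exact hd t ⟨⟨by linarith [ht.1.1], ht.1.2⟩, ht.2⟩

/-- A set of full measure in an open set is dense in it. This is used at points reached by a
trajectory, from which `F` itself need not be a trajectory. -/
theorem exists_mem_flowDomain_dist_lt (h : FlowSetting Ω G T lo hi M Cd φ V F) {z : Pt d}
    (hz : z ∈ Ω) {ε : ℝ} (hε : 0 < ε) : ∃ x ∈ flowDomain Ω G T φ V F, dist x z < ε := by
  by_contra! hcon
  have hopen : IsOpen (Ω ∩ Metric.ball z ε) := h.isOpen.inter Metric.isOpen_ball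
  have hpos := hopen.measure_pos volume ⟨z, hz, Metric.mem_ball_self hε⟩
  have h0 := h.ae_mem_flowDomain
  rw [ae_iff, Measure.restrict_apply₀' h.isOpen.measurableSet.nullMeasurableSet] at h0
  have hsub : Ω ∩ Metric.ball z ε ⊆ {x | x ∉ flowDomain Ω G T φ V F} ∩ Ω := fun x hx =>
    ⟨fun hxY => absurd (hcon x hxY) (not_le.2 hx.2), hx.1⟩
  exact hpos.ne' (measure_mono_null hsub h0)

theorem integrable_φ_mul (h : FlowSetting Ω G T lo hi M Cd φ V F) {f : Pt d → ℝ}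
    (hf : AEStronglyMeasurable f (leb Ω)) {B : ℝ} (hB : ∀ᵐ x ∂leb Ω, ‖f x‖ ≤ B) :
    Integrable (fun x => φ x * f x) (leb Ω) := by
  have := h.isFiniteMeasure
  refine Integrable.of_bound (h.aestronglyMeasurable_φ.mul hf) (hi * B) ?_
  filter_upwards [h.ae_mem_cells, hB] with x hx hxB
  have h1 := h.φ_bounds x hx
  have h0 : 0 ≤ φ x := h.lo_pos.le.trans h1.1
  rw [norm_mul, Real.norm_of_nonneg h0]
  exact mul_le_mul h1.2 hxB (norm_nonneg _) (h0.trans h1.2)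

/-- Short-time expansion estimate for a test function carried by the flow near a tame point. -/
theorem integral_comp_flow_le (h : FlowSetting Ω G T lo hi M Cd φ V F) {y : Pt d} {ρ τ L : ℝ}
    (hρ : 0 < ρ) (hτT : τ ≤ T) (hMτ : M * τ ≤ ρ) (hL : 0 ≤ L)
    (htame : ∀ (α β : ℝ) (γ₁ γ₂ : ℝ → Pt d), α ≤ β → β - α ≤ τ →
      IsFieldCurve G (transportField φ V) α β γ₁ → IsFieldCurve G (transportField φ V) α β γ₂ →
      (∀ t ∈ Icc α β, γ₁ t ∈ Metric.ball y (4 * ρ)) →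
      (∀ t ∈ Icc α β, γ₂ t ∈ Metric.ball y (4 * ρ)) → ‖γ₁ β - γ₂ β‖ ≤ L * ‖γ₁ α - γ₂ α‖)
    {g : Pt d → ℝ} {Lg : NNReal} (hg : LipschitzWith Lg g) (hg0 : ∀ x, 0 ≤ g x)
    (hg1 : ∀ x, g x ≤ 1) (hsupp : ∀ x ∉ Metric.ball y ρ, g x = 0) {σ : ℝ} (hσ : σ ∈ Icc 0 τ) :
    AEStronglyMeasurable (fun x => g (F σ x)) (leb Ω) ∧
    ∫ x in Ω, φ x * g (F σ x) ≤ Real.exp (Cd / lo * σ) * ∫ x in Ω, φ x * g x := by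
  have hfin := h.isFiniteMeasure
  set Y := flowDomain Ω G T φ V F with hY
  set b := transportField φ V with hb
  -- `Lg * L` serves when both curves start near `y`. The term `1 / ρ` serves when one starts in
  -- `ball y (2ρ)` and the other outside `ball y (3ρ)`: the values differ by at most `1` and the
  -- starting points by at least `ρ`.
  let K : NNReal := Lg * ⟨L, hL⟩ + ⟨1 / ρ, by positivity⟩
  have hKdef : (K : ℝ) = Lg * L + 1 / ρ := rfl
  have hgabs : ∀ x, |g x| ≤ 1 := fun x => by rw [abs_of_nonneg (hg0 x)]; exact hg1 x
  -- a curve moves by at most `ρ`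
  have hmove : ∀ γ : ℝ → Pt d, ∀ s ∈ Icc 0 τ, IsFieldCurve G b 0 s γ → ∀ t ∈ Icc 0 s,
      dist (γ t) (γ 0) ≤ ρ := by
    intro γ s hs hγ t ht
    rw [dist_eq_norm]
    refine (hγ.norm_sub_le h.speed le_rfl ht.1 ht.2).trans ?_
    refine le_trans (mul_le_mul_of_nonneg_left ?_ h.M_nonneg) hMτ
    linarith [ht.2, hs.2]
  have hzero : ∀ γ : ℝ → Pt d, ∀ s ∈ Icc 0 τ, IsFieldCurve G b 0 s γ →
      γ 0 ∉ Metric.ball y (2 * ρ) → g (γ s) = 0 := by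
    intro γ s hs hγ h0
    refine hsupp _ fun hmem => h0 ?_
    have h1 := hmove γ s hs hγ s ⟨hs.1, le_rfl⟩
    rw [Metric.mem_ball] at hmem ⊢
    have := dist_triangle_left (γ 0) y (γ s)
    linarith
  have hfar : ∀ z z' : Pt d, z ∈ Metric.ball y (2 * ρ) → z' ∉ Metric.ball y (3 * ρ) →
      1 ≤ K * ‖z - z'‖ := by
    intro z z' hz hz'
    have h1 : ρ ≤ ‖z - z'‖ := by
      rw [← dist_eq_norm]
      rw [Metric.mem_ball] at hz hz'
      have := dist_triangle_left z' y z
      linarith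
    have h2 : (1 / ρ) * ρ ≤ K * ‖z - z'‖ := by
      refine mul_le_mul ?_ h1 hρ.le K.2
      rw [hKdef]
      have : 0 ≤ (Lg : ℝ) * L := mul_nonneg Lg.2 hL
      linarith
    rwa [one_div_mul_cancel hρ.ne'] at h2
  have hzero3 : ∀ z : Pt d, z ∉ Metric.ball y (3 * ρ) → z ∉ Metric.ball y (2 * ρ) := fun z hz hz2 =>
    hz (Metric.ball_subset_ball (by linarith) hz2)
  -- Stated for arbitrary curves rather than for `F`, because `hshift` applies it to the tail of a
  -- trajectory, whose starting point may lie outside `Y`.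
  have hcmp : ∀ γ₁ γ₂ : ℝ → Pt d, ∀ s ∈ Icc 0 τ, IsFieldCurve G b 0 s γ₁ →
      IsFieldCurve G b 0 s γ₂ → |g (γ₁ s) - g (γ₂ s)| ≤ K * ‖γ₁ 0 - γ₂ 0‖ := by
    intro γ₁ γ₂ s hs h₁ h₂
    have hnn : 0 ≤ (K : ℝ) * ‖γ₁ 0 - γ₂ 0‖ := by positivity
    by_cases hm₁ : γ₁ 0 ∈ Metric.ball y (3 * ρ)
    · by_cases hm₂ : γ₂ 0 ∈ Metric.ball y (3 * ρ)
      · have hin : ∀ γ : ℝ → Pt d, IsFieldCurve G b 0 s γ → γ 0 ∈ Metric.ball y (3 * ρ) →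
            ∀ t ∈ Icc 0 s, γ t ∈ Metric.ball y (4 * ρ) := by
          intro γ hγ h0 t ht
          have h1 := hmove γ s hs hγ t ht
          rw [Metric.mem_ball] at h0 ⊢
          have := dist_triangle (γ t) (γ 0) y
          linarith
        have h3 := htame 0 s γ₁ γ₂ hs.1 (by linarith [hs.2]) h₁ h₂ (hin γ₁ h₁ hm₁) (hin γ₂ h₂ hm₂)
        have h4 := hg.norm_sub_le (γ₁ s) (γ₂ s)
        rw [Real.norm_eq_abs] at h4
        refine h4.trans ((mul_le_mul_of_nonneg_left h3 Lg.2).trans ?_)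
        rw [hKdef]
        have : 0 ≤ 1 / ρ * ‖γ₁ 0 - γ₂ 0‖ := by positivity
        change (Lg : ℝ) * (L * ‖γ₁ 0 - γ₂ 0‖) ≤ _
        linarith
      · rw [hzero γ₂ s hs h₂ (hzero3 _ hm₂), sub_zero]
        by_cases hm : γ₁ 0 ∈ Metric.ball y (2 * ρ)
        · exact (hgabs _).trans (hfar _ _ hm hm₂)
        · rw [hzero γ₁ s hs h₁ hm, abs_zero]; exact hnn
    · rw [hzero γ₁ s hs h₁ (hzero3 _ hm₁), zero_sub, abs_neg]
      by_cases hm : γ₂ 0 ∈ Metric.ball y (2 * ρ)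
      · rw [norm_sub_rev]
        exact (hgabs _).trans (hfar _ _ hm hm₁)
      · rw [hzero γ₂ s hs h₂ hm, abs_zero]; exact hnn
  have hYcurve : ∀ x ∈ Y, ∀ s ∈ Icc 0 τ, IsFieldCurve G b 0 s (fun t => F t x) := fun x hx s hs =>
    hx.2.2.2.mono le_rfl (hs.2.trans hτT)
  -- the Lipschitz extension
  have hext : ∀ s ∈ Icc 0 τ, ∃ ψ : Pt d → ℝ, LipschitzWith K ψ ∧ (∀ x ∈ Y, ψ x = g (F s x)) ∧
      HasCompactSupport ψ := by
    intro s hs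
    classical
    let u : Pt d → ℝ := fun x => if x ∈ Y then g (F s x) else 0
    have hu : ∀ x ∈ Y, u x = g (F s x) := fun x hx => if_pos hx
    have hu0 : ∀ x ∉ Metric.ball y (3 * ρ), u x = 0 := by
      intro x hx
      by_cases hxY : x ∈ Y
      · rw [hu x hxY]
        exact hzero _ s hs (hYcurve x hxY s hs) (by rw [hxY.2.1]; exact hzero3 _ hx)
      · exact if_neg hxY
    have hu1 : ∀ x ∈ Y, ∀ z ∉ Metric.ball y (3 * ρ), |u x - u z| ≤ K * ‖x - z‖ := by
      intro x hx z hz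
      rw [hu0 z hz, sub_zero, hu x hx]
      by_cases hm : x ∈ Metric.ball y (2 * ρ)
      · exact (hgabs _).trans (hfar _ _ hm hz)
      · rw [hzero _ s hs (hYcurve x hx s hs) (by rw [hx.2.1]; exact hm), abs_zero]
        positivity
    have hlip : LipschitzOnWith K u (Y ∪ (Metric.ball y (3 * ρ))ᶜ) := by
      refine LipschitzOnWith.of_dist_le_mul fun x hx z hz => ?_
      rw [Real.dist_eq, dist_eq_norm]
      rcases hx with hx | hx <;> rcases hz with hz | hz
      · have := hcmp _ _ s hs (hYcurve x hx s hs) (hYcurve z hz s hs)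
        rw [hx.2.1, hz.2.1] at this
        rwa [hu x hx, hu z hz]
      · exact hu1 x hx z hz
      · rw [abs_sub_comm, norm_sub_rev]; exact hu1 z hz x hx
      · rw [hu0 x hx, hu0 z hz, sub_zero, abs_zero]; positivity
    obtain ⟨ψ, hψ, heq⟩ := hlip.extend_real
    refine ⟨ψ, hψ, fun x hx => by rw [← heq (Or.inl hx), hu x hx], ?_⟩
    refine HasCompactSupport.of_support_subset_isCompact (isCompact_closedBall y (3 * ρ)) ?_
    intro x hx
    by_contra hxb
    have hxb' : x ∉ Metric.ball y (3 * ρ) := fun h => hxb (Metric.ball_subset_closedBall h)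
    exact hx (by rw [← heq (Or.inr hxb'), hu0 x hxb'])
  choose! ψ hψlip hψY hψc using hext
  have hψae : ∀ s ∈ Icc 0 τ, (fun x => g (F s x)) =ᵐ[leb Ω] ψ s := by
    intro s hs
    filter_upwards [h.ae_mem_flowDomain] with x hx using (hψY s hs x hx).symm
  have hmeas : ∀ s ∈ Icc 0 τ, AEStronglyMeasurable (fun x => g (F s x)) (leb Ω) := fun s hs =>
    (hψlip s hs).continuous.aestronglyMeasurable.congr (hψae s hs).symm
  have hintegrable : ∀ s ∈ Icc 0 τ, Integrable (fun x => φ x * g (F s x)) (leb Ω) := fun s hs =>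
    h.integrable_φ_mul (hmeas s hs) (Filter.Eventually.of_forall fun x => hgabs _)
  -- This replaces the semigroup property, which is not available. Take `x' ∈ Y` close to `F e x`:
  -- then `ψ s (F e x)` is close to `ψ s x' = g (F s x')`, and by `hcmp` the latter is close to the
  -- value of `g` at the end of the actual tail, `F (s + e) x`.
  have hshift : ∀ x ∈ Y, ∀ s, 0 ≤ s → ∀ e, 0 ≤ e → s + e ≤ τ → ψ s (F e x) = g (F (s + e) x) := by
    intro x hx s hs e he hse
    have hs' : s ∈ Icc 0 τ := ⟨hs, by linarith⟩
    have hxc : IsFieldCurve G b 0 s (fun t => F (t + e) x) := by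
      have := (hx.2.2.2.mono he (show s + e ≤ T by linarith)).comp_add e
      simpa using this
    refine eq_of_forall_dist_le fun ε hε => ?_
    obtain ⟨x', hx', hd⟩ := h.exists_mem_flowDomain_dist_lt
      (hx.2.2.1 e ⟨he, by linarith⟩) (ε := ε / (2 * (K + 1))) (by positivity)
    have h1 := (hψlip s hs').dist_le_mul (F e x) x'
    have h2 := hcmp _ _ s hs' (hYcurve x' hx' s hs') hxc
    rw [hψY s hs' x' hx'] at h1
    simp only [zero_add, hx'.2.1] at h2
    rw [← Real.dist_eq, ← dist_eq_norm] at h2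
    rw [dist_comm] at hd
    rw [dist_comm x'] at h2
    calc dist (ψ s (F e x)) (g (F (s + e) x))
        ≤ dist (ψ s (F e x)) (g (F s x')) + dist (g (F s x')) (g (F (s + e) x)) :=
          dist_triangle _ _ _
      _ ≤ K * dist (F e x) x' + K * dist (F e x) x' := add_le_add h1 h2
      _ = 2 * K * dist (F e x) x' := by ring
      _ ≤ 2 * (K + 1) * (ε / (2 * (K + 1))) := by
          gcongr
          · linarith
      _ = ε := by field_simp
  set a : ℝ → ℝ := fun s => ∫ x in Ω, φ x * g (F s x) with ha
  obtain ⟨gd, hgd, hgdb, hdiv⟩ := h.exists_div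
  have hgint : Integrable gd (leb Ω) := hgd.integrable (by norm_num)
  -- time increments
  have hincr : ∀ x ∈ Y, ∀ s ∈ Icc 0 τ, ∀ s' ∈ Icc 0 τ, s ≤ s' →
      |g (F s' x) - g (F s x)| ≤ Lg * (M * (s' - s)) := by
    intro x hx s hs s' hs' hss
    have h1 := hg.norm_sub_le (F s' x) (F s x)
    rw [Real.norm_eq_abs] at h1
    exact h1.trans (mul_le_mul_of_nonneg_left
      (hx.2.2.2.norm_sub_le h.speed hs.1 hss (hs'.2.trans hτT)) Lg.2)
  have hφabs : ∀ x ∈ G, |φ x| ≤ hi := fun x hx => by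
    have h1 := h.φ_bounds x hx
    rw [abs_of_nonneg (h.lo_pos.le.trans h1.1)]; exact h1.2
  -- By `hshift`, the increment of `g (F · x)` after time `s` is that of `ψ s` along the trajectory
  -- issued from `x` at time `0`. Its slope tends to `fderiv ℝ (ψ s) x (V x / φ x)`; the weight `φ`
  -- cancels the denominator, and the Stokes formula turns the integral into the divergence term.
  have hderiv : ∀ s ∈ Ico 0 τ, HasDerivWithinAt a (-∫ x in Ω, gd x * ψ s x) (Ici s) s := by
    intro s hs
    have hsI : s ∈ Icc 0 τ := Ico_subset_Icc_self hs
    rw [← hasDerivWithinAt_Ioi_iff_Ici,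
      hasDerivWithinAt_iff_tendsto_slope' self_notMem_Ioi,
      ← hdiv.integral_fderiv_of_lipschitz h.integrable_V hgint (hψlip s hsI) (hψc s hsI)]
    have hev : ∀ᶠ s' in nhdsWithin s (Ioi s), s' ∈ Ioo s τ := Ioo_mem_nhdsGT hs.2
    have hslope : ∀ᶠ s' in nhdsWithin s (Ioi s),
        ∫ x in Ω, (s' - s)⁻¹ * (φ x * g (F s' x) - φ x * g (F s x)) = slope a s s' := by
      filter_upwards [hev] with s' hs'
      have hI : s' ∈ Icc 0 τ := ⟨hs.1.trans hs'.1.le, hs'.2.le⟩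
      rw [integral_const_mul, integral_sub (hintegrable s' hI) (hintegrable s hsI), slope_def_field,
        div_eq_inv_mul]
    refine Filter.Tendsto.congr' hslope ?_
    refine tendsto_integral_filter_of_dominated_convergence (fun _ => hi * (Lg * M)) ?_ ?_
      (integrable_const _) ?_
    · filter_upwards [hev] with s' hs'
      have hI : s' ∈ Icc 0 τ := ⟨hs.1.trans hs'.1.le, hs'.2.le⟩
      exact ((hintegrable s' hI).sub (hintegrable s hsI)).aestronglyMeasurable.const_mul _
    · filter_upwards [hev] with s' hs'
      have hI : s' ∈ Icc 0 τ := ⟨hs.1.trans hs'.1.le, hs'.2.le⟩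
      filter_upwards [h.ae_mem_cells, h.ae_mem_flowDomain] with x hx hxY
      have h1 := hincr x hxY s hsI s' hI hs'.1.le
      have hpos : 0 < s' - s := sub_pos.2 hs'.1
      have h2 := hφabs x hx
      have h3 := hg0 x
      rw [← mul_sub, norm_mul, norm_mul, Real.norm_of_nonneg (inv_nonneg.2 hpos.le),
        Real.norm_eq_abs, Real.norm_eq_abs]
      calc (s' - s)⁻¹ * (|φ x| * |g (F s' x) - g (F s x)|)
          ≤ (s' - s)⁻¹ * (hi * (Lg * (M * (s' - s)))) := by
            have : 0 ≤ hi := (abs_nonneg _).trans h2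
            gcongr
        _ = hi * (Lg * M) := by field_simp
    · filter_upwards [h.ae_mem_cells, h.ae_mem_flowDomain,
        ae_restrict_of_ae ((hψlip s hsI).ae_differentiableAt (μ := volume))] with x hx hxY hdiff
      have hd0 : HasDerivWithinAt (fun e => F e x) (b (F 0 x)) (Ici 0) 0 :=
        hxY.2.2.2.hasDerivWithinAt_left h.T_pos h.isOpen_cells
          (((h.φ_cont.inv₀ fun z hz => (h.lo_pos.trans_le (h.φ_bounds z hz).1).ne')).smul h.V_cont)
          (by rw [hxY.2.1]; exact hx)
      have hd1 : HasDerivWithinAt (fun e => ψ s (F e x)) (fderiv ℝ (ψ s) x (b x)) (Ici 0) 0 := by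
        have hdf : HasFDerivAt (ψ s) (fderiv ℝ (ψ s) x) (F 0 x) := by
          rw [hxY.2.1]; exact hdiff.hasFDerivAt
        have := hdf.comp_hasDerivWithinAt (0 : ℝ) hd0
        rwa [hxY.2.1] at this
      rw [← hasDerivWithinAt_Ioi_iff_Ici,
      hasDerivWithinAt_iff_tendsto_slope' self_notMem_Ioi] at hd1
      have hsh : Filter.Tendsto (fun s' => s' - s) (nhdsWithin s (Ioi s))
          (nhdsWithin 0 (Ioi 0)) := by
        refine tendsto_nhdsWithin_iff.2 ⟨?_, ?_⟩
        · have : ContinuousAt (fun s' : ℝ => s' - s) s := by fun_prop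
          simpa [ContinuousAt] using this.tendsto.mono_left nhdsWithin_le_nhds
        · filter_upwards [self_mem_nhdsWithin] with s' hs'
          exact sub_pos.2 (mem_Ioi.1 hs')
      have hd2 := (hd1.comp hsh).const_mul (φ x)
      rw [h.V_eq hx, map_smul, smul_eq_mul]
      refine hd2.congr' ?_
      filter_upwards [hev] with s' hs'
      have e1 := hshift x hxY s hs.1 (s' - s) (by linarith [hs'.1]) (by linarith [hs'.2])
      have e2 := hshift x hxY s hs.1 0 le_rfl (by linarith [hs.2])
      rw [add_sub_cancel] at e1
      rw [add_zero] at e2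
      simp only [Function.comp, slope_def_field, e1, e2, sub_zero]
      ring
  have hcont : ContinuousOn a (Icc 0 τ) := by
    have hle : ∀ s ∈ Icc 0 τ, ∀ s' ∈ Icc 0 τ, s ≤ s' →
        |a s' - a s| ≤ hi * (Lg * M) * volume.real Ω * (s' - s) := by
      intro s hs s' hs' hss
      have e : a s' - a s = ∫ x in Ω, (φ x * g (F s' x) - φ x * g (F s x)) :=
        (integral_sub (hintegrable s' hs') (hintegrable s hs)).symm
      rw [e, ← Real.norm_eq_abs]
      refine (norm_integral_le_of_norm_le_const (C := hi * (Lg * M) * (s' - s)) ?_).trans_eq ?_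
      · filter_upwards [h.ae_mem_cells, h.ae_mem_flowDomain] with x hx hxY
        have h1 := hincr x hxY s hs s' hs' hss
        have h2 := hφabs x hx
        rw [← mul_sub, norm_mul, Real.norm_eq_abs, Real.norm_eq_abs]
        calc |φ x| * |g (F s' x) - g (F s x)| ≤ hi * (Lg * (M * (s' - s))) := by
              have : 0 ≤ hi := (abs_nonneg _).trans h2
              gcongr
          _ = _ := by ring
      · simp only [measureReal_restrict_apply_univ]; ring
    have hlip : LipschitzOnWith (Real.toNNReal (hi * (Lg * M) * volume.real Ω)) a (Icc 0 τ) := by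
      refine LipschitzOnWith.of_dist_le_mul fun s hs s' hs' => ?_
      rw [Real.dist_eq, Real.dist_eq]
      rcases le_total s s' with hss | hss
      · rw [abs_sub_comm, abs_sub_comm s, abs_of_nonneg (sub_nonneg.2 hss)]
        exact (hle s hs s' hs' hss).trans
          (mul_le_mul_of_nonneg_right (Real.le_coe_toNNReal _) (sub_nonneg.2 hss))
      · rw [abs_of_nonneg (sub_nonneg.2 hss)]
        exact (hle s' hs' s hs hss).trans
          (mul_le_mul_of_nonneg_right (Real.le_coe_toNNReal _) (sub_nonneg.2 hss))
    exact hlip.continuousOn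
  have hanonneg : ∀ s, 0 ≤ a s := fun s => by
    refine integral_nonneg_of_ae ?_
    filter_upwards [h.ae_mem_cells] with x hx
    exact mul_nonneg (h.lo_pos.le.trans (h.φ_bounds x hx).1) (hg0 _)
  -- Since `φ / lo ≥ 1`, the weight can be put back into the integral, which produces the rate `Cd /
  -- lo`.
  have hbound : ∀ s ∈ Ico 0 τ, ‖-∫ x in Ω, gd x * ψ s x‖ ≤ Cd / lo * ‖a s‖ + 0 := by
    intro s hs
    have hsI : s ∈ Icc 0 τ := Ico_subset_Icc_self hs
    rw [norm_neg, add_zero, Real.norm_of_nonneg (hanonneg s), ← integral_const_mul]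
    refine norm_integral_le_of_norm_le ((hintegrable s hsI).const_mul _) ?_
    filter_upwards [h.ae_mem_cells, hgdb, hψae s hsI] with x hx hxg hxψ
    rw [← hxψ, norm_mul, Real.norm_eq_abs, Real.norm_of_nonneg (hg0 _)]
    have h1 := (h.φ_bounds x hx).1
    have h3 : 1 ≤ φ x / lo := by rwa [one_le_div h.lo_pos]
    calc |gd x| * g (F s x) ≤ Cd * g (F s x) := mul_le_mul_of_nonneg_right hxg (hg0 _)
      _ = Cd * g (F s x) * 1 := by ring
      _ ≤ Cd * g (F s x) * (φ x / lo) :=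
          mul_le_mul_of_nonneg_left h3 (mul_nonneg h.Cd_nonneg (hg0 _))
      _ = _ := by ring
  refine ⟨hmeas σ hσ, ?_⟩
  have hgr := norm_le_gronwallBound_of_norm_deriv_right_le hcont hderiv
    (δ := a 0) (K := Cd / lo) (ε := 0)
    (by rw [Real.norm_of_nonneg (hanonneg 0)]) hbound σ hσ
  rw [Real.norm_of_nonneg (hanonneg σ), gronwallBound_ε0, sub_zero] at hgr
  have ha0 : a 0 = ∫ x in Ω, φ x * g x := by
    refine integral_congr_ae ?_
    filter_upwards [h.ae_mem_flowDomain] with x hx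
    rw [hx.2.1]
  rw [← ha0, mul_comm]
  exact hgr

end FlowSetting

end Ellam

/-! ### From short times to all times, along tame trajectories -/

namespace Ellam

/-- The distance to the complement enters as one closed condition for each `w ∉ U`, which needs no
separate case when `U` is the whole space. -/
theorem exists_compact_exhaustion {E : Type*} [PseudoMetricSpace E] [ProperSpace E] (x₀ : E)
    {U : Set E} (hU : IsOpen U) :
    ∃ K : ℕ → Set E, Monotone K ∧ (∀ m, IsCompact (K m)) ∧ (∀ m, K m ⊆ U) ∧
      ∀ C, IsCompact C → C ⊆ U → ∃ m, C ⊆ K m := by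
  refine ⟨fun m => Metric.closedBall x₀ m ∩ {z | ∀ w ∉ U, 1 / ((m : ℝ) + 1) ≤ dist z w},
    fun m m' hm => ?_, fun m => ?_, fun m z hz => ?_, fun C hC hCU => ?_⟩
  · refine inter_subset_inter (Metric.closedBall_subset_closedBall (by exact_mod_cast hm))
      fun z hz w hw => (one_div_le_one_div_of_le (by positivity) ?_).trans (hz w hw)
    have : (m : ℝ) ≤ m' := by exact_mod_cast hm
    linarith
  · refine (isCompact_closedBall x₀ _).inter_right ?_
    simp only [ofPred_forall]
    exact isClosed_iInter fun w => isClosed_iInter fun _ =>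
      isClosed_le continuous_const (continuous_id.dist continuous_const)
  · by_contra h
    have h1 := hz.2 z h
    rw [dist_self] at h1
    exact absurd h1 (not_le.2 (by positivity))
  · obtain ⟨δ, hδ, hsub⟩ := hC.exists_thickening_subset_open hU hCU
    obtain ⟨R, hR⟩ := hC.isBounded.subset_closedBall x₀
    obtain ⟨m₁, hm₁⟩ := exists_nat_ge R
    obtain ⟨m₂, hm₂⟩ := exists_nat_one_div_lt hδ
    refine ⟨max m₁ m₂, fun z hz => ⟨?_, fun w hw => ?_⟩⟩
    · refine Metric.closedBall_subset_closedBall ?_ (hR hz)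
      exact hm₁.trans (by exact_mod_cast le_max_left _ _)
    · have h1 : δ ≤ dist z w := by
        by_contra hlt
        rw [not_le] at hlt
        exact hw (hsub (Metric.mem_thickening_iff.2 ⟨z, hz, by rwa [dist_comm]⟩))
      refine le_trans ?_ (hm₂.le.trans h1)
      refine one_div_le_one_div_of_le (by positivity) ?_
      have : (m₂ : ℝ) ≤ (max m₁ m₂ : ℕ) := by exact_mod_cast le_max_right _ _
      linarith

namespace FlowSetting

variable {d : ℕ} {Ω G : Set (Pt d)} {T lo hi M Cd : ℝ} {φ : Pt d → ℝ} {V : Pt d → Pt d}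
  {F : ℝ → Pt d → Pt d}

theorem isFiniteMeasure_porousMeasure (h : FlowSetting Ω G T lo hi M Cd φ V F) :
    IsFiniteMeasure (porousMeasure Ω φ) := by
  have := h.integrable_φ_mul (f := fun _ => 1) aestronglyMeasurable_const (B := 1)
    (Filter.Eventually.of_forall fun x => by simp)
  simp only [mul_one] at this
  exact isFiniteMeasure_withDensity_ofReal this.2

theorem porousMeasure_absolutelyContinuous : porousMeasure Ω φ ≪ leb Ω :=
  withDensity_absolutelyContinuous _ _

theorem lintegral_porousMeasure (h : FlowSetting Ω G T lo hi M Cd φ V F) {f : Pt d → ℝ}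
    (hf : AEStronglyMeasurable f (leb Ω)) (hf0 : ∀ᵐ x ∂leb Ω, 0 ≤ f x) {B : ℝ}
    (hB : ∀ᵐ x ∂leb Ω, ‖f x‖ ≤ B) :
    ∫⁻ x, ENNReal.ofReal (f x) ∂porousMeasure Ω φ = ENNReal.ofReal (∫ x in Ω, φ x * f x) := by
  rw [porousMeasure, lintegral_withDensity_eq_lintegral_mul₀
    h.aestronglyMeasurable_φ.aemeasurable.ennreal_ofReal hf.aemeasurable.ennreal_ofReal,
    ofReal_integral_eq_lintegral_ofReal (h.integrable_φ_mul hf hB)]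
  · refine lintegral_congr_ae ?_
    filter_upwards [h.ae_mem_cells] with x hx
    rw [Pi.mul_apply, ENNReal.ofReal_mul (h.lo_pos.le.trans (h.φ_bounds x hx).1)]
  · filter_upwards [h.ae_mem_cells, hf0] with x hx hx0
    exact mul_nonneg (h.lo_pos.le.trans (h.φ_bounds x hx).1) hx0

theorem porousMeasure_compl_flowDomain (h : FlowSetting Ω G T lo hi M Cd φ V F) :
    porousMeasure Ω φ (flowDomain Ω G T φ V F)ᶜ = 0 :=
  porousMeasure_absolutelyContinuous h.ae_mem_flowDomain

/-- Near a tame point the flow expands volumes at most exponentially. -/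
theorem exists_flow_box (h : FlowSetting Ω G T lo hi M Cd φ V F) {y : Pt d}
    (hy : IsTame G (transportField φ V) y) :
    ∃ ρ > 0, ∃ τ ∈ Ioc 0 T, (∀ σ ∈ Icc 0 τ, ∀ γ₁ γ₂ : ℝ → Pt d,
        IsFieldCurve G (transportField φ V) 0 σ γ₁ → IsFieldCurve G (transportField φ V) 0 σ γ₂ →
        γ₁ 0 = γ₂ 0 → γ₁ 0 ∈ Metric.ball y ρ → γ₁ σ = γ₂ σ) ∧
      ∀ σ ∈ Icc 0 τ, ∀ B, MeasurableSet B → B ⊆ Metric.ball y ρ →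
        porousMeasure Ω φ {x | x ∈ flowDomain Ω G T φ V F ∧ F σ x ∈ B}
          ≤ ENNReal.ofReal (Real.exp (Cd / lo * σ)) * porousMeasure Ω φ B := by
  have hfin := h.isFiniteMeasure_porousMeasure
  obtain ⟨r, hr, τ₀, hτ₀, L, hL, htame⟩ := hy
  -- Starting in `ball y ρ` and moving by at most `ρ`, a curve stays in the ball of radius `4ρ = r`
  -- where tameness applies.
  set ρ := r / 4 with hρdef
  have hρ : 0 < ρ := by positivity
  have hr4 : r = 4 * ρ := by rw [hρdef]; ring
  -- The bound `ρ / (M + 1)` ensures `M * τ ≤ ρ`, also when `M = 0`.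
  set τ := min (min τ₀ (ρ / (M + 1))) T with hτdef
  have hM := h.M_nonneg
  have hτ : 0 < τ := lt_min (lt_min hτ₀ (by positivity)) h.T_pos
  have hττ : τ ≤ τ₀ := (min_le_left _ _).trans (min_le_left _ _)
  have hMτ : M * τ ≤ ρ := by
    have h1 : τ ≤ ρ / (M + 1) := (min_le_left _ _).trans (min_le_right _ _)
    rw [le_div_iff₀ (by positivity)] at h1
    nlinarith
  rw [hr4] at htame
  refine ⟨ρ, hρ, τ, ⟨hτ, min_le_right _ _⟩, ?_, ?_⟩
  · intro σ hσ γ₁ γ₂ h₁ h₂ h0 hmem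
    have hin : ∀ γ : ℝ → Pt d, IsFieldCurve G (transportField φ V) 0 σ γ →
        γ 0 ∈ Metric.ball y ρ → ∀ t ∈ Icc 0 σ, γ t ∈ Metric.ball y (4 * ρ) := by
      intro γ hγ hγ0 t ht
      have h1 := hγ.norm_sub_le h.speed le_rfl ht.1 ht.2
      have h2 : M * (t - 0) ≤ M * τ := mul_le_mul_of_nonneg_left (by linarith [ht.2, hσ.2]) hM
      rw [← dist_eq_norm] at h1
      rw [Metric.mem_ball] at hγ0 ⊢
      have := dist_triangle (γ t) (γ 0) y
      linarith
    have h1 := htame 0 σ γ₁ γ₂ hσ.1 (by linarith [hσ.2]) h₁ h₂ (hin γ₁ h₁ hmem)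
      (hin γ₂ h₂ (h0 ▸ hmem))
    rw [h0, sub_self, norm_zero, mul_zero] at h1
    exact sub_eq_zero.1 (norm_le_zero_iff.1 h1)
  intro σ hσ
  have hopen : ∀ O, IsOpen O → O ⊆ Metric.ball y ρ →
      porousMeasure Ω φ {x | x ∈ flowDomain Ω G T φ V F ∧ F σ x ∈ O}
        ≤ ENNReal.ofReal (Real.exp (Cd / lo * σ)) * porousMeasure Ω φ O := by
    intro O hO hOsub
    obtain ⟨g, hlip, h0, h1, hoff, hmono, hone⟩ := exists_lipschitz_approx_indicator hO
    -- These sets may fail to be measurable. Continuity from below along an increasing union still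
    -- holds for the outer measure.
    have hset : {x | x ∈ flowDomain Ω G T φ V F ∧ F σ x ∈ O}
        = ⋃ k, {x | x ∈ flowDomain Ω G T φ V F ∧ g k (F σ x) = 1} := by
      ext x
      simp only [mem_iUnion, mem_ofPred_eq]
      constructor
      · rintro ⟨hx, hxO⟩
        obtain ⟨k, hk⟩ := hone _ hxO
        exact ⟨k, hx, hk⟩
      · rintro ⟨k, hx, hk⟩
        refine ⟨hx, ?_⟩
        by_contra hno
        rw [hoff k _ hno] at hk
        exact zero_ne_one hk
    have hmn : Monotone fun k => {x | x ∈ flowDomain Ω G T φ V F ∧ g k (F σ x) = 1} := by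
      rintro i j hij x ⟨hx, hk⟩
      exact ⟨hx, le_antisymm (h1 _ _) (hk ▸ hmono _ hij)⟩
    rw [hset, hmn.measure_iUnion]
    refine iSup_le fun k => ?_
    obtain ⟨Lg, hLg⟩ := hlip k
    obtain ⟨hmeas, hint⟩ := h.integral_comp_flow_le hρ (min_le_right _ _) hMτ hL
      (fun α β γ₁ γ₂ hab hle => htame α β γ₁ γ₂ hab (hle.trans hττ)) hLg (h0 k) (h1 k)
      (fun x hx => hoff k x fun hxO => hx (hOsub hxO)) hσ
    have hb1 : ∀ x, ‖g k x‖ ≤ 1 := fun x => by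
      rw [Real.norm_of_nonneg (h0 k x)]; exact h1 k x
    have hmeasμ : AEMeasurable (fun x => ENNReal.ofReal (g k (F σ x))) (porousMeasure Ω φ) :=
      (hmeas.aemeasurable.mono_ac porousMeasure_absolutelyContinuous).ennreal_ofReal
    calc porousMeasure Ω φ {x | x ∈ flowDomain Ω G T φ V F ∧ g k (F σ x) = 1}
        ≤ porousMeasure Ω φ {x | 1 ≤ ENNReal.ofReal (g k (F σ x))} :=
          measure_mono fun x hx => by simp [hx.2]
      _ ≤ ∫⁻ x, ENNReal.ofReal (g k (F σ x)) ∂porousMeasure Ω φ := by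
          have := mul_meas_ge_le_lintegral₀ hmeasμ 1
          rwa [one_mul] at this
      _ = ENNReal.ofReal (∫ x in Ω, φ x * g k (F σ x)) :=
          h.lintegral_porousMeasure hmeas (Filter.Eventually.of_forall fun x => h0 k _)
            (Filter.Eventually.of_forall fun x => hb1 _)
      _ ≤ ENNReal.ofReal (Real.exp (Cd / lo * σ) * ∫ x in Ω, φ x * g k x) :=
          ENNReal.ofReal_le_ofReal hint
      _ = ENNReal.ofReal (Real.exp (Cd / lo * σ)) *
            ∫⁻ x, ENNReal.ofReal (g k x) ∂porousMeasure Ω φ := by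
          rw [ENNReal.ofReal_mul (Real.exp_pos _).le,
            h.lintegral_porousMeasure hLg.continuous.aestronglyMeasurable
              (Filter.Eventually.of_forall fun x => h0 k _)
              (Filter.Eventually.of_forall fun x => hb1 _)]
      _ ≤ ENNReal.ofReal (Real.exp (Cd / lo * σ)) * porousMeasure Ω φ O := by
          gcongr
          rw [← lintegral_indicator_one hO.measurableSet]
          refine lintegral_mono fun x => ?_
          by_cases hx : x ∈ O
          · rw [indicator_of_mem hx, Pi.one_apply]
            exact ENNReal.ofReal_le_one.2 (h1 k x)
          · simp [hoff k x hx]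
  intro B hB hBsub
  -- Outer regularity passes from open sets to `B`; the excess `ε / A` becomes `ε` once multiplied
  -- by the expansion factor `A`.
  refine ENNReal.le_of_forall_pos_le_add fun ε hε _ => ?_
  set A := ENNReal.ofReal (Real.exp (Cd / lo * σ)) with hA
  have hA0 : A ≠ 0 := by simp [hA, Real.exp_pos]
  have hAt : A ≠ ⊤ := ENNReal.ofReal_ne_top
  obtain ⟨U, hBU, hU, hμU⟩ := B.exists_isOpen_lt_add (μ := porousMeasure Ω φ)
    (measure_ne_top _ _) (ε := ε / A) (ENNReal.div_ne_zero.2 ⟨by exact_mod_cast hε.ne', hAt⟩)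
  calc porousMeasure Ω φ {x | x ∈ flowDomain Ω G T φ V F ∧ F σ x ∈ B}
      ≤ porousMeasure Ω φ {x | x ∈ flowDomain Ω G T φ V F ∧ F σ x ∈ U ∩ Metric.ball y ρ} :=
        measure_mono fun x hx => ⟨hx.1, hBU hx.2, hBsub hx.2⟩
    _ ≤ A * porousMeasure Ω φ (U ∩ Metric.ball y ρ) :=
        hopen _ (hU.inter Metric.isOpen_ball) inter_subset_right
    _ ≤ A * (porousMeasure Ω φ B + ε / A) := by
        gcongr
        exact (measure_mono inter_subset_left).trans hμU.le
    _ = A * porousMeasure Ω φ B + ε := by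
        rw [mul_add, ENNReal.mul_div_cancel hA0 hAt]

theorem exists_uniform_flow_box (h : FlowSetting Ω G T lo hi M Cd φ V F) {Q : Set (Pt d)}
    (hQ : IsCompact Q) (hQt : ∀ y ∈ Q, IsTame G (transportField φ V) y) :
    ∃ τ ∈ Ioc 0 T, (∀ σ ∈ Icc 0 τ, ∀ γ₁ γ₂ : ℝ → Pt d,
        IsFieldCurve G (transportField φ V) 0 σ γ₁ → IsFieldCurve G (transportField φ V) 0 σ γ₂ →
        γ₁ 0 = γ₂ 0 → γ₁ 0 ∈ Q → γ₁ σ = γ₂ σ) ∧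
      ∀ σ ∈ Icc 0 τ, ∀ B, porousMeasure Ω φ {x | x ∈ flowDomain Ω G T φ V F ∧ F σ x ∈ B ∩ Q}
          ≤ ENNReal.ofReal (Real.exp (Cd / lo * σ)) * porousMeasure Ω φ B := by
  have key : ∃ s', Q ⊆ s' ∧ MeasurableSet s' ∧ ∃ τ ∈ Ioc 0 T,
      (∀ σ ∈ Icc 0 τ, ∀ γ₁ γ₂ : ℝ → Pt d,
        IsFieldCurve G (transportField φ V) 0 σ γ₁ → IsFieldCurve G (transportField φ V) 0 σ γ₂ →
        γ₁ 0 = γ₂ 0 → γ₁ 0 ∈ s' → γ₁ σ = γ₂ σ) ∧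
      ∀ σ ∈ Icc 0 τ, ∀ B, MeasurableSet B → B ⊆ s' →
        porousMeasure Ω φ {x | x ∈ flowDomain Ω G T φ V F ∧ F σ x ∈ B}
          ≤ ENNReal.ofReal (Real.exp (Cd / lo * σ)) * porousMeasure Ω φ B := by
    refine hQ.induction_on (p := fun Q => ∃ s', Q ⊆ s' ∧ MeasurableSet s' ∧ ∃ τ ∈ Ioc 0 T,
      (∀ σ ∈ Icc 0 τ, ∀ γ₁ γ₂ : ℝ → Pt d,
        IsFieldCurve G (transportField φ V) 0 σ γ₁ → IsFieldCurve G (transportField φ V) 0 σ γ₂ →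
        γ₁ 0 = γ₂ 0 → γ₁ 0 ∈ s' → γ₁ σ = γ₂ σ) ∧
      ∀ σ ∈ Icc 0 τ, ∀ B, MeasurableSet B → B ⊆ s' →
        porousMeasure Ω φ {x | x ∈ flowDomain Ω G T φ V F ∧ F σ x ∈ B}
          ≤ ENNReal.ofReal (Real.exp (Cd / lo * σ)) * porousMeasure Ω φ B) ?_ ?_ ?_ ?_
    · refine ⟨∅, subset_rfl, MeasurableSet.empty, T, ⟨h.T_pos, le_rfl⟩,
        fun σ _ γ₁ γ₂ _ _ _ hm => absurd hm (notMem_empty _), fun σ _ B _ hB => ?_⟩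
      rw [subset_empty_iff.1 hB]
      simp
    · rintro s t hst ⟨s', hs', hrest⟩
      exact ⟨s', hst.trans hs', hrest⟩
    · rintro s t ⟨s', hs, hsm, τ₁, hτ₁, hu₁, hb₁⟩ ⟨t', ht, htm, τ₂, hτ₂, hu₂, hb₂⟩
      refine ⟨s' ∪ t', union_subset_union hs ht, hsm.union htm, min τ₁ τ₂,
        ⟨lt_min hτ₁.1 hτ₂.1, (min_le_left _ _).trans hτ₁.2⟩, ?_, ?_⟩
      · rintro σ hσ γ₁ γ₂ h₁ h₂ h0 (hm | hm)
        · exact hu₁ σ ⟨hσ.1, hσ.2.trans (min_le_left _ _)⟩ γ₁ γ₂ h₁ h₂ h0 hm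
        · exact hu₂ σ ⟨hσ.1, hσ.2.trans (min_le_right _ _)⟩ γ₁ γ₂ h₁ h₂ h0 hm
      · intro σ hσ B hB hBsub
        have e1 := hb₁ σ ⟨hσ.1, hσ.2.trans (min_le_left _ _)⟩ (B ∩ s') (hB.inter hsm)
          inter_subset_right
        have e2 := hb₂ σ ⟨hσ.1, hσ.2.trans (min_le_right _ _)⟩ (B \ s') (hB.diff hsm)
          fun x hx => (hBsub hx.1).resolve_left hx.2
        rw [← measure_inter_add_sdiff B hsm, mul_add]
        refine le_trans ?_ (add_le_add e1 e2)
        refine (measure_mono fun x hx => ?_).trans (measure_union_le _ _)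
        by_cases hxs : F σ x ∈ s'
        · exact Or.inl ⟨hx.1, hx.2, hxs⟩
        · exact Or.inr ⟨hx.1, hx.2, hxs⟩
    · intro y hy
      obtain ⟨ρ, hρ, τ, hτ, hu, hb⟩ := h.exists_flow_box (hQt y hy)
      exact ⟨Metric.ball y ρ, mem_nhdsWithin_of_mem_nhds (Metric.ball_mem_nhds y hρ),
        Metric.ball y ρ, subset_rfl, measurableSet_ball, τ, hτ, hu, hb⟩
  obtain ⟨s', hs, hsm, τ, hτ, hu, hb⟩ := key
  refine ⟨τ, hτ, fun σ hσ γ₁ γ₂ h₁ h₂ h0 hm => hu σ hσ γ₁ γ₂ h₁ h₂ h0 (hs hm), fun σ hσ B => ?_⟩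
  have e := hb σ hσ (toMeasurable (porousMeasure Ω φ) B ∩ s')
    ((measurableSet_toMeasurable _ _).inter hsm) inter_subset_right
  have hsub : {x | x ∈ flowDomain Ω G T φ V F ∧ F σ x ∈ B ∩ Q} ⊆ {x | x ∈ flowDomain Ω G T φ V F ∧
      F σ x ∈ toMeasurable (porousMeasure Ω φ) B ∩ s'} :=
    fun x hx => ⟨hx.1, subset_toMeasurable _ _ hx.2.1, hs hx.2.2⟩
  refine (measure_mono hsub).trans (e.trans (mul_le_mul_right ?_ _))
  exact (measure_mono inter_subset_left).trans (measure_toMeasurable _).le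

/-- The interval `[0, t]` is cut into `k` steps of length `σ ≤ τ`. The factors `exp(Cd σ / lo)`
multiply to `exp(Cd t / lo)` whatever `k` is, so the bound does not depend on `Q`. -/
theorem measure_flow_preimage_compact_le (h : FlowSetting Ω G T lo hi M Cd φ V F) {Q : Set (Pt d)}
    (hQ : IsCompact Q) (hQt : ∀ y ∈ Q, IsTame G (transportField φ V) y) {t : ℝ} (ht : t ∈ Icc 0 T)
    (B : Set (Pt d)) :
    porousMeasure Ω φ {x | x ∈ flowDomain Ω G T φ V F ∧ (∀ s ∈ Icc 0 t, F s x ∈ Q) ∧ F t x ∈ B}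
      ≤ ENNReal.ofReal (Real.exp (Cd / lo * t)) * porousMeasure Ω φ B := by
  obtain ⟨τ, hτ, hu, hb⟩ := h.exists_uniform_flow_box hQ hQt
  obtain ⟨k, hk⟩ := exists_nat_gt (t / τ)
  have hk0 : (0 : ℝ) < k := lt_of_le_of_lt (div_nonneg ht.1 hτ.1.le) hk
  set σ := t / k with hσdef
  have hσ : σ ∈ Icc 0 τ := by
    refine ⟨div_nonneg ht.1 hk0.le, ?_⟩
    rw [div_lt_iff₀ hτ.1] at hk
    rw [hσdef, div_le_iff₀ hk0]
    linarith
  have hkσ : k * σ = t := by rw [hσdef]; field_simp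
  have step : ∀ j : ℕ, j ≤ k → ∀ B, porousMeasure Ω φ {x | x ∈ flowDomain Ω G T φ V F ∧
      (∀ i ≤ j, F (i * σ) x ∈ Q) ∧ F (j * σ) x ∈ B}
      ≤ ENNReal.ofReal (Real.exp (Cd / lo * (j * σ))) * porousMeasure Ω φ B := by
    intro j
    induction j with
    | zero =>
      intro _ B
      simp only [Nat.cast_zero, zero_mul, mul_zero, Real.exp_zero, ENNReal.ofReal_one, one_mul]
      exact measure_mono fun x hx => by
        have := hx.2.2
        rwa [hx.1.2.1] at this
    | succ j ih =>
      intro hj B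
      have ih' := ih (Nat.le_of_succ_le hj)
      have hjT : (j : ℝ) * σ + σ ≤ T := by
        have h1 : ((j + 1 : ℕ) : ℝ) ≤ k := by exact_mod_cast hj
        push_cast at h1
        nlinarith [hσ.1, ht.2]
      have hj0 : 0 ≤ (j : ℝ) * σ := mul_nonneg (by positivity) hσ.1
      -- The point `F (j * σ) x` may be outside the flow domain; such `x` form a null set, by the
      -- induction hypothesis applied to the null complement. Otherwise uniqueness identifies the
      -- tail of the trajectory with the flow restarted at `F (j * σ) x`, and the hypothesis is
      -- applied to the preimage of `B ∩ Q` under `F σ`.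
      have hsub : {x | x ∈ flowDomain Ω G T φ V F ∧
          (∀ i ≤ j + 1, F (i * σ) x ∈ Q) ∧ F ((j + 1 : ℕ) * σ) x ∈ B} ⊆
          {x | x ∈ flowDomain Ω G T φ V F ∧ (∀ i ≤ j, F (i * σ) x ∈ Q) ∧
            F (j * σ) x ∈ (flowDomain Ω G T φ V F)ᶜ} ∪
          {x | x ∈ flowDomain Ω G T φ V F ∧ (∀ i ≤ j, F (i * σ) x ∈ Q) ∧
            F (j * σ) x ∈ {z | z ∈ flowDomain Ω G T φ V F ∧ F σ z ∈ B ∩ Q}} := by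
        rintro x ⟨hx, hxQ, hxB⟩
        have hxQ' : ∀ i ≤ j, F (i * σ) x ∈ Q := fun i hi => hxQ i (hi.trans (Nat.le_succ j))
        by_cases hz : F (j * σ) x ∈ flowDomain Ω G T φ V F
        · refine Or.inr ⟨hx, hxQ', hz, ?_⟩
          have hc : IsFieldCurve G (transportField φ V) 0 σ (fun s => F (s + j * σ) x) := by
            have := (hx.2.2.2.mono hj0 hjT).comp_add (j * σ)
            simpa using this
          have := hu σ hσ (fun s => F (s + j * σ) x) (fun s => F s (F (j * σ) x)) hc
            (hz.2.2.2.mono le_rfl (hσ.2.trans hτ.2)) (by simp [hz.2.1])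
            (by simpa using hxQ' j le_rfl)
          have e : σ + j * σ = (j + 1 : ℕ) * σ := by push_cast; ring
          rw [← this, e]
          exact ⟨hxB, hxQ (j + 1) le_rfl⟩
        · exact Or.inl ⟨hx, hxQ', hz⟩
      refine (measure_mono hsub).trans ((measure_union_le _ _).trans ?_)
      have e1 := ih' (flowDomain Ω G T φ V F)ᶜ
      rw [h.porousMeasure_compl_flowDomain, mul_zero] at e1
      have e2 := (ih' {z | z ∈ flowDomain Ω G T φ V F ∧ F σ z ∈ B ∩ Q}).trans
        (mul_le_mul_right (hb σ hσ B) _)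
      refine (add_le_add e1 e2).trans_eq ?_
      rw [zero_add, ← mul_assoc, ← ENNReal.ofReal_mul (Real.exp_pos _).le, ← Real.exp_add]
      congr 3
      push_cast; ring
  have := step k le_rfl B
  rw [hkσ] at this
  refine (measure_mono fun x hx => ?_).trans this
  refine ⟨hx.1, fun i hi => hx.2.1 _ ⟨mul_nonneg (by positivity) hσ.1, ?_⟩, hx.2.2⟩
  rw [← hkσ]
  exact mul_le_mul_of_nonneg_right (by exact_mod_cast hi) hσ.1

/-- Expansion estimate along the curves that only meet tame points. -/
theorem measure_flow_preimage_tame_le (h : FlowSetting Ω G T lo hi M Cd φ V F) {t : ℝ}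
    (ht : t ∈ Icc 0 T) (B : Set (Pt d)) :
    porousMeasure Ω φ {x | x ∈ flowDomain Ω G T φ V F ∧
        (∀ s ∈ Icc 0 t, IsTame G (transportField φ V) (F s x)) ∧ F t x ∈ B}
      ≤ ENNReal.ofReal (Real.exp (Cd / lo * t)) * porousMeasure Ω φ B := by
  obtain ⟨Q, hmono, hcomp, hsub, hex⟩ := exists_compact_exhaustion (0 : Pt d)
    (isOpen_isTame (G := G) (b := transportField φ V))
  have hset : {x | x ∈ flowDomain Ω G T φ V F ∧
        (∀ s ∈ Icc 0 t, IsTame G (transportField φ V) (F s x)) ∧ F t x ∈ B}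
      ⊆ ⋃ m, {x | x ∈ flowDomain Ω G T φ V F ∧ (∀ s ∈ Icc 0 t, F s x ∈ Q m) ∧ F t x ∈ B} := by
    rintro x ⟨hx, hxt, hxB⟩
    have hc : IsCompact ((fun s => F s x) '' Icc 0 t) :=
      isCompact_Icc.image_of_continuousOn
        (hx.2.2.2.continuousOn.mono (Icc_subset_Icc le_rfl ht.2))
    obtain ⟨m, hm⟩ := hex _ hc (by rintro _ ⟨s, hs, rfl⟩; exact hxt s hs)
    exact mem_iUnion.2 ⟨m, hx, fun s hs => hm ⟨s, hs, rfl⟩, hxB⟩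
  refine (measure_mono hset).trans ?_
  rw [Monotone.measure_iUnion]
  · exact iSup_le fun m => h.measure_flow_preimage_compact_le (hcomp m) (hsub m) ht B
  · rintro m m' hm x ⟨hx, hxQ, hxB⟩
    exact ⟨hx, fun s hs => hmono hm (hxQ s hs), hxB⟩

end FlowSetting

end Ellam

/-! ### Volumes of hyperplanes and slabs -/

namespace Ellam

theorem volume_hyperplane {d : ℕ} {n : Pt d} (hn : n ≠ 0) (a : ℝ) :
    volume {x : Pt d | inner ℝ n x = a} = 0 := by
  have hnn : (inner ℝ n n : ℝ) ≠ 0 := inner_self_ne_zero.2 hn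
  set z : Pt d := (a / inner ℝ n n : ℝ) • n with hz
  have hnz : inner ℝ n z = a := by
    rw [hz, inner_smul_right, div_mul_cancel₀ _ hnn]
  have hne : AffineSubspace.mk' z (LinearMap.ker (innerSL ℝ n : Pt d →ₗ[ℝ] ℝ)) ≠ ⊤ := by
    intro htop
    have : z + n ∈ AffineSubspace.mk' z (LinearMap.ker (innerSL ℝ n : Pt d →ₗ[ℝ] ℝ)) := by
      rw [htop]; trivial
    rw [AffineSubspace.mem_mk'] at this
    simp [hn] at this
  refine measure_mono_null (fun x hx => ?_) (Measure.addHaar_affineSubspace volume _ hne)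
  have hx' : inner ℝ n x = a := hx
  change x ∈ AffineSubspace.mk' z (LinearMap.ker (innerSL ℝ n : Pt d →ₗ[ℝ] ℝ))
  rw [AffineSubspace.mem_mk']
  simp [inner_sub_right, hx', hnz]

/-- Translation packing: in a bounded region, the intersection of `k` slabs of width `δ` with
independent normals has volume of order `δ ^ k`. -/
theorem volume_ball_inter_slabs_le {d k : ℕ} {n v : Fin k → Pt d}
    (hv : ∀ i j, inner ℝ (n i) (v j) = if i = j then (1 : ℝ) else 0) (R : ℝ) {δ : ℝ} (hδ : 0 < δ)
    (hδ1 : δ ≤ 1) (a : Fin k → ℝ) :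
    volume (Metric.ball (0 : Pt d) R ∩ {x | ∀ i, |inner ℝ (n i) x - a i| ≤ δ})
      ≤ ENNReal.ofReal (δ ^ k) * volume (Metric.ball (0 : Pt d) (R + ∑ i, 6 * ‖v i‖)) := by
  set S := Metric.ball (0 : Pt d) R ∩ {x | ∀ i, |inner ℝ (n i) x - a i| ≤ δ} with hS
  set m := ⌈1 / δ⌉₊ with hm
  have hm1 : 1 ≤ δ * m := by
    have := Nat.le_ceil (1 / δ)
    rwa [div_le_iff₀' hδ] at this
  have hm2 : δ * m ≤ 2 := by
    have := (Nat.ceil_lt_add_one (by positivity : 0 ≤ 1 / δ)).le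
    calc δ * m ≤ δ * (1 / δ + 1) := by gcongr
      _ = 1 + δ := by field_simp
      _ ≤ 2 := by linarith
  -- Shifts by multiples of `3δ` separate slabs of total width `2δ`. With `m = ⌈1/δ⌉` copies in each
  -- direction the total shift along `v i` is at most `3δm ‖v i‖ ≤ 6 ‖v i‖`, while `m ^ k ≥ δ ^
  -- (-k)` disjoint copies fit in the larger ball.
  let w : (Fin k → Fin m) → Pt d := fun j => ∑ i, (3 * δ * (j i : ℕ)) • v i
  have hw : ∀ j i, inner ℝ (n i) (w j) = 3 * δ * (j i : ℕ) := by
    intro j i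
    simp only [w, inner_sum, inner_smul_right, hv]
    simp
  have hwn : ∀ j, ‖w j‖ ≤ ∑ i, 6 * ‖v i‖ := by
    intro j
    refine (norm_sum_le _ _).trans (Finset.sum_le_sum fun i _ => ?_)
    rw [norm_smul, Real.norm_of_nonneg (by positivity)]
    have : ((j i : ℕ) : ℝ) ≤ m := by exact_mod_cast (j i).2.le
    gcongr
    nlinarith
  have hSm : MeasurableSet S := by
    refine measurableSet_ball.inter (IsClosed.measurableSet ?_)
    simp only [ofPred_forall]
    exact isClosed_iInter fun i => isClosed_le (by fun_prop) continuous_const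
  have hdisj : Pairwise (Function.onFun Disjoint fun j => (fun x => x + -w j) ⁻¹' S) := by
    intro j j' hjj
    rw [Function.onFun, Set.disjoint_left]
    intro x hx hx'
    apply hjj
    ext i
    have h1 := hx.2 i
    have h2 := hx'.2 i
    simp only [inner_add_right, inner_neg_right, hw] at h1 h2
    by_contra hne
    have h3 : (1 : ℝ) ≤ |((j i : ℕ) : ℝ) - (j' i : ℕ)| := by
      have : (1 : ℤ) ≤ |((j i : ℕ) : ℤ) - (j' i : ℕ)| :=
        Int.one_le_abs (sub_ne_zero.2 (by exact_mod_cast hne))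
      exact_mod_cast this
    have h4 : |3 * δ * (((j i : ℕ) : ℝ) - (j' i : ℕ))| ≤ 2 * δ := by
      rw [abs_le] at h1 h2 ⊢
      constructor <;> linarith [h1.1, h1.2, h2.1, h2.2]
    rw [abs_mul, abs_of_pos (by positivity)] at h4
    nlinarith
  have hsub : ⋃ j, (fun x => x + -w j) ⁻¹' S ⊆ Metric.ball (0 : Pt d) (R + ∑ i, 6 * ‖v i‖) := by
    intro x hx
    obtain ⟨j, hj⟩ := mem_iUnion.1 hx
    have h1 := hj.1
    rw [mem_ball_zero_iff] at h1 ⊢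
    have : x = (x + -w j) + w j := by abel
    rw [this]
    exact (norm_add_le _ _).trans_lt (add_lt_add_of_lt_of_le h1 (hwn j))
  have hcount := measure_mono (μ := volume) hsub
  rw [measure_iUnion hdisj fun j => hSm.preimage (measurable_add_const _)] at hcount
  simp only [measure_preimage_add_right, tsum_fintype, Finset.sum_const, Finset.card_univ,
    Fintype.card_fun, Fintype.card_fin, nsmul_eq_mul] at hcount
  calc volume S = 1 * volume S := (one_mul _).symm
    _ ≤ ENNReal.ofReal ((δ * m) ^ k) * volume S := by
        gcongr
        rw [ENNReal.one_le_ofReal]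
        exact one_le_pow₀ hm1
    _ = ENNReal.ofReal (δ ^ k) * (((m ^ k : ℕ) : ℝ≥0∞) * volume S) := by
        rw [mul_pow, ENNReal.ofReal_mul (by positivity), mul_assoc]
        congr 2
        rw [← Nat.cast_pow, ENNReal.ofReal_natCast]
    _ ≤ _ := by gcongr

/-- The hyperplane with normal `h.1` and level `h.2`. -/
def hyperplane {d : ℕ} (h : Pt d × ℝ) : Set (Pt d) := {x | inner ℝ h.1 x = h.2}

/-- The points of a neighbourhood of a hyperplane. -/
def slab {d : ℕ} (h : Pt d × ℝ) (δ : ℝ) : Set (Pt d) := {x | |inner ℝ h.1 x - h.2| ≤ δ}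

theorem exists_volume_slab_le {d : ℕ} {h : Pt d × ℝ} (hn : h.1 ≠ 0) (R : ℝ) :
    ∃ C : ℝ≥0∞, C ≠ ⊤ ∧ ∀ δ ∈ Ioc (0 : ℝ) 1,
      volume (Metric.ball (0 : Pt d) R ∩ slab h δ) ≤ ENNReal.ofReal δ * C := by
  have hnn : (inner ℝ h.1 h.1 : ℝ) ≠ 0 := inner_self_ne_zero.2 hn
  refine ⟨_, ?_, fun δ hδ => (measure_mono ?_).trans
    ((volume_ball_inter_slabs_le (k := 1) (n := fun _ => h.1)
      (v := fun _ => (inner ℝ h.1 h.1 : ℝ)⁻¹ • h.1) ?_ R hδ.1 hδ.2 fun _ => h.2).trans_eq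
        (by rw [pow_one]))⟩
  · exact measure_ball_lt_top.ne
  · exact inter_subset_inter_right _ fun x hx _ => hx
  · intro i j
    rw [inner_smul_right, inv_mul_cancel₀ hnn, if_pos (Subsingleton.elim i j)]

/-- Hyperplanes with independent normals meet in codimension two, whence `δ²`; the dual vectors come
from inverting the Gram matrix, of determinant `D`. Distinct parallel hyperplanes are at positive
distance, so that thin slabs around them are disjoint. -/
theorem exists_volume_slab_inter_slab_le {d : ℕ} {h h' : Pt d × ℝ} (hn : h.1 ≠ 0) (hn' : h'.1 ≠ 0)
    (hne : hyperplane h ≠ hyperplane h') (R : ℝ) :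
    ∃ C : ℝ≥0∞, C ≠ ⊤ ∧ ∃ δ₀ > 0, ∀ δ ∈ Ioc (0 : ℝ) δ₀,
      volume (Metric.ball (0 : Pt d) R ∩ (slab h δ ∩ slab h' δ)) ≤ ENNReal.ofReal (δ ^ 2) * C := by
  obtain ⟨n, a⟩ := h
  obtain ⟨n', a'⟩ := h'
  simp only at hn hn'
  have hnn : (inner ℝ n n : ℝ) ≠ 0 := inner_self_ne_zero.2 hn
  set D : ℝ := inner ℝ n n * inner ℝ n' n' - inner ℝ n n' * inner ℝ n n' with hD
  by_cases hD0 : D = 0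
  · -- parallel normals
    set c : ℝ := inner ℝ n n' / inner ℝ n n with hc
    have hpar : n' = c • n := by
      have h1 : inner ℝ (n' - c • n) (n' - c • n) = (0 : ℝ) := by
        rw [inner_sub_left, inner_sub_right, inner_sub_right, inner_smul_left, inner_smul_left,
          inner_smul_right, inner_smul_right, real_inner_comm n n']
        simp only [conj_trivial]
        rw [hc]
        field_simp
        rw [hD] at hD0
        linarith
      exact sub_eq_zero.1 (inner_self_eq_zero.1 h1)
    have hc0 : c ≠ 0 := by
      rintro h0
      rw [h0, zero_smul] at hpar
      exact hn' hpar
    have hlev : c * a ≠ a' := by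
      intro he
      apply hne
      ext x
      simp only [hyperplane, mem_ofPred_eq, hpar, inner_smul_left, conj_trivial, ← he]
      exact (mul_right_inj' hc0).symm
    refine ⟨0, ENNReal.zero_ne_top, |c * a - a'| / (2 * (|c| + 1)), ?_, fun δ hδ => ?_⟩
    · have := abs_pos.2 (sub_ne_zero.2 hlev)
      positivity
    · rw [mul_zero, nonpos_iff_eq_zero]
      convert! measure_empty (μ := (volume : Measure (Pt d)))
      rw [eq_empty_iff_forall_notMem]
      rintro x ⟨-, h1, h2⟩
      simp only [slab, mem_ofPred_eq, hpar, inner_smul_left, conj_trivial] at h1 h2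
      have h3 := hδ.2
      rw [le_div_iff₀ (by positivity)] at h3
      have h4 : |c * a - a'| ≤ |c| * δ + δ := by
        have e : c * a - a' = -(c * (inner ℝ n x - a)) + (c * inner ℝ n x - a') := by ring
        rw [e]
        refine (abs_add_le _ _).trans (add_le_add ?_ h2)
        rw [abs_neg, abs_mul]
        exact mul_le_mul_of_nonneg_left h1 (abs_nonneg c)
      have h5 : 0 < (|c| + 1) * δ := mul_pos (by positivity) hδ.1
      linarith
  · let N : Fin 2 → Pt d := ![n, n']
    let v : Fin 2 → Pt d := ![(inner ℝ n' n' / D : ℝ) • n - (inner ℝ n n' / D : ℝ) • n',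
      (inner ℝ n n / D : ℝ) • n' - (inner ℝ n n' / D : ℝ) • n]
    have hv : ∀ i j, inner ℝ (N i) (v j) = if i = j then (1 : ℝ) else 0 := by
      intro i j
      fin_cases i <;> fin_cases j <;>
        simp only [N, v, Fin.zero_eta, Fin.mk_one, Matrix.cons_val_zero, Matrix.cons_val_one,
          inner_sub_right, inner_smul_right, real_inner_comm n n'] <;> simp <;> field_simp <;>
        simp only [hD, real_inner_self_eq_norm_sq] <;> ring
    refine ⟨_, ?_, 1, one_pos, fun δ hδ => (measure_mono ?_).trans
      (volume_ball_inter_slabs_le hv R hδ.1 hδ.2 ![a, a'])⟩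
    · exact measure_ball_lt_top.ne
    · refine inter_subset_inter_right _ fun x hx i => ?_
      fin_cases i
      · exact hx.1
      · exact hx.2

/-! ### Continuity of the normal component across a face -/

section Trace

variable {d : ℕ}

theorem integral_fderiv_apply_eq_zero {ψ : Pt d → ℝ} (hψ : ContDiff ℝ ∞ ψ)
    (hc : HasCompactSupport ψ) (W : Pt d) : ∫ x, fderiv ℝ ψ x W = 0 := by
  have hdc : Continuous fun x => fderiv ℝ ψ x W :=
    (hψ.continuous_fderiv (by simp)).clm_apply continuous_const
  have hds : HasCompactSupport fun x => fderiv ℝ ψ x W := hc.fderiv_apply ℝ W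
  have := integral_mul_fderiv_eq_neg_fderiv_mul_of_integrable (μ := volume) (f := fun _ => (1 : ℝ))
    (g := ψ) (v := W) (by simp) (by simpa using hdc.integrable_of_hasCompactSupport hds)
    (by simpa using hψ.continuous.integrable_of_hasCompactSupport hc)
    (fun x _ => differentiableAt_const _) (fun x _ => (hψ.differentiable (by simp)) x)
  simpa using this

/-- The hypothesis says that the mass in the half-space of a bump translated along `W` does not
change. If `inner ℝ n W ≠ 0`, translation can bring the bump from outside the half-space to inside,
changing this mass from zero to a positive value. -/
theorem inner_eq_zero_of_integral_halfspace {n W : Pt d}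
    (h : ∀ ψ : Pt d → ℝ, ContDiff ℝ ∞ ψ → HasCompactSupport ψ →
      ∫ x in {x | 0 < inner ℝ n x}, fderiv ℝ ψ x W = 0) : inner ℝ n W = (0 : ℝ) := by
  by_contra hc
  set c : ℝ := inner ℝ n W with hcdef
  have hn : n ≠ 0 := by rintro rfl; simp [hcdef] at hc
  have hnpos : 0 < ‖n‖ := norm_pos_iff.2 hn
  let η : ContDiffBump (-n) := ⟨‖n‖ / 4, ‖n‖ / 2, by positivity, by linarith⟩
  have hηsupp : ∀ x, η x ≠ 0 → |inner ℝ n x + ‖n‖ ^ 2| ≤ ‖n‖ ^ 2 / 2 := by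
    intro x hx
    have hx' : x ∈ Metric.ball (-n) (‖n‖ / 2) := by
      have : x ∈ Function.support η := hx
      rwa [η.support_eq] at this
    rw [Metric.mem_ball, dist_eq_norm, sub_neg_eq_add] at hx'
    have e : inner ℝ n x + ‖n‖ ^ 2 = inner ℝ n (x + n) := by
      rw [inner_add_right, real_inner_self_eq_norm_sq]
    rw [e]
    refine (abs_real_inner_le_norm _ _).trans ?_
    nlinarith
  have hηc : HasCompactSupport (η : Pt d → ℝ) := η.hasCompactSupport
  have hηs : ContDiff ℝ ∞ (η : Pt d → ℝ) := η.contDiff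
  set P := {x : Pt d | 0 < inner ℝ n x} with hP
  have hPm : MeasurableSet P := (isOpen_lt continuous_const (by fun_prop)).measurableSet
  let I : ℝ → ℝ := fun t => ∫ x in P, η (x + t • W)
  have hcs : ∀ t : ℝ, HasCompactSupport fun x => η (x + t • W) := fun t =>
    hηc.comp_homeomorph (Homeomorph.addRight (t • W))
  have hsm : ∀ t : ℝ, ContDiff ℝ ∞ fun x => η (x + t • W) := fun t =>
    hηs.comp (contDiff_id.add contDiff_const)
  have hfd : ∀ (t : ℝ) (x : Pt d), fderiv ℝ (fun x => η (x + t • W)) x = fderiv ℝ η (x + t • W) :=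
    fun t x => fderiv_comp_add_right (t • W)
  have hfc : Continuous fun x => fderiv ℝ η x W :=
    (hηs.continuous_fderiv (by simp)).clm_apply continuous_const
  have hfs : HasCompactSupport fun x => fderiv ℝ (η : Pt d → ℝ) x W := hηc.fderiv_apply ℝ W
  obtain ⟨B, hB⟩ := hfs.exists_bound_of_continuous hfc
  have hderiv : ∀ t, HasDerivAt I 0 t := by
    intro t
    have hzero : ∫ x in P, fderiv ℝ η (x + t • W) W = 0 := by
      have := h _ (hsm t) (hcs t)
      simpa only [hfd] using this
    obtain ⟨R, hR⟩ := hfs.isCompact.isBounded.subset_closedBall 0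
    have := hasDerivAt_integral_of_dominated_loc_of_deriv_le (μ := volume.restrict P)
      (F := fun (t : ℝ) x => η (x + t • W)) (F' := fun (t : ℝ) x => fderiv ℝ η (x + t • W) W)
      (x₀ := t) (s := Metric.ball t 1)
      (bound := (Metric.closedBall (0 : Pt d) (R + (|t| + 1) * ‖W‖)).indicator fun _ => B)
      (Metric.ball_mem_nhds t one_pos)
      (Filter.Eventually.of_forall fun t => (hsm t).continuous.aestronglyMeasurable)
      (((hsm t).continuous.integrable_of_hasCompactSupport (hcs t)).restrict)
      ((hfc.comp (by fun_prop)).aestronglyMeasurable)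
      (Filter.Eventually.of_forall fun x r hr => ?_) ?_
      (Filter.Eventually.of_forall fun x r hr => ?_)
    · rw [← hzero]; exact this.2
    · by_cases hx : x ∈ Metric.closedBall (0 : Pt d) (R + (|t| + 1) * ‖W‖)
      · rw [indicator_of_mem hx]; exact hB _
      · rw [indicator_of_notMem hx]
        by_contra hne
        have h0 : fderiv ℝ η (x + r • W) W ≠ 0 := by
          intro h0; rw [h0, norm_zero] at hne; exact hne le_rfl
        have h1 := hR (subset_tsupport _ (Function.mem_support.2 h0))
        rw [mem_closedBall_zero_iff] at h1 hx
        apply hx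
        have e : x = (x + r • W) - r • W := by abel
        rw [e]
        refine (norm_sub_le _ _).trans (add_le_add h1 ?_)
        rw [norm_smul]
        gcongr
        rw [Metric.mem_ball, Real.dist_eq] at hr
        rw [Real.norm_eq_abs]
        have := abs_sub_abs_le_abs_sub r t
        linarith
    · refine (IntegrableOn.integrable_indicator ?_ measurableSet_closedBall).restrict
      exact integrableOn_const measure_closedBall_lt_top.ne
    · have h1 : HasFDerivAt (η : Pt d → ℝ) (fderiv ℝ η (x + r • W)) (x + r • W) :=
        ((hηs.differentiable (by simp)) _).hasFDerivAt
      have h2 : HasDerivAt (fun r : ℝ => x + r • W) W r := by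
        simpa using ((hasDerivAt_id r).smul_const W).const_add x
      have gen : ∀ (f : Pt d → ℝ) (f' : Pt d →L[ℝ] ℝ), HasFDerivAt f f' (x + r • W) →
          HasDerivAt (fun r : ℝ => f (x + r • W)) (f' W) r := fun f f' hf =>
        hf.comp_hasDerivAt r h2
      exact gen _ _ h1
  have hconst : ∀ t, I t = I 0 := fun t =>
    is_const_of_deriv_eq_zero (fun t => (hderiv t).differentiableAt) (fun t => (hderiv t).deriv) t 0
  have hI0 : I 0 = 0 := by
    refine setIntegral_eq_zero_of_forall_eq_zero fun x hx => ?_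
    rw [zero_smul, add_zero]
    by_contra hne
    have h1 := (abs_le.1 (hηsupp x hne)).2
    have h2 : 0 < inner ℝ n x := hx
    nlinarith [sq_pos_of_pos hnpos]
  -- On the support of `η` the product with `n` lies between `-3‖n‖²/2` and `-‖n‖²/2`. This
  -- translation raises it by `2‖n‖²`, so the whole bump ends up in `P`.
  have hI1 : I (-(2 * ‖n‖ ^ 2 / c)) = ∫ x, η x := by
    have : ∀ x, x ∉ P → η (x + (-(2 * ‖n‖ ^ 2 / c)) • W) = 0 := by
      intro x hx
      by_contra hne
      have h1 := (abs_le.1 (hηsupp _ hne)).1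
      rw [inner_add_right, inner_smul_right, ← hcdef, neg_mul, div_mul_cancel₀ _ hc] at h1
      have h2 : ¬ 0 < inner ℝ n x := hx
      nlinarith [sq_pos_of_pos hnpos]
    change ∫ x in P, η (x + (-(2 * ‖n‖ ^ 2 / c)) • W) = _
    rw [setIntegral_eq_integral_of_forall_compl_eq_zero this,
      integral_add_right_eq_self (fun x => η x)]
  have hpos : 0 < ∫ x, η x := η.integral_pos
  rw [hconst, hI0] at hI1
  linarith

/-- Continuity of the normal component across a face. -/
theorem HasDivNoFlux.inner_normal_eq {Ω : Set (Pt d)} {V : Pt d → Pt d} {g : Pt d → ℝ}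
    (h : HasDivNoFlux Ω V g) {Cd : ℝ} (hg : ∀ᵐ x ∂leb Ω, |g x| ≤ Cd)
    {z n : Pt d} {a ρ : ℝ} (hρ : 0 < ρ) (hn : n ≠ 0) (hz : inner ℝ n z = a)
    (hball : Metric.ball z ρ ⊆ Ω) {Vp Vm : Pt d → Pt d} (hVp : Continuous Vp) (hVm : Continuous Vm)
    (hp : ∀ x ∈ Metric.ball z ρ, a < inner ℝ n x → V x = Vp x)
    (hm : ∀ x ∈ Metric.ball z ρ, inner ℝ n x < a → V x = Vm x) :
    (inner ℝ n (Vp z) : ℝ) = inner ℝ n (Vm z) := by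
  rw [← sub_eq_zero, ← inner_sub_right]
  refine inner_eq_zero_of_integral_halfspace fun ψ hψ hψc => ?_
  have hdψ : Continuous (fderiv ℝ ψ) := hψ.continuous_fderiv (by simp)
  obtain ⟨R, hR⟩ := hψc.isCompact.isBounded.subset_closedBall 0
  have hdz : ∀ y, y ∉ Metric.closedBall (0 : Pt d) R → fderiv ℝ ψ y = 0 := fun y hy =>
    image_eq_zero_of_notMem_tsupport fun hmem => hy (hR (tsupport_fderiv_subset ℝ hmem))
  set P := {x : Pt d | 0 < inner ℝ n x} with hP
  have hPm : MeasurableSet P := (isOpen_lt continuous_const (by fun_prop)).measurableSet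
  classical
  -- `J t` is the left side of the Stokes formula tested on `ψ ((x - z) / t)`, rescaled. The left
  -- side is `t ^ d * (t⁻¹ * J t)` and the divergence term is only `O(t ^ d)`, so that `J t = O(t)`.
  -- The limit `J 0` involves the two constant fields `Vp z` and `Vm z`.
  let J : ℝ → ℝ := fun t => ∫ y, fderiv ℝ ψ y (P.piecewise (fun y => Vp (z + t • y))
    (fun y => Vm (z + t • y)) y)
  have hmeas : ∀ t : ℝ, AEStronglyMeasurable (fun y => fderiv ℝ ψ y
      (P.piecewise (fun y => Vp (z + t • y)) (fun y => Vm (z + t • y)) y)) volume := by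
    intro t
    refine isBoundedBilinearMap_apply.continuous.comp_aestronglyMeasurable
      (hdψ.aestronglyMeasurable.prodMk ?_)
    exact (StronglyMeasurable.piecewise hPm (hVp.comp (by fun_prop)).stronglyMeasurable
      (hVm.comp (by fun_prop)).stronglyMeasurable).aestronglyMeasurable
  -- the blow-up has a limit
  have hlim : Filter.Tendsto J (nhdsWithin 0 (Ioi 0)) (nhds (J 0)) := by
    obtain ⟨B₁, hB₁⟩ := (isCompact_closedBall z R).exists_bound_of_continuousOn hVp.continuousOn
    obtain ⟨B₂, hB₂⟩ := (isCompact_closedBall z R).exists_bound_of_continuousOn hVm.continuousOn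
    have hev : ∀ᶠ t in nhdsWithin (0 : ℝ) (Ioi 0), t ∈ Ioo (0 : ℝ) 1 := Ioo_mem_nhdsGT one_pos
    refine tendsto_integral_filter_of_dominated_convergence
      (fun y => ‖fderiv ℝ ψ y‖ * (|B₁| + |B₂|)) (Filter.Eventually.of_forall hmeas) ?_ ?_ ?_
    · filter_upwards [hev] with t ht
      refine Filter.Eventually.of_forall fun y => ?_
      by_cases hy : y ∈ Metric.closedBall (0 : Pt d) R
      · refine (ContinuousLinearMap.le_opNorm _ _).trans ?_
        gcongr
        have hmem : z + t • y ∈ Metric.closedBall z R := by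
          rw [mem_closedBall_zero_iff] at hy
          rw [Metric.mem_closedBall, dist_eq_norm, add_sub_cancel_left, norm_smul,
            Real.norm_of_nonneg ht.1.le]
          nlinarith [norm_nonneg y, ht.2, ht.1]
        by_cases hyP : y ∈ P
        · rw [piecewise_eq_of_mem _ _ _ hyP]
          have := hB₁ _ hmem
          linarith [le_abs_self B₁, abs_nonneg B₂]
        · rw [piecewise_eq_of_notMem _ _ _ hyP]
          have := hB₂ _ hmem
          linarith [le_abs_self B₂, abs_nonneg B₁]
      · rw [hdz y hy]; simp
    · exact ((hdψ.norm).integrable_of_hasCompactSupport (hψc.fderiv ℝ).norm).mul_const _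
    · refine Filter.Eventually.of_forall fun y => ?_
      refine ((fderiv ℝ ψ y).continuous.tendsto _).comp ?_
      have hc : Filter.Tendsto (fun t : ℝ => z + t • y) (nhdsWithin 0 (Ioi 0))
          (nhds (z + (0 : ℝ) • y)) :=
        ((by fun_prop : Continuous fun t : ℝ => z + t • y).tendsto 0).mono_left nhdsWithin_le_nhds
      by_cases hyP : y ∈ P
      · simp only [piecewise_eq_of_mem _ _ _ hyP]
        exact (hVp.tendsto _).comp hc
      · simp only [piecewise_eq_of_notMem _ _ _ hyP]
        exact (hVm.tendsto _).comp hc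
  -- and it is small
  have hbound : ∀ᶠ t in nhdsWithin (0 : ℝ) (Ioi 0), |J t| ≤ t * (Cd * ∫ y, |ψ y|) := by
    have hev : ∀ᶠ t in nhdsWithin (0 : ℝ) (Ioi 0), t ∈ Ioo (0 : ℝ) (ρ / (|R| + 1)) :=
      Ioo_mem_nhdsGT (by positivity)
    filter_upwards [hev] with t ht
    have ht0 : t ≠ 0 := ht.1.ne'
    have htR : t * R < ρ := by
      have := ht.2
      rw [lt_div_iff₀ (by positivity)] at this
      nlinarith [le_abs_self R, ht.1]
    let e : Pt d → Pt d := fun x => t⁻¹ • (x - z)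
    let ψt : Pt d → ℝ := fun x => ψ (e x)
    have he : ∀ y, e (z + t • y) = y := fun y => by
      simp only [e, add_sub_cancel_left, smul_smul, inv_mul_cancel₀ ht0, one_smul]
    have hψt : ContDiff ℝ ∞ ψt := hψ.comp ((contDiff_id.sub contDiff_const).const_smul t⁻¹)
    have hout : ∀ x ∉ Metric.ball z ρ, e x ∉ Metric.closedBall (0 : Pt d) R := by
      intro x hx hmem
      apply hx
      rw [mem_closedBall_zero_iff, norm_smul, norm_inv, Real.norm_of_nonneg ht.1.le,
        inv_mul_le_iff₀ ht.1] at hmem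
      rw [Metric.mem_ball, dist_eq_norm]
      linarith
    have hψtc : HasCompactSupport ψt := by
      refine HasCompactSupport.of_support_subset_isCompact (isCompact_closedBall z ρ) fun x hx => ?_
      by_contra hxb
      refine hx (image_eq_zero_of_notMem_tsupport (f := ψ) (x := e x) fun hmem => ?_)
      exact hout x (fun h => hxb (Metric.ball_subset_closedBall h)) (hR hmem)
    have hfd : ∀ x, fderiv ℝ ψt x = t⁻¹ • fderiv ℝ ψ (e x) := by
      intro x
      have h1 : HasFDerivAt e (t⁻¹ • ContinuousLinearMap.id ℝ (Pt d)) x :=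
        ((hasFDerivAt_id x).sub_const z).const_smul t⁻¹
      have h2 := ((hψ.differentiable (by simp)) (e x)).hasFDerivAt.comp x h1
      refine h2.fderiv.trans ?_
      ext w; simp
    have key := h ψt hψt hψtc
    -- change of variables
    have hcv : ∀ f : Pt d → ℝ, ∫ x, f x = t ^ d * ∫ y, f (z + t • y) := by
      intro f
      have h1 := Measure.integral_comp_smul (volume : Measure (Pt d)) (fun y => f (z + y)) t
      rw [integral_add_left_eq_self f z, finrank_euclideanSpace_fin, smul_eq_mul,
        abs_of_pos (inv_pos.2 (pow_pos ht.1 d))] at h1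
      rw [h1, ← mul_assoc, mul_inv_cancel₀ (pow_pos ht.1 d).ne', one_mul]
    have hl : ∫ x in Ω, fderiv ℝ ψt x (V x) = t ^ d * (t⁻¹ * J t) := by
      have hJ : t⁻¹ * J t = ∫ y, t⁻¹ * fderiv ℝ ψ y (P.piecewise (fun y => Vp (z + t • y))
          (fun y => Vm (z + t • y)) y) := (integral_const_mul _ _).symm
      rw [setIntegral_eq_integral_of_forall_compl_eq_zero, hcv, hJ]
      · congr 1
        refine integral_congr_ae ?_
        have hnull : ∀ᵐ y : Pt d, inner ℝ n y ≠ 0 := by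
          rw [ae_iff]; simpa using volume_hyperplane hn 0
        filter_upwards [hnull] with y hy
        rw [hfd, he, _root_.smul_apply, smul_eq_mul]
        by_cases hyR : z + t • y ∈ Metric.ball z ρ
        · congr 2
          have hin : inner ℝ n (z + t • y) = a + t * inner ℝ n y := by
            rw [inner_add_right, inner_smul_right, hz]
          rcases lt_or_gt_of_ne hy with hlt | hgt
          · rw [piecewise_eq_of_notMem _ _ _ (by simpa [hP] using hlt.le)]
            exact hm _ hyR (by rw [hin]; nlinarith [ht.1])
          · rw [piecewise_eq_of_mem _ _ _ (show y ∈ P from hgt)]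
            exact hp _ hyR (by rw [hin]; nlinarith [ht.1])
        · have := hout _ hyR
          rw [he] at this
          rw [hdz y this]; simp
      · intro x hx
        rw [hfd, hdz _ (hout x fun hxb => hx (hball hxb))]
        simp
    have hr : |∫ x in Ω, g x * ψt x| ≤ Cd * (t ^ d * ∫ y, |ψ y|) := by
      have hint : Integrable ψt := hψt.continuous.integrable_of_hasCompactSupport hψtc
      have e1 : ∫ x, |ψt x| = t ^ d * ∫ y, |ψ y| := by
        rw [hcv]
        simp only [ψt, he]
      have e2 : ∫ x in Ω, |ψt x| = ∫ x, |ψt x| := by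
        refine setIntegral_eq_integral_of_forall_compl_eq_zero fun x hx => ?_
        have hzero : ψt x = 0 := image_eq_zero_of_notMem_tsupport (f := ψ) (x := e x) fun hmem =>
          hout x (fun hxb => hx (hball hxb)) (hR hmem)
        rw [hzero, abs_zero]
      rw [← e1, ← e2, ← integral_const_mul, ← Real.norm_eq_abs]
      refine norm_integral_le_of_norm_le (hint.abs.restrict.const_mul _) ?_
      filter_upwards [hg] with x hx
      rw [norm_mul, Real.norm_eq_abs, Real.norm_eq_abs]
      exact mul_le_mul_of_nonneg_right hx (abs_nonneg _)
    rw [← abs_neg, ← key, hl, abs_mul, abs_mul, abs_of_pos (pow_pos ht.1 d),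
      abs_of_pos (inv_pos.2 ht.1), mul_left_comm Cd] at hr
    have h3 := le_of_mul_le_mul_left hr (pow_pos ht.1 d)
    rwa [inv_mul_le_iff₀ ht.1] at h3
  have hJ0 : J 0 = 0 := by
    have hz0 : Filter.Tendsto (fun t : ℝ => t * (Cd * ∫ y, |ψ y|)) (nhdsWithin 0 (Ioi 0))
        (nhds 0) := by
      have : Continuous fun t : ℝ => t * (Cd * ∫ y, |ψ y|) := by fun_prop
      simpa using (this.tendsto 0).mono_left nhdsWithin_le_nhds
    exact tendsto_nhds_unique hlim (squeeze_zero_norm' hbound hz0)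
  have hdint : ∀ W, Integrable fun y => fderiv ℝ ψ y W := fun W =>
    (hdψ.clm_apply continuous_const).integrable_of_hasCompactSupport (hψc.fderiv_apply ℝ W)
  have hsplit : J 0 = (∫ y in P, fderiv ℝ ψ y (Vp z - Vm z)) + ∫ y, fderiv ℝ ψ y (Vm z) := by
    rw [← integral_indicator hPm, ← integral_add ((hdint _).indicator hPm) (hdint _)]
    refine integral_congr_ae (Filter.Eventually.of_forall fun y => ?_)
    by_cases hy : y ∈ P
    · simp [hy]
    · simp [hy]
  rw [hJ0, integral_fderiv_apply_eq_zero hψ hψc, add_zero] at hsplit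
  exact hsplit.symm

end Trace

end Ellam

/-! ### The field near the faces, and the points that are not tame -/

namespace Ellam

/-- `G ⊆ Ω` is the disjoint union of finitely many open cells in each of which `φ` and `V` are
restrictions of smooth functions, and `Ω \ G` is covered by finitely many hyperplanes. -/
structure CellDecomposition {d : ℕ} {ι : Type*} (Ω G : Set (Pt d)) (φ : Pt d → ℝ) (V : Pt d → Pt d)
    (cell : ι → Set (Pt d)) (φc : ι → Pt d → ℝ) (Vc : ι → Pt d → Pt d) (H : Set (Pt d × ℝ)) :
    Prop where
  finite : H.Finite
  normal_ne_zero : ∀ h ∈ H, h.1 ≠ 0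
  cover : Ω \ G ⊆ ⋃ h ∈ H, hyperplane h
  isOpen_cell : ∀ i, IsOpen (cell i)
  disjoint : ∀ i j, i ≠ j → Disjoint (cell i) (cell j)
  eq_iUnion : G = ⋃ i, cell i
  contDiff_φc : ∀ i, ContDiff ℝ ∞ (φc i)
  contDiff_Vc : ∀ i, ContDiff ℝ ∞ (Vc i)
  eqOn_φ : ∀ i, EqOn φ (φc i) (cell i)
  eqOn_V : ∀ i, EqOn V (Vc i) (cell i)

namespace CellDecomposition

variable {d : ℕ} {ι : Type*} {Ω G : Set (Pt d)} {T lo hi M Cd : ℝ} {φ : Pt d → ℝ}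
  {V : Pt d → Pt d} {F : ℝ → Pt d → Pt d} {cell : ι → Set (Pt d)} {φc : ι → Pt d → ℝ}
  {Vc : ι → Pt d → Pt d} {H : Set (Pt d × ℝ)}

theorem cell_subset (hD : CellDecomposition Ω G φ V cell φc Vc H) (i : ι) : cell i ⊆ G := by
  rw [hD.eq_iUnion]; exact subset_iUnion cell i

theorem exists_subset_cell (hD : CellDecomposition Ω G φ V cell φc Vc H) {A : Set (Pt d)}
    (hA : Convex ℝ A) (hne : A.Nonempty) (hAG : A ⊆ G) : ∃ i, A ⊆ cell i := by
  obtain ⟨x, hx⟩ := hne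
  have hxG := hAG hx
  rw [hD.eq_iUnion] at hxG
  obtain ⟨i, hi⟩ := mem_iUnion.1 hxG
  refine ⟨i, hA.isPreconnected.subset_left_of_subset_union (v := ⋃ j, ⋃ _ : j ≠ i, cell j)
    (hD.isOpen_cell i) (isOpen_iUnion fun j => isOpen_iUnion fun _ => hD.isOpen_cell j) ?_ ?_
    ⟨x, hx, hi⟩⟩
  · exact disjoint_iUnion_right.2 fun j => disjoint_iUnion_right.2 fun hj =>
      hD.disjoint i j hj.symm
  · intro y hy
    have hyG := hAG hy
    rw [hD.eq_iUnion] at hyG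
    obtain ⟨j, hj⟩ := mem_iUnion.1 hyG
    by_cases hij : j = i
    · exact Or.inl (hij ▸ hj)
    · exact Or.inr (mem_iUnion.2 ⟨j, mem_iUnion.2 ⟨hij, hj⟩⟩)

theorem le_φc (hD : CellDecomposition Ω G φ V cell φc Vc H)
    (hS : FlowSetting Ω G T lo hi M Cd φ V F) {i : ι} {z : Pt d} (hz : z ∈ closure (cell i)) :
    lo ≤ φc i z := by
  have hcl : IsClosed {x | lo ≤ φc i x} := isClosed_le continuous_const (hD.contDiff_φc i).continuous
  refine hcl.closure_subset_iff.2 (fun x hx => ?_) hz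
  change lo ≤ φc i x
  rw [← hD.eqOn_φ i hx]
  exact (hS.φ_bounds x (hD.cell_subset i hx)).1

theorem contDiffAt_field (hD : CellDecomposition Ω G φ V cell φc Vc H)
    (hS : FlowSetting Ω G T lo hi M Cd φ V F) {i : ι} {z : Pt d} (hz : z ∈ closure (cell i)) :
    ContDiffAt ℝ 1 (transportField (φc i) (Vc i)) z := by
  have h0 : φc i z ≠ 0 := (hS.lo_pos.trans_le (hD.le_φc hS hz)).ne'
  exact (((hD.contDiff_φc i).of_le (by simp)).contDiffAt.inv h0).smul
    ((hD.contDiff_Vc i).of_le (by simp)).contDiffAt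

theorem exists_lipschitzOnWith_field (hD : CellDecomposition Ω G φ V cell φc Vc H)
    (hS : FlowSetting Ω G T lo hi M Cd φ V F) {i : ι} {z : Pt d} (hz : z ∈ closure (cell i)) :
    ∃ K : NNReal, ∃ r > 0, LipschitzOnWith K (transportField (φc i) (Vc i)) (Metric.ball z r) := by
  obtain ⟨K, t, ht, hK⟩ := (hD.contDiffAt_field hS hz).exists_lipschitzOnWith
  obtain ⟨r, hr, hsub⟩ := Metric.mem_nhds_iff.1 ht
  exact ⟨K, r, hr, hK.mono hsub⟩

theorem field_eq (hD : CellDecomposition Ω G φ V cell φc Vc H) {i : ι} {x : Pt d}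
    (hx : x ∈ cell i) : transportField φ V x = transportField (φc i) (Vc i) x := by
  rw [transportField, transportField, hD.eqOn_φ i hx, hD.eqOn_V i hx]

theorem isTame_of_mem (hD : CellDecomposition Ω G φ V cell φc Vc H)
    (hS : FlowSetting Ω G T lo hi M Cd φ V F) {y : Pt d} (hy : y ∈ G) :
    IsTame G (transportField φ V) y := by
  rw [hD.eq_iUnion] at hy
  obtain ⟨i, hi⟩ := mem_iUnion.1 hy
  obtain ⟨K, r, hr, hK⟩ := hD.exists_lipschitzOnWith_field hS (subset_closure hi)
  obtain ⟨r', hr', hsub⟩ := Metric.isOpen_iff.1 (hD.isOpen_cell i) y hi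
  refine isTame_of_lipschitzOnWith (lt_min hr hr')
    (hK.mono (Metric.ball_subset_ball (min_le_left _ _))) fun x hx => hD.field_eq ?_
  exact hsub (Metric.ball_subset_ball (min_le_right _ _) hx.1)

/-- A ball centred on a face, which meets no other face, is cut by this face into two halves, each
of them in one cell. -/
theorem exists_half_balls (hD : CellDecomposition Ω G φ V cell φc Vc H) {h : Pt d × ℝ} (hh : h ∈ H)
    {z : Pt d} (hz : z ∈ hyperplane h) {ρ : ℝ} (hρ : 0 < ρ) (hball : Metric.ball z ρ ⊆ Ω)
    (hother : ∀ h' ∈ H, hyperplane h' ≠ hyperplane h → Disjoint (hyperplane h') (Metric.ball z ρ)) :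
    ∃ i j, z ∈ closure (cell i) ∧ z ∈ closure (cell j) ∧
      (∀ x ∈ Metric.ball z ρ, h.2 < inner ℝ h.1 x → x ∈ cell i) ∧
      (∀ x ∈ Metric.ball z ρ, inner ℝ h.1 x < h.2 → x ∈ cell j) ∧
      (∀ x ∈ Metric.ball z ρ ∩ G, x ∈ cell i ∨ x ∈ cell j) := by
  have hn := hD.normal_ne_zero h hh
  have hnpos : 0 < ‖h.1‖ := norm_pos_iff.2 hn
  have hz' : inner ℝ h.1 z = h.2 := hz
  have hG : ∀ x ∈ Metric.ball z ρ, inner ℝ h.1 x ≠ h.2 → x ∈ G := by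
    intro x hx hne
    by_contra hxG
    obtain ⟨h', hh', hx'⟩ := mem_iUnion₂.1 (hD.cover ⟨hball hx, hxG⟩)
    by_cases he : hyperplane h' = hyperplane h
    · rw [he] at hx'
      exact hne hx'
    · exact Set.disjoint_left.1 (hother h' hh' he) hx' hx
  have hmove : ∀ (x : Pt d) (t : ℝ), inner ℝ h.1 (x + t • h.1) = inner ℝ h.1 x + t * ‖h.1‖ ^ 2 := by
    intro x t
    rw [inner_add_right, inner_smul_right, real_inner_self_eq_norm_sq]
  have hclose : ∀ x : Pt d, ∀ ε > 0, ∃ t > (0 : ℝ), ∀ s : ℝ, |s| ≤ t → dist (x + s • h.1) x < ε := by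
    intro x ε hε
    refine ⟨ε / (2 * ‖h.1‖), by positivity, fun s hs => ?_⟩
    rw [dist_eq_norm, add_sub_cancel_left, norm_smul, Real.norm_eq_abs]
    calc |s| * ‖h.1‖ ≤ ε / (2 * ‖h.1‖) * ‖h.1‖ := by gcongr
      _ = ε / 2 := by field_simp
      _ < ε := by linarith
  have hconvp : Convex ℝ (Metric.ball z ρ ∩ {x | h.2 < inner ℝ h.1 x}) :=
    (convex_ball z ρ).inter (convex_halfSpace_gt (innerₛₗ ℝ h.1).isLinear h.2)
  have hconvm : Convex ℝ (Metric.ball z ρ ∩ {x | inner ℝ h.1 x < h.2}) :=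
    (convex_ball z ρ).inter (convex_halfSpace_lt (innerₛₗ ℝ h.1).isLinear h.2)
  obtain ⟨t₀, ht₀, hd₀⟩ := hclose z ρ hρ
  obtain ⟨i, hi⟩ := hD.exists_subset_cell hconvp
    ⟨z + t₀ • h.1, hd₀ t₀ (abs_of_pos ht₀).le, by
      change h.2 < _
      rw [hmove, hz']; nlinarith [sq_pos_of_pos hnpos]⟩
    (fun x hx => hG x hx.1 (ne_of_gt hx.2))
  obtain ⟨j, hj⟩ := hD.exists_subset_cell hconvm
    ⟨z + (-t₀) • h.1, hd₀ (-t₀) (by rw [abs_neg, abs_of_pos ht₀]), by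
      change _ < h.2
      rw [hmove, hz']; nlinarith [sq_pos_of_pos hnpos]⟩
    (fun x hx => hG x hx.1 (ne_of_lt hx.2))
  refine ⟨i, j, ?_, ?_, fun x hx hlt => hi ⟨hx, hlt⟩, fun x hx hlt => hj ⟨hx, hlt⟩, ?_⟩
  · rw [Metric.mem_closure_iff]
    intro ε hε
    obtain ⟨t, ht, hd⟩ := hclose z ε hε
    refine ⟨z + (min t t₀) • h.1, hi ⟨?_, ?_⟩, ?_⟩
    · exact hd₀ _ (by rw [abs_of_pos (lt_min ht ht₀)]; exact min_le_right _ _)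
    · change h.2 < _
      rw [hmove, hz']; nlinarith [sq_pos_of_pos hnpos, lt_min ht ht₀]
    · rw [dist_comm]
      exact hd _ (by rw [abs_of_pos (lt_min ht ht₀)]; exact min_le_left _ _)
  · rw [Metric.mem_closure_iff]
    intro ε hε
    obtain ⟨t, ht, hd⟩ := hclose z ε hε
    refine ⟨z + (-min t t₀) • h.1, hj ⟨?_, ?_⟩, ?_⟩
    · exact hd₀ _ (by rw [abs_neg, abs_of_pos (lt_min ht ht₀)]; exact min_le_right _ _)
    · change _ < h.2
      rw [hmove, hz']; nlinarith [sq_pos_of_pos hnpos, lt_min ht ht₀]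
    · rw [dist_comm]
      exact hd _ (by rw [abs_neg, abs_of_pos (lt_min ht ht₀)]; exact min_le_left _ _)
  · rintro x ⟨hx, hxG⟩
    rcases lt_trichotomy (inner ℝ h.1 x) h.2 with hlt | heq | hgt
    · exact Or.inr (hj ⟨hx, hlt⟩)
    -- A hyperplane of `H` may also run through the interior of a cell. A point of `G` on it has its
    -- own cell `k`, open, hence meeting the upper half-ball; disjointness of the cells then gives
    -- `k = i`.
    · left
      rw [hD.eq_iUnion] at hxG
      obtain ⟨k, hk⟩ := mem_iUnion.1 hxG
      obtain ⟨ε, hε, hsub⟩ := Metric.isOpen_iff.1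
        ((hD.isOpen_cell k).inter (Metric.isOpen_ball (x := z) (ε := ρ))) x ⟨hk, hx⟩
      obtain ⟨t, ht, hd⟩ := hclose x ε hε
      have hmem := hsub (hd t (abs_of_pos ht).le)
      have hci : x + t • h.1 ∈ cell i := hi ⟨hmem.2, by
        change h.2 < _
        rw [hmove, heq]; nlinarith [sq_pos_of_pos hnpos]⟩
      by_cases hki : k = i
      · exact hki ▸ hk
      · exact absurd hci (Set.disjoint_left.1 (hD.disjoint k i hki) hmem.1)
    · exact Or.inl (hi ⟨hx, hgt⟩)

/-- By continuity, half of each normal speed at `z` remains a lower bound nearby in the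
corresponding cell. Division by `φ > 0` preserves the sign, so that every curve crosses upwards with
a uniform speed. -/
theorem isTame_of_crossing (hD : CellDecomposition Ω G φ V cell φc Vc H)
    (hS : FlowSetting Ω G T lo hi M Cd φ V F) {z n : Pt d} {a ρ : ℝ} (hρ : 0 < ρ) {i j : ι}
    (hi : z ∈ closure (cell i)) (hj : z ∈ closure (cell j))
    (hp : ∀ x ∈ Metric.ball z ρ, a < inner ℝ n x → x ∈ cell i)
    (hm : ∀ x ∈ Metric.ball z ρ, inner ℝ n x < a → x ∈ cell j)
    (hG : ∀ x ∈ Metric.ball z ρ ∩ G, x ∈ cell i ∨ x ∈ cell j)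
    (hposi : 0 < inner ℝ n (Vc i z)) (hposj : 0 < inner ℝ n (Vc j z)) :
    IsTame G (transportField φ V) z := by
  have hfield : ∀ k, z ∈ closure (cell k) → 0 < inner ℝ n (Vc k z) → ∃ K : NNReal, ∃ c > 0,
      ∃ r > 0, LipschitzOnWith K (transportField (φc k) (Vc k)) (Metric.ball z r) ∧
        ∀ x ∈ Metric.ball z r, c ≤ inner ℝ n (transportField (φc k) (Vc k) x) := by
    intro k hk hpos
    obtain ⟨K, r, hr, hK⟩ := hD.exists_lipschitzOnWith_field hS hk
    have hcont : ContinuousAt (fun x => inner ℝ n (transportField (φc k) (Vc k) x)) z :=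
      continuousAt_const.inner (hD.contDiffAt_field hS hk).continuousAt
    have hval : 0 < inner ℝ n (transportField (φc k) (Vc k) z) := by
      rw [transportField, inner_smul_right]
      exact mul_pos (inv_pos.2 (hS.lo_pos.trans_le (hD.le_φc hS hk))) hpos
    have hev := hcont.eventually (lt_mem_nhds (half_lt_self hval))
    obtain ⟨r', hr', hsub⟩ := Metric.mem_nhds_iff.1 hev
    exact ⟨K, _, half_pos hval, min r r', lt_min hr hr',
      hK.mono (Metric.ball_subset_ball (min_le_left _ _)),
      fun x hx => (hsub (Metric.ball_subset_ball (min_le_right _ _) hx)).le⟩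
  obtain ⟨K₁, c₁, hc₁, r₁, hr₁, hK₁, hb₁⟩ := hfield i hi hposi
  obtain ⟨K₂, c₂, hc₂, r₂, hr₂, hK₂, hb₂⟩ := hfield j hj hposj
  have h1 : Metric.ball z (min ρ (min r₁ r₂)) ⊆ Metric.ball z r₁ :=
    Metric.ball_subset_ball ((min_le_right _ _).trans (min_le_left _ _))
  have h2 : Metric.ball z (min ρ (min r₁ r₂)) ⊆ Metric.ball z r₂ :=
    Metric.ball_subset_ball ((min_le_right _ _).trans (min_le_right _ _))
  have h3 : Metric.ball z (min ρ (min r₁ r₂)) ⊆ Metric.ball z ρ :=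
    Metric.ball_subset_ball (min_le_left _ _)
  refine isTame_of_transversal (n := n) (a := a) (c := min c₁ c₂) (M := M) (K := max K₁ K₂)
    (lt_min hρ (lt_min hr₁ hr₂)) ((hK₁.mono h1).weaken (le_max_left _ _))
    ((hK₂.mono h2).weaken (le_max_right _ _)) (lt_min hc₁ hc₂) hS.M_nonneg hS.speed ?_ ?_ ?_
  · rintro x ⟨hx, hxG⟩
    rcases hG x ⟨h3 hx, hxG⟩ with hc | hc
    · rw [hD.field_eq hc]; exact (min_le_left _ _).trans (hb₁ x (h1 hx))
    · rw [hD.field_eq hc]; exact (min_le_right _ _).trans (hb₂ x (h2 hx))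
  · exact fun x hx hlt => hD.field_eq (hp x (h3 hx.1) hlt)
  · exact fun x hx hlt => hD.field_eq (hm x (h3 hx.1) hlt)

theorem exists_lipschitz_bound [Finite ι] (hD : CellDecomposition Ω G φ V cell φc Vc H) (R : ℝ) :
    ∃ L : NNReal, ∀ i, LipschitzOnWith L (Vc i) (Metric.closedBall 0 R) := by
  have h1 : ∀ i, ∃ L : NNReal, LipschitzOnWith L (Vc i) (Metric.closedBall 0 R) := fun i =>
    (hD.contDiff_Vc i).contDiffOn.exists_lipschitzOnWith (by simp) (convex_closedBall _ _)
      (isCompact_closedBall _ _)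
  choose L hL using h1
  cases nonempty_fintype ι
  exact ⟨Finset.univ.sup L, fun i => (hL i).weaken (Finset.le_sup (Finset.mem_univ i))⟩

/-- A curve that meets a point which is not tame within time `τ` starts close to two faces, or very
close to a face. -/
theorem exists_near_faces [Finite ι] (hD : CellDecomposition Ω G φ V cell φc Vc H)
    (hS : FlowSetting Ω G T lo hi M Cd φ V F) :
    ∃ C > 0, ∀ δ > 0, ∀ τ > 0, (M + 1) * τ ≤ δ → ∀ σ ∈ Icc 0 τ, ∀ γ : ℝ → Pt d,
      IsFieldCurve G (transportField φ V) 0 σ γ → Metric.ball (γ σ) δ ⊆ Ω →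
      ¬ IsTame G (transportField φ V) (γ σ) →
      (∃ h ∈ H, ∃ h' ∈ H, hyperplane h ≠ hyperplane h' ∧ γ 0 ∈ slab h (C * τ) ∧
        γ 0 ∈ slab h' (C * τ)) ∨ ∃ h ∈ H, γ 0 ∈ slab h (C * τ ^ 2) := by
  obtain ⟨R, hR⟩ := hS.isBounded.subset_closedBall 0
  obtain ⟨L, hL⟩ := hD.exists_lipschitz_bound R
  obtain ⟨N, hN⟩ : ∃ N : ℝ, ∀ h ∈ H, ‖h.1‖ ≤ N := by
    obtain ⟨N, hN⟩ := (hD.finite.image fun h => ‖h.1‖).bddAbove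
    exact ⟨N, fun h hh => hN ⟨h, hh, rfl⟩⟩
  have hM := hS.M_nonneg
  have hlo := hS.lo_pos
  set N' := |N| + 1 with hN'
  have hN'pos : 0 < N' := by positivity
  have hNle : ∀ h ∈ H, ‖h.1‖ ≤ N' := fun h hh => (hN h hh).trans (by
    rw [hN']; linarith [le_abs_self N])
  -- The first term bounds the change of `inner ℝ h.1 ·` over a distance `2 (M + 1) τ`, for two
  -- nearby faces. The second one is the normal acceleration: Lipschitz constant times displacement,
  -- divided by the lower bound of `φ`.
  refine ⟨N' * (2 * (M + 1)) + N' * (L * (M + 1)) / lo, by positivity, ?_⟩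
  set C := N' * (2 * (M + 1)) + N' * (L * (M + 1)) / lo with hC
  have hC1 : N' * (2 * (M + 1)) ≤ C := by
    have : 0 ≤ N' * (L * (M + 1)) / lo := by positivity
    linarith
  have hC2 : N' * (L * (M + 1)) / lo ≤ C := by
    have : 0 ≤ N' * (2 * (M + 1)) := by positivity
    linarith
  intro δ hδ τ hτ hτδ σ hσ γ hγ hball hbad
  set z := γ σ with hzdef
  set ρ := (M + 1) * τ with hρdef
  have hρ : 0 < ρ := by positivity
  have hballρ : Metric.ball z ρ ⊆ Ω := (Metric.ball_subset_ball hτδ).trans hball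
  have hdist : ∀ t ∈ Icc 0 σ, ‖γ t - z‖ ≤ M * τ := by
    intro t ht
    rw [norm_sub_rev]
    refine (hγ.norm_sub_le hS.speed ht.1 ht.2 le_rfl).trans ?_
    exact mul_le_mul_of_nonneg_left (by linarith [ht.1, hσ.2]) hM
  have hdist' : ∀ t ∈ Icc 0 σ, γ t ∈ Metric.ball z ρ := by
    intro t ht
    rw [Metric.mem_ball, dist_eq_norm]
    refine (hdist t ht).trans_lt ?_
    rw [hρdef]; linarith
  have hzΩ : z ∈ Ω := hballρ (Metric.mem_ball_self hρ)
  have hzG : z ∉ G := fun hzG => hbad (hD.isTame_of_mem hS hzG)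
  obtain ⟨h, hh, hz⟩ := mem_iUnion₂.1 (hD.cover ⟨hzΩ, hzG⟩)
  have hz' : inner ℝ h.1 z = h.2 := hz
  have h0σ : (0 : ℝ) ∈ Icc 0 σ := ⟨le_rfl, hσ.1⟩
  by_cases hex : ∃ h' ∈ H, hyperplane h' ≠ hyperplane h ∧
      ¬ Disjoint (hyperplane h') (Metric.ball z ρ)
  · left
    obtain ⟨h', hh', hne, hnd⟩ := hex
    obtain ⟨w, hw, hwb⟩ := Set.not_disjoint_iff.1 hnd
    have hw' : inner ℝ h'.1 w = h'.2 := hw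
    have hnear : ∀ h ∈ H, ∀ w : Pt d, inner ℝ h.1 w = h.2 → ‖γ 0 - w‖ ≤ 2 * ρ →
        γ 0 ∈ slab h (C * τ) := by
      intro h hh w hw hle
      change |inner ℝ h.1 (γ 0) - h.2| ≤ _
      rw [← hw, ← inner_sub_right]
      calc |(inner ℝ h.1 (γ 0 - w) : ℝ)| ≤ ‖h.1‖ * ‖γ 0 - w‖ := abs_real_inner_le_norm _ _
        _ ≤ N' * (2 * ρ) := mul_le_mul (hNle h hh) hle (norm_nonneg _) hN'pos.le
        _ = N' * (2 * (M + 1)) * τ := by rw [hρdef]; ring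
        _ ≤ C * τ := by gcongr
    have h1 := hdist 0 h0σ
    have hMρ : M * τ ≤ ρ := by rw [hρdef]; nlinarith
    refine ⟨h, hh, h', hh', hne.symm, hnear h hh z hz' (by linarith), hnear h' hh' w hw' ?_⟩
    have h2 : ‖z - w‖ < ρ := by rwa [← dist_eq_norm, dist_comm]
    have h3 := norm_sub_le_norm_sub_add_norm_sub (γ 0) z w
    linarith
  · right
    push Not at hex
    obtain ⟨i, j, hi, hj, hp, hm, hG⟩ := hD.exists_half_balls hh hz hρ hballρ hex
    obtain ⟨g, hg, hgb, hdiv⟩ := hS.exists_div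
    have htrace : (inner ℝ h.1 (Vc i z) : ℝ) = inner ℝ h.1 (Vc j z) :=
      hdiv.inner_normal_eq hgb hρ (hD.normal_ne_zero h hh) hz' hballρ
        (hD.contDiff_Vc i).continuous (hD.contDiff_Vc j).continuous
        (fun x hx hlt => hD.eqOn_V i (hp x hx hlt)) (fun x hx hlt => hD.eqOn_V j (hm x hx hlt))
    -- The two one-sided normal components agree by `htrace`. If they were nonzero the crossing
    -- would be transversal and `z` tame; for a negative value the normal is reversed and the two
    -- sides are exchanged.
    have hzero : (inner ℝ h.1 (Vc i z) : ℝ) = 0 := by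
      by_contra hne
      rcases lt_or_gt_of_ne hne with hneg | hpos
      · refine hbad (hD.isTame_of_crossing hS (n := -h.1) (a := -h.2) hρ hj hi
          (fun x hx hlt => hm x hx ?_) (fun x hx hlt => hp x hx ?_) (fun x hx => (hG x hx).symm)
          ?_ ?_)
        · rw [inner_neg_left] at hlt; linarith
        · rw [inner_neg_left] at hlt; linarith
        · rw [inner_neg_left]; linarith
        · rw [inner_neg_left]; linarith
      · exact hbad (hD.isTame_of_crossing hS hρ hi hj hp hm hG hpos (htrace ▸ hpos))
    have hzeroj : (inner ℝ h.1 (Vc j z) : ℝ) = 0 := htrace ▸ hzero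
    refine ⟨h, hh, ?_⟩
    -- The normal velocity vanishes at `z`, so it is `O(τ)` at distance `O(τ)`. Over a time at most
    -- `τ` the displacement normal to the face is then `O(τ²)`.
    have hspeed : ∀ k, inner ℝ h.1 (Vc k z) = (0 : ℝ) → ∀ x ∈ cell k, ‖x - z‖ ≤ M * τ →
        |(inner ℝ h.1 (transportField φ V x) : ℝ)| ≤ N' * (L * (M + 1)) / lo * τ := by
      intro k hk x hx hxz
      have hxG := hD.cell_subset k hx
      have hφ := (hS.φ_bounds x hxG).1
      rw [transportField, inner_smul_right, abs_mul, abs_inv, abs_of_pos (hlo.trans_le hφ),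
        hD.eqOn_V k hx]
      have e1 : |(inner ℝ h.1 (Vc k x) : ℝ)| ≤ N' * (L * ((M + 1) * τ)) := by
        have e : (inner ℝ h.1 (Vc k x) : ℝ) = inner ℝ h.1 (Vc k x - Vc k z) := by
          rw [inner_sub_right, hk, sub_zero]
        rw [e]
        refine (abs_real_inner_le_norm _ _).trans
          (mul_le_mul (hNle h hh) ?_ (norm_nonneg _) hN'pos.le)
        refine ((hL k).norm_sub_le (hR (hS.subset hxG)) (hR hzΩ)).trans ?_
        exact mul_le_mul_of_nonneg_left (hxz.trans (by nlinarith)) L.2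
      calc (φ x)⁻¹ * |(inner ℝ h.1 (Vc k x) : ℝ)| ≤ lo⁻¹ * (N' * (L * ((M + 1) * τ))) := by
            gcongr
        _ = _ := by ring
    have hmove : ‖(inner ℝ h.1 (γ σ) : ℝ) - inner ℝ h.1 (γ 0)‖
        ≤ N' * (L * (M + 1)) / lo * τ * (σ - 0) := by
      obtain ⟨S, hSc, hd⟩ := hγ.exists_countable
      refine norm_sub_le_of_hasDerivAt_off_countable (f := fun t => (inner ℝ h.1 (γ t) : ℝ))
        (f' := fun t => inner ℝ h.1 (transportField φ V (γ t))) hσ.1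
        (continuousOn_const.inner hγ.continuousOn) hSc (fun t ht => ?_) (fun t ht => ?_)
      · simpa using (hasDerivAt_const t h.1).inner ℝ (hd t ht).2
      · have htI := Ioo_subset_Icc_self ht.1
        rw [Real.norm_eq_abs]
        rcases hG (γ t) ⟨hdist' t htI, (hd t ht).1⟩ with hc | hc
        · exact hspeed i hzero _ hc (hdist t htI)
        · exact hspeed j hzeroj _ hc (hdist t htI)
    change |inner ℝ h.1 (γ 0) - h.2| ≤ _
    rw [← hzdef, hz', Real.norm_eq_abs, abs_sub_comm] at hmove
    refine hmove.trans ?_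
    have hσ0 := hσ.1
    have hστ := hσ.2
    calc N' * (L * (M + 1)) / lo * τ * (σ - 0) ≤ C * τ * τ := by
          rw [sub_zero]
          gcongr
      _ = C * τ ^ 2 := by ring

end CellDecomposition

end Ellam

/-! ### Almost every trajectory meets tame points only -/

namespace Ellam

/-- Families of sets with volume `O(η²)` as `η → 0`. -/
def VolumeQuadratic {d : ℕ} (A : ℝ → Set (Pt d)) : Prop :=
  ∃ C : ℝ≥0∞, C ≠ ⊤ ∧ ∃ η₀ > 0, ∀ η ∈ Ioc (0 : ℝ) η₀, volume (A η) ≤ ENNReal.ofReal (η ^ 2) * C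

namespace VolumeQuadratic

variable {d : ℕ} {A A' : ℝ → Set (Pt d)}

theorem union (h : VolumeQuadratic A) (h' : VolumeQuadratic A') :
    VolumeQuadratic fun η => A η ∪ A' η := by
  obtain ⟨C, hC, η₀, hη₀, hA⟩ := h
  obtain ⟨C', hC', η₁, hη₁, hA'⟩ := h'
  refine ⟨C + C', ENNReal.add_ne_top.2 ⟨hC, hC'⟩, min η₀ η₁, lt_min hη₀ hη₁, fun η hη => ?_⟩
  rw [mul_add]
  exact (measure_union_le _ _).trans (add_le_add
    (hA η ⟨hη.1, hη.2.trans (min_le_left _ _)⟩) (hA' η ⟨hη.1, hη.2.trans (min_le_right _ _)⟩))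

theorem biUnion {κ : Type*} {s : Set κ} (hs : s.Finite) {A : κ → ℝ → Set (Pt d)}
    (h : ∀ p ∈ s, VolumeQuadratic (A p)) : VolumeQuadratic fun η => ⋃ p ∈ s, A p η := by
  induction s, hs using Set.Finite.induction_on with
  | empty => exact ⟨0, ENNReal.zero_ne_top, 1, one_pos, fun η _ => by simp⟩
  | insert ha hs ih =>
    simp only [biUnion_insert]
    exact (h _ (mem_insert _ _)).union (ih fun p hp => h p (mem_insert_of_mem _ hp))

theorem mono (h : VolumeQuadratic A) (hsub : ∀ η, A' η ⊆ A η) : VolumeQuadratic A' := by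
  obtain ⟨C, hC, η₀, hη₀, hA⟩ := h
  exact ⟨C, hC, η₀, hη₀, fun η hη => (measure_mono (hsub η)).trans (hA η hη)⟩

end VolumeQuadratic

/-- Points that are `C η`-close to two hyperplanes of `H`, or `C η²`-close to one of them. -/
def nearFaces {d : ℕ} (H : Set (Pt d × ℝ)) (C η : ℝ) : Set (Pt d) :=
  {y | (∃ h ∈ H, ∃ h' ∈ H, hyperplane h ≠ hyperplane h' ∧ y ∈ slab h (C * η) ∧
    y ∈ slab h' (C * η)) ∨ ∃ h ∈ H, y ∈ slab h (C * η ^ 2)}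

/-- Two slabs of width `η` around distinct hyperplanes meet in volume `O(η²)`, and one slab of width
`η²` has volume `O(η²)`. This order is what outweighs the `T / η` time slots. -/
theorem volumeQuadratic_nearFaces {d : ℕ} {H : Set (Pt d × ℝ)} (hH : H.Finite)
    (hn : ∀ h ∈ H, h.1 ≠ 0) {C : ℝ} (hC : 0 < C) (R : ℝ) :
    VolumeQuadratic fun η => Metric.ball 0 R ∩ nearFaces H C η := by
  have h1 : VolumeQuadratic fun η => ⋃ p ∈ {p ∈ H ×ˢ H | hyperplane p.1 ≠ hyperplane p.2},
      Metric.ball (0 : Pt d) R ∩ (slab p.1 (C * η) ∩ slab p.2 (C * η)) := by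
    refine VolumeQuadratic.biUnion ((hH.prod hH).subset (sep_subset _ _)) fun p hp => ?_
    obtain ⟨K, hK, δ₀, hδ₀, hle⟩ :=
      exists_volume_slab_inter_slab_le (hn _ hp.1.1) (hn _ hp.1.2) hp.2 R
    refine ⟨ENNReal.ofReal (C ^ 2) * K, ENNReal.mul_ne_top ENNReal.ofReal_ne_top hK, δ₀ / C,
      by positivity, fun η hη => ?_⟩
    have hη2 := hη.2
    rw [le_div_iff₀ hC] at hη2
    refine (hle (C * η) ⟨mul_pos hC hη.1, by linarith⟩).trans_eq ?_
    rw [← mul_assoc, ← ENNReal.ofReal_mul (by positivity), mul_pow, mul_comm (C ^ 2)]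
  have h2 : VolumeQuadratic fun η => ⋃ h ∈ H, Metric.ball (0 : Pt d) R ∩ slab h (C * η ^ 2) := by
    refine VolumeQuadratic.biUnion hH fun h hh => ?_
    obtain ⟨K, hK, hle⟩ := exists_volume_slab_le (hn h hh) R
    refine ⟨ENNReal.ofReal C * K, ENNReal.mul_ne_top ENNReal.ofReal_ne_top hK, min 1 (1 / C),
      by positivity, fun η hη => ?_⟩
    have hη1 := hη.2.trans (min_le_left _ _)
    have hη2 := hη.2.trans (min_le_right _ _)
    rw [le_div_iff₀ hC] at hη2
    have hη0 := hη.1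
    refine (hle (C * η ^ 2) ⟨by positivity, by nlinarith⟩).trans_eq ?_
    rw [← mul_assoc, ← ENNReal.ofReal_mul (by positivity), mul_comm C]
  refine (h1.union h2).mono fun η y hy => ?_
  rcases hy.2 with ⟨h, hh, h', hh', hne, ha, hb⟩ | ⟨h, hh, ha⟩
  · exact Or.inl (mem_iUnion₂.2 ⟨(h, h'), ⟨⟨hh, hh'⟩, hne⟩, hy.1, ha, hb⟩)
  · exact Or.inr (mem_iUnion₂.2 ⟨h, hh, hy.1, ha⟩)

section

variable {d : ℕ} {ι : Type*} {Ω G : Set (Pt d)} {T lo hi M Cd : ℝ} {φ : Pt d → ℝ}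
  {V : Pt d → Pt d} {F : ℝ → Pt d → Pt d} {cell : ι → Set (Pt d)} {φc : ι → Pt d → ℝ}
  {Vc : ι → Pt d → Pt d} {H : Set (Pt d × ℝ)}

theorem FlowSetting.porousMeasure_le (hS : FlowSetting Ω G T lo hi M Cd φ V F) (B : Set (Pt d)) :
    porousMeasure Ω φ B ≤ ENNReal.ofReal hi * leb Ω B := by
  have h1 : porousMeasure Ω φ ≤ (leb Ω).withDensity fun _ => ENNReal.ofReal hi := by
    refine withDensity_mono ?_
    filter_upwards [hS.ae_mem_cells] with x hx
    exact ENNReal.ofReal_le_ofReal (hS.φ_bounds x hx).2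
  rw [withDensity_const] at h1
  exact h1 B

/-- Almost every curve meets tame points only. -/
theorem CellDecomposition.measure_hits_eq_zero [Finite ι]
    (hD : CellDecomposition Ω G φ V cell φc Vc H)
    (hS : FlowSetting Ω G T lo hi M Cd φ V F) :
    porousMeasure Ω φ {x | x ∈ flowDomain Ω G T φ V F ∧
      ∃ s ∈ Icc 0 T, ¬ IsTame G (transportField φ V) (F s x)} = 0 := by
  obtain ⟨C, hC, hnear⟩ := hD.exists_near_faces hS
  obtain ⟨R, hR⟩ := hS.isBounded.subset_ball 0
  obtain ⟨K, hK, η₀, hη₀, hvol⟩ := volumeQuadratic_nearFaces hD.finite hD.normal_ne_zero hC R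
  have hT := hS.T_pos
  have hM := hS.M_nonneg
  have hlo := hS.lo_pos
  have hCd := hS.Cd_nonneg
  -- `exists_near_faces` needs a ball of fixed radius inside `Ω` around the point that is hit.
  -- Trajectories are therefore sorted by their distance `δ` to the complement of `Ω`.
  have main : ∀ δ > 0, porousMeasure Ω φ {x | x ∈ flowDomain Ω G T φ V F ∧ x ∈ G ∧
      (∀ s ∈ Icc 0 T, Metric.ball (F s x) δ ⊆ Ω) ∧
      ∃ s ∈ Icc 0 T, ¬ IsTame G (transportField φ V) (F s x)} = 0 := by
    intro δ hδ
    set A := {x | x ∈ flowDomain Ω G T φ V F ∧ x ∈ G ∧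
      (∀ s ∈ Icc 0 T, Metric.ball (F s x) δ ⊆ Ω) ∧
      ∃ s ∈ Icc 0 T, ¬ IsTame G (transportField φ V) (F s x)} with hA
    set D : ℝ≥0∞ := ENNReal.ofReal (Real.exp (Cd / lo * T)) * (ENNReal.ofReal hi * K) with hDdef
    have hDtop : D ≠ ⊤ := ENNReal.mul_ne_top ENNReal.ofReal_ne_top
      (ENNReal.mul_ne_top ENNReal.ofReal_ne_top hK)
    -- Time is cut into `k` slots of length `η = T / k`. Each contributes a measure of order `η²`,
    -- and `k * η ^ 2 = T ^ 2 / k`.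
    have hbound : ∀ᶠ k : ℕ in Filter.atTop,
        porousMeasure Ω φ A ≤ ENNReal.ofReal (T ^ 2 / k) * D := by
      filter_upwards [Filter.eventually_gt_atTop 0,
        tendsto_natCast_atTop_atTop.eventually_ge_atTop (T / η₀),
        tendsto_natCast_atTop_atTop.eventually_ge_atTop ((M + 1) * T / δ)] with k hk0 hk1 hk2
      have hk : (0 : ℝ) < k := by exact_mod_cast hk0
      set η := T / k with hη
      have hηpos : 0 < η := by positivity
      have hη1 : η ≤ η₀ := by
        rw [div_le_iff₀ hη₀] at hk1
        rw [hη, div_le_iff₀ hk]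
        linarith
      have hη2 : (M + 1) * η ≤ δ := by
        rw [div_le_iff₀ hδ] at hk2
        rw [hη, mul_div_assoc', div_le_iff₀ hk]
        linarith
      have hkη : k * η = T := by rw [hη]; field_simp
      have hjT : ∀ j : ℕ, j ≤ k → (j : ℝ) * η ≤ T := by
        intro j hj
        rw [← hkη]
        exact mul_le_mul_of_nonneg_right (by exact_mod_cast hj) hηpos.le
      -- `j + 1` is the first index such that a bad point is met before time `(j + 1) * η`; it is
      -- not `0`, because `x ∈ G` is tame. Up to time `j * η` the trajectory is tame, and from there
      -- a bad point is at most `η` away in time.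
      have hsub : A ⊆ ⋃ j ∈ Finset.range k, {x | x ∈ flowDomain Ω G T φ V F ∧
          (∀ s ∈ Icc 0 (j * η), IsTame G (transportField φ V) (F s x)) ∧
          F (j * η) x ∈ Metric.ball 0 R ∩ nearFaces H C η} := by
        rintro x ⟨hx, hxG, hxball, s₀, hs₀, hbad⟩
        classical
        have hex : ∃ j : ℕ, ∃ s ∈ Icc 0 (j * η), ¬ IsTame G (transportField φ V) (F s x) :=
          ⟨k, s₀, by rw [hkη]; exact hs₀, hbad⟩
        obtain ⟨s, hs, hsbad⟩ := Nat.find_spec hex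
        have hle : Nat.find hex ≤ k := Nat.find_min' hex ⟨s₀, by rw [hkη]; exact hs₀, hbad⟩
        have hne : Nat.find hex ≠ 0 := by
          intro h0
          rw [h0] at hs
          have hs0 : s = 0 := le_antisymm (by simpa using hs.2) hs.1
          rw [hs0, hx.2.1] at hsbad
          exact hsbad (hD.isTame_of_mem hS hxG)
        obtain ⟨j, hj⟩ := Nat.exists_eq_succ_of_ne_zero hne
        have hjk : j < k := by omega
        have htame : ∀ s ∈ Icc 0 (j * η), IsTame G (transportField φ V) (F s x) := by
          intro r hr
          by_contra hcon
          exact Nat.find_min hex (m := j) (by omega) ⟨r, hr, hcon⟩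
        have hjs : j * η < s := by
          by_contra hcon
          exact hsbad (htame s ⟨hs.1, not_lt.1 hcon⟩)
        have hsj : s ≤ j * η + η := by
          have := hs.2
          rw [hj] at this
          push_cast at this
          linarith
        have hsT : s ≤ T := hs.2.trans (hjT _ hle)
        have hj0 : 0 ≤ (j : ℝ) * η := by positivity
        refine mem_iUnion₂.2 ⟨j, Finset.mem_range.2 hjk, hx, htame, ?_, ?_⟩
        · exact hR (hx.2.2.1 _ ⟨hj0, hjT j hjk.le⟩)
        · have hc : IsFieldCurve G (transportField φ V) 0 (s - j * η)
              (fun r => F (r + j * η) x) := by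
            have := (hx.2.2.2.mono hj0 hsT).comp_add (j * η)
            simpa using this
          have := hnear δ hδ η hηpos hη2 (s - j * η) ⟨by linarith, by linarith⟩ _ hc
            (by simpa using hxball s ⟨hs.1, hsT⟩) (by simpa using hsbad)
          simp only [zero_add] at this
          exact this
      calc porousMeasure Ω φ A ≤ _ := measure_mono hsub
        _ ≤ ∑ j ∈ Finset.range k, _ := measure_biUnion_finset_le _ _
        _ ≤ ∑ j ∈ Finset.range k, ENNReal.ofReal (η ^ 2) * D := by
            refine Finset.sum_le_sum fun j hj => ?_
            have hj' : (j : ℝ) * η ≤ T := hjT j (Finset.mem_range.1 hj).le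
            refine (hS.measure_flow_preimage_tame_le ⟨by positivity, hj'⟩ _).trans ?_
            rw [hDdef, mul_left_comm (ENNReal.ofReal (η ^ 2))]
            refine mul_le_mul' (ENNReal.ofReal_le_ofReal (Real.exp_le_exp.2 ?_)) ?_
            · exact mul_le_mul_of_nonneg_left hj' (by positivity)
            · refine (hS.porousMeasure_le _).trans ?_
              rw [mul_left_comm (ENNReal.ofReal (η ^ 2))]
              exact mul_le_mul_right ((Measure.restrict_le_self _).trans (hvol η ⟨hηpos, hη1⟩)) _
        _ = ENNReal.ofReal (T ^ 2 / k) * D := by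
            rw [Finset.sum_const, Finset.card_range, nsmul_eq_mul, ← mul_assoc,
              ← ENNReal.ofReal_natCast, ← ENNReal.ofReal_mul hk.le]
            congr 2
            rw [hη]; field_simp
    have hlim : Filter.Tendsto (fun k : ℕ => ENNReal.ofReal (T ^ 2 / k) * D) Filter.atTop
        (nhds 0) := by
      have h1 : Filter.Tendsto (fun k : ℕ => ENNReal.ofReal (T ^ 2 / k)) Filter.atTop (nhds 0) := by
        simpa using ENNReal.tendsto_ofReal (tendsto_const_div_atTop_nhds_zero_nat (T ^ 2))
      simpa using ENNReal.Tendsto.mul_const h1 (Or.inr hDtop)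
    exact le_antisymm (ge_of_tendsto hlim hbound) bot_le
  have hGnull : porousMeasure Ω φ Gᶜ = 0 :=
    FlowSetting.porousMeasure_absolutelyContinuous hS.ae_mem_cells
  -- A trajectory is a compact subset of the open set `Ω`, hence keeps some distance `1 / (m + 1)`
  -- from the complement.
  have hsub : {x | x ∈ flowDomain Ω G T φ V F ∧
      ∃ s ∈ Icc 0 T, ¬ IsTame G (transportField φ V) (F s x)} ⊆ Gᶜ ∪
      ⋃ m : ℕ, {x | x ∈ flowDomain Ω G T φ V F ∧ x ∈ G ∧
        (∀ s ∈ Icc 0 T, Metric.ball (F s x) (1 / ((m : ℝ) + 1)) ⊆ Ω) ∧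
        ∃ s ∈ Icc 0 T, ¬ IsTame G (transportField φ V) (F s x)} := by
    rintro x ⟨hx, hbad⟩
    by_cases hxG : x ∈ G
    · right
      have hc : IsCompact ((fun s => F s x) '' Icc 0 T) :=
        isCompact_Icc.image_of_continuousOn hx.2.2.2.continuousOn
      obtain ⟨δ, hδ, hthick⟩ := hc.exists_thickening_subset_open hS.isOpen
        (by rintro _ ⟨s, hs, rfl⟩; exact hx.2.2.1 s hs)
      obtain ⟨m, hm⟩ := exists_nat_one_div_lt hδ
      refine mem_iUnion.2 ⟨m, hx, hxG, fun s hs y hy => hthick ?_, hbad⟩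
      exact Metric.mem_thickening_iff.2 ⟨F s x, ⟨s, hs, rfl⟩, (Metric.mem_ball.1 hy).trans hm⟩
    · exact Or.inl hxG
  refine measure_mono_null hsub (measure_union_null hGnull (measure_iUnion_null fun m => ?_))
  exact main _ (by positivity)

theorem CellDecomposition.measure_flow_preimage_le [Finite ι]
    (hD : CellDecomposition Ω G φ V cell φc Vc H)
    (hS : FlowSetting Ω G T lo hi M Cd φ V F) {t : ℝ} (ht : t ∈ Icc 0 T) (B : Set (Pt d)) :
    porousMeasure Ω φ {x | F t x ∈ B}
      ≤ ENNReal.ofReal (Real.exp (Cd / lo * t)) * porousMeasure Ω φ B := by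
  have hsub : {x | F t x ∈ B} ⊆ ((flowDomain Ω G T φ V F)ᶜ ∪ {x | x ∈ flowDomain Ω G T φ V F ∧
      ∃ s ∈ Icc 0 T, ¬ IsTame G (transportField φ V) (F s x)}) ∪
      {x | x ∈ flowDomain Ω G T φ V F ∧
        (∀ s ∈ Icc 0 t, IsTame G (transportField φ V) (F s x)) ∧ F t x ∈ B} := by
    intro x hx
    by_cases hxY : x ∈ flowDomain Ω G T φ V F
    · by_cases hbad : ∃ s ∈ Icc 0 T, ¬ IsTame G (transportField φ V) (F s x)
      · exact Or.inl (Or.inr ⟨hxY, hbad⟩)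
      · push Not at hbad
        exact Or.inr ⟨hxY, fun s hs => hbad s ⟨hs.1, hs.2.trans ht.2⟩, hx⟩
    · exact Or.inl (Or.inl hxY)
  refine (measure_mono hsub).trans ((measure_union_le _ _).trans ?_)
  rw [measure_union_null hS.porousMeasure_compl_flowDomain (hD.measure_hits_eq_zero hS), zero_add]
  exact hS.measure_flow_preimage_tame_le ht B

end

end Ellam

/-! ### From meshes to the flow of an admissible velocity -/

namespace Ellam

variable {d : ℕ} {Ω : Set (Pt d)}

theorem contDiff_eval_mvPolynomial (p : MvPolynomial (Fin d) ℝ) :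
    ContDiff ℝ ∞ (fun x : Pt d => MvPolynomial.eval (fun j => x j) p) := by
  have h := AnalyticOnNhd.eval_continuousLinearMap'
    (fun j : Fin d => (EuclideanSpace.proj j : Pt d →L[ℝ] ℝ)) p
  exact contDiffOn_univ.1 (h.contDiffOn uniqueDiffOn_univ)

theorem PiecewisePolynomial.exists_contDiff {M : Set (Set (Pt d))} {V : Pt d → Pt d}
    (h : PiecewisePolynomial M V) {K : Set (Pt d)} (hK : K ∈ M) :
    ∃ W : Pt d → Pt d, ContDiff ℝ ∞ W ∧ EqOn V W K := by
  obtain ⟨P, hP⟩ := h K hK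
  refine ⟨fun x => WithLp.toLp 2 fun i => MvPolynomial.eval (fun j => x j) (P i),
    contDiff_euclidean.2 fun i => contDiff_eval_mvPolynomial (P i), fun x hx => ?_⟩
  ext i
  exact hP x hx i

theorem IsMesh.exists_hyperplanes {M : Set (Set (Pt d))} (hM : IsMesh Ω M) :
    ∃ H : Set (Pt d × ℝ), H.Finite ∧ (∀ h ∈ H, h.1 ≠ 0) ∧
      Ω \ ⋃₀ M ⊆ ⋃ h ∈ H, hyperplane h := by
  have hex : ∀ K : M, ∃ H : Set (Pt d × ℝ), H.Finite ∧ (∀ h ∈ H, h.1 ≠ 0) ∧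
      frontier K.1 ⊆ ⋃ h ∈ H, {x | inner ℝ h.1 x = h.2} :=
    fun K => (hM.cell K.1 K.2).frontier_subset
  choose H hfin hne hsub using hex
  have := hM.finite.to_subtype
  refine ⟨⋃ K, H K, finite_iUnion hfin, fun h hh => ?_, fun x hx => ?_⟩
  · obtain ⟨K, hK⟩ := mem_iUnion.1 hh
    exact hne K h hK
  · obtain ⟨K, hK, hxK⟩ := mem_iUnion₂.1 (hM.cover hx.1)
    have hxf : x ∈ frontier K := by
      rw [(hM.cell K hK).isOpen.frontier_eq]
      exact ⟨hxK, fun h => hx.2 ⟨K, hK, h⟩⟩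
    obtain ⟨h, hh, hxh⟩ := mem_iUnion₂.1 (hsub ⟨K, hK⟩ hxf)
    exact mem_iUnion₂.2 ⟨h, mem_iUnion.2 ⟨⟨K, hK⟩, hh⟩, hxh⟩

theorem exists_cellDecomposition {Mφ Mu : Set (Set (Pt d))} {φ : Pt d → ℝ} {V : Pt d → Pt d}
    (hMφ : IsMesh Ω Mφ) (hMu : IsMesh Ω Mu) (hφ : PiecewiseSmooth Mφ φ)
    (hV : PiecewisePolynomial Mu V) :
    ∃ (cell : Mφ × Mu → Set (Pt d)) (φc : Mφ × Mu → Pt d → ℝ) (Vc : Mφ × Mu → Pt d → Pt d)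
      (H : Set (Pt d × ℝ)), CellDecomposition Ω (⋃₀ Mφ ∩ ⋃₀ Mu) φ V cell φc Vc H := by
  obtain ⟨H, hH, hHn, hHc⟩ := hMφ.exists_hyperplanes
  obtain ⟨H', hH', hHn', hHc'⟩ := hMu.exists_hyperplanes
  have hexφ : ∀ K : Mφ, ∃ g : Pt d → ℝ, ContDiff ℝ ∞ g ∧ EqOn φ g K.1 := fun K => hφ K.1 K.2
  have hexV : ∀ K : Mu, ∃ W : Pt d → Pt d, ContDiff ℝ ∞ W ∧ EqOn V W K.1 :=
    fun K => hV.exists_contDiff K.2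
  choose g hg hgφ using hexφ
  choose W hW hWV using hexV
  refine ⟨fun i => i.1.1 ∩ i.2.1, fun i => g i.1, fun i => W i.2, H ∪ H', hH.union hH', ?_, ?_,
    fun i => ((hMφ.cell _ i.1.2).isOpen).inter (hMu.cell _ i.2.2).isOpen, ?_, ?_,
    fun i => hg i.1, fun i => hW i.2, fun i => (hgφ i.1).mono inter_subset_left,
    fun i => (hWV i.2).mono inter_subset_right⟩
  · rintro h (hh | hh)
    exacts [hHn h hh, hHn' h hh]
  · rintro x ⟨hxΩ, hx⟩
    rw [biUnion_union]
    by_cases h : x ∈ ⋃₀ Mφ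
    · exact Or.inr (hHc' ⟨hxΩ, fun h' => hx ⟨h, h'⟩⟩)
    · exact Or.inl (hHc ⟨hxΩ, h⟩)
  · rintro ⟨K, L⟩ ⟨K', L'⟩ hne
    by_cases hK : K = K'
    · have hL : L ≠ L' := fun hL => hne (by rw [hK, hL])
      exact (hMu.disjoint L.2 L'.2 (fun h => hL (Subtype.ext h))).mono inter_subset_right
        inter_subset_right
    · exact (hMφ.disjoint K.2 K'.2 (fun h => hK (Subtype.ext h))).mono inter_subset_left
        inter_subset_left
  · ext x
    simp only [mem_inter_iff, mem_sUnion, mem_iUnion, Prod.exists, Subtype.exists]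
    constructor
    · rintro ⟨⟨K, hK, hx⟩, L, hL, hx'⟩
      exact ⟨K, hK, L, hL, hx, hx'⟩
    · rintro ⟨K, hK, L, hL, hx, hx'⟩
      exact ⟨⟨K, hK, hx⟩, L, hL, hx'⟩

theorem forall_le_of_ae_restrict {E : Type*} [TopologicalSpace E] [MeasurableSpace E]
    [OpensMeasurableSpace E] {μ : Measure E} [μ.IsOpenPosMeasure] {f : E → ℝ} {G : Set E}
    (hf : ContinuousOn f G) (hG : IsOpen G) {a : ℝ} (h : ∀ᵐ x ∂μ.restrict G, a ≤ f x) :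
    ∀ x ∈ G, a ≤ f x := by
  intro x hx
  by_contra hlt
  have hopen : IsOpen (G ∩ f ⁻¹' Iio a) := hf.isOpen_inter_preimage hG isOpen_Iio
  have hpos := hopen.measure_pos μ ⟨x, hx, not_le.1 hlt⟩
  rw [ae_iff, Measure.restrict_apply₀' hG.measurableSet.nullMeasurableSet] at h
  have hsub : G ∩ f ⁻¹' Iio a ⊆ {y | ¬ a ≤ f y} ∩ G := fun y hy => ⟨not_le.2 hy.2, hy.1⟩
  exact hpos.ne' (measure_mono_null hsub h)

theorem CellDecomposition.exists_flowSetting {ι : Type*} [Finite ι] {G : Set (Pt d)}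
    {T lo hi Cd : ℝ} {φ : Pt d → ℝ} {V : Pt d → Pt d} {F : ℝ → Pt d → Pt d}
    {cell : ι → Set (Pt d)} {φc : ι → Pt d → ℝ} {Vc : ι → Pt d → Pt d} {H : Set (Pt d × ℝ)}
    (hD : CellDecomposition Ω G φ V cell φc Vc H) (hΩ : IsOpen Ω) (hb : Bornology.IsBounded Ω)
    (hGΩ : G ⊆ Ω) (hT : 0 < T) (hlo : 0 < lo) (hCd : 0 ≤ Cd)
    (hφ : ∀ᵐ x ∂leb Ω, lo ≤ φ x ∧ φ x ≤ hi)
    (hdiv : ∃ g : Pt d → ℝ, MemLp g 2 (leb Ω) ∧ (∀ᵐ x ∂leb Ω, |g x| ≤ Cd) ∧ HasDivNoFlux Ω V g)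
    (hF : IsFlow Ω G T φ V F) : ∃ M, FlowSetting Ω G T lo hi M Cd φ V F := by
  have hG : IsOpen G := by
    rw [hD.eq_iUnion]; exact isOpen_iUnion hD.isOpen_cell
  have hφc : ContinuousOn φ G := by
    rw [hD.eq_iUnion]
    exact ContinuousOn.iUnion_of_isOpen
      (fun i => (hD.contDiff_φc i).continuous.continuousOn.congr (hD.eqOn_φ i)) hD.isOpen_cell
  have hVc : ContinuousOn V G := by
    rw [hD.eq_iUnion]
    exact ContinuousOn.iUnion_of_isOpen
      (fun i => (hD.contDiff_Vc i).continuous.continuousOn.congr (hD.eqOn_V i)) hD.isOpen_cell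
  have hφG : ∀ᵐ x ∂leb G, lo ≤ φ x ∧ φ x ≤ hi := ae_restrict_of_ae_restrict_of_subset hGΩ hφ
  have hlow : ∀ x ∈ G, lo ≤ φ x := forall_le_of_ae_restrict hφc hG (hφG.mono fun x hx => hx.1)
  have hup : ∀ x ∈ G, φ x ≤ hi := by
    intro x hx
    have := forall_le_of_ae_restrict hφc.neg hG (hφG.mono fun x hx => neg_le_neg hx.2) x hx
    exact neg_le_neg_iff.1 this
  obtain ⟨R, hR⟩ := hb.subset_closedBall 0
  have hbd : ∀ i, ∃ C, ∀ x ∈ Metric.closedBall (0 : Pt d) R, ‖Vc i x‖ ≤ C := fun i =>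
    (isCompact_closedBall _ _).exists_bound_of_continuousOn
      (hD.contDiff_Vc i).continuous.continuousOn
  choose C hC using hbd
  obtain ⟨C', hC'⟩ := Finite.exists_le C
  refine ⟨lo⁻¹ * max C' 0, hΩ, hb, hG, hGΩ, ?_, hT, hlo, fun x hx => ⟨hlow x hx, hup x hx⟩,
    hφc, hVc, by positivity, fun x hx => ?_, hCd, hdiv, hF⟩
  · refine measure_mono_null hD.cover ((measure_biUnion_null_iff hD.finite.countable).2
      fun h hh => ?_)
    exact volume_hyperplane (hD.normal_ne_zero h hh) h.2
  · obtain ⟨i, hi⟩ : ∃ i, x ∈ cell i := by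
      rw [hD.eq_iUnion] at hx; exact mem_iUnion.1 hx
    have h1 : ‖V x‖ ≤ max C' 0 := by
      rw [hD.eqOn_V i hi]
      exact ((hC i x (hR (hGΩ hx))).trans (hC' i)).trans (le_max_left _ _)
    rw [transportField, norm_smul, norm_inv, Real.norm_of_nonneg (hlo.le.trans (hlow x hx))]
    exact mul_le_mul (inv_anti₀ hlo (hlow x hx)) h1 (norm_nonneg _) (by positivity)

/-- The flow of an admissible velocity compresses the measure `φ dx` at most exponentially. -/
theorem IsFlow.measure_preimage_le {Mφ Mu : Set (Set (Pt d))} {φ : Pt d → ℝ} {V : Pt d → Pt d}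
    {F : ℝ → Pt d → Pt d} {T lo hi Mdiv : ℝ} (hΩ : IsOpen Ω) (hb : Bornology.IsBounded Ω)
    (hMφ : IsMesh Ω Mφ) (hMu : IsMesh Ω Mu) (hφs : PiecewiseSmooth Mφ φ)
    (hV : IsAdmissibleVelocity Ω Mu Mdiv V) (hT : 0 < T) (hlo : 0 < lo)
    (hφ : ∀ᵐ x ∂leb Ω, lo ≤ φ x ∧ φ x ≤ hi)
    (hF : IsFlow Ω (⋃₀ Mφ ∩ ⋃₀ Mu) T φ V F) {t : ℝ} (ht : t ∈ Icc 0 T) (B : Set (Pt d)) :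
    porousMeasure Ω φ {x | F t x ∈ B}
      ≤ ENNReal.ofReal (Real.exp (|Mdiv| / lo * t)) * porousMeasure Ω φ B := by
  obtain ⟨cell, φc, Vc, H, hD⟩ := exists_cellDecomposition hMφ hMu hφs hV.piecewise
  obtain ⟨g, hg, hgM, hgd⟩ := hV.exists_div
  have := hMφ.finite.to_subtype
  have := hMu.finite.to_subtype
  obtain ⟨M, hS⟩ := hD.exists_flowSetting hΩ hb
    (fun x hx => by obtain ⟨K, hK, hxK⟩ := hx.1; exact hMφ.subset K hK hxK) hT hlo
    (abs_nonneg Mdiv) hφ ⟨g, hg, hgM.mono fun x hx => hx.trans (le_abs_self _), hgd⟩ hF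
  exact hD.measure_flow_preimage_le hS ht B

end Ellam

/-! ### Integral inequalities for maps of bounded compression -/

namespace Ellam

section Measure

variable {α : Type*} [MeasurableSpace α] {μ : Measure α}

/-- This form of Cauchy-Schwarz fits weights directly: `s² p - 2 s |f| + r` is nonnegative for all
`s`, and so is its integral, whose discriminant is then nonpositive. -/
theorem abs_integral_le_sqrt_mul_sqrt {f p r : α → ℝ} (hp : Integrable p μ) (hr : Integrable r μ)
    (hp0 : ∀ᵐ x ∂μ, 0 ≤ p x) (hr0 : ∀ᵐ x ∂μ, 0 ≤ r x) (hf : AEStronglyMeasurable f μ)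
    (hfpr : ∀ᵐ x ∂μ, f x ^ 2 ≤ p x * r x) :
    |∫ x, f x ∂μ| ≤ √(∫ x, p x ∂μ) * √(∫ x, r x ∂μ) := by
  have hpt : ∀ᵐ x ∂μ, ∀ s : ℝ, 0 ≤ s ^ 2 * p x - 2 * s * |f x| + r x := by
    filter_upwards [hp0, hr0, hfpr] with x hpx hrx hx s
    rcases hpx.eq_or_lt with h0 | h0
    · have : f x ^ 2 ≤ 0 := by simpa [← h0] using hx
      have : f x = 0 := by nlinarith [sq_nonneg (f x)]
      simp [this, ← h0, hrx]
    · have h1 : 0 ≤ p x * (s ^ 2 * p x - 2 * s * |f x| + r x) := by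
        nlinarith [sq_nonneg (s * p x - |f x|), sq_abs (f x)]
      exact nonneg_of_mul_nonneg_right h1 h0
  have hfi : Integrable f μ := by
    refine ((hp.add hr).mono' hf ?_)
    filter_upwards [hpt, hp0, hr0] with x hx hpx hrx
    have := hx 1
    rw [Real.norm_eq_abs, Pi.add_apply]
    nlinarith [abs_nonneg (f x)]
  set X := ∫ x, p x ∂μ
  set Y := ∫ x, r x ∂μ
  have hX : 0 ≤ X := integral_nonneg_of_ae hp0
  have hY : 0 ≤ Y := integral_nonneg_of_ae hr0
  have hdisc : ∀ s : ℝ, 0 ≤ X * (s * s) + (-2 * ∫ x, |f x| ∂μ) * s + Y := by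
    intro s
    have h1 : 0 ≤ ∫ x, (s ^ 2 * p x - 2 * s * |f x| + r x) ∂μ :=
      integral_nonneg_of_ae (hpt.mono fun x hx => hx s)
    have h2 : Integrable (fun x => s ^ 2 * p x - 2 * s * |f x|) μ :=
      (hp.const_mul _).sub (hfi.abs.const_mul _)
    rw [integral_add h2 hr, integral_sub (hp.const_mul _) (hfi.abs.const_mul _), integral_const_mul,
      integral_const_mul] at h1
    change 0 ≤ s ^ 2 * X - _ + Y at h1
    linarith
  have h2 := discrim_le_zero hdisc
  rw [discrim] at h2
  rw [← Real.sqrt_mul hX]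
  refine (abs_integral_le_integral_abs).trans (Real.le_sqrt_of_sq_le ?_)
  nlinarith

/-- Layer-cake formula: up to a null set, `{t < v²}` is contained in the preimage under `Φ` of `{t <
P²}`. Only `v` and `P` have to be measurable, not `Φ`. -/
theorem lintegral_sq_le_of_le_comp {ν : Measure α} {Φ : α → α} {κ : ℝ≥0∞} (hκ : κ ≠ ⊤)
    (hΦ : ∀ B, ν {x | Φ x ∈ B} ≤ κ * ν B) {P v : α → ℝ} (hP : AEMeasurable P ν)
    (hv : AEMeasurable v ν) (hvP : ∀ᵐ x ∂ν, |v x| ≤ |P (Φ x)|) :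
    ∫⁻ x, ENNReal.ofReal (v x ^ 2) ∂ν ≤ κ * ∫⁻ x, ENNReal.ofReal (P x ^ 2) ∂ν := by
  rw [lintegral_eq_lintegral_meas_lt ν (Filter.Eventually.of_forall fun x => sq_nonneg _)
    (hv.pow_const 2), lintegral_eq_lintegral_meas_lt ν
      (Filter.Eventually.of_forall fun x => sq_nonneg _) (hP.pow_const 2),
    ← lintegral_const_mul' _ _ hκ]
  refine lintegral_mono fun t => (measure_mono_ae ?_).trans (hΦ {x | t < P x ^ 2})
  filter_upwards [hvP] with x hx hxt
  exact lt_of_lt_of_le hxt (sq_le_sq.2 hx)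

/-- An integrand bounded by the composition of a function with a map of bounded compression, which
need not be measurable. -/
theorem abs_integral_le_of_le_comp {φ : α → ℝ} (hφm : AEStronglyMeasurable φ μ)
    (hφ : ∀ᵐ x ∂μ, 0 < φ x) {Φ : α → α} {κ : ℝ} (hκ : 0 ≤ κ)
    (hΦ : ∀ B, (μ.withDensity fun x => ENNReal.ofReal (φ x)) {x | Φ x ∈ B}
      ≤ ENNReal.ofReal κ * (μ.withDensity fun x => ENNReal.ofReal (φ x)) B)
    {P h k p : α → ℝ} (hP : AEStronglyMeasurable P μ) (hPi : Integrable (fun x => φ x * P x ^ 2) μ)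
    (hk : AEStronglyMeasurable k μ) (hp : Integrable p μ)
    (hkp : ∀ᵐ x ∂μ, k x ^ 2 ≤ p x * φ x) (hh : ∀ᵐ x ∂μ, |h x| ≤ |k x| * |P (Φ x)|) :
    |∫ x, h x ∂μ| ≤ √(∫ x, p x ∂μ) * √(κ * ∫ x, φ x * P x ^ 2 ∂μ) := by
  -- The Bochner integral of a non-measurable function is `0` by convention, and the inequality is
  -- then trivial.
  by_cases hm : AEStronglyMeasurable h μ
  swap
  · rw [integral_non_aestronglyMeasurable hm, abs_zero]; positivity
  set ν := μ.withDensity fun x => ENNReal.ofReal (φ x) with hν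
  have hac : ν ≪ μ := withDensity_absolutelyContinuous _ _
  -- The quotient `w` stands for `P ∘ Φ`, which may not be measurable. Where `k = 0` the bound `hh`
  -- forces `h = 0`, so `h = k * w` survives division by zero.
  set w : α → ℝ := fun x => h x / k x with hw
  have hwm : AEStronglyMeasurable w μ :=
    (hm.aemeasurable.div hk.aemeasurable).aestronglyMeasurable
  have hwP : ∀ᵐ x ∂μ, |w x| ≤ |P (Φ x)| := by
    filter_upwards [hh] with x hx
    rw [hw, abs_div]
    rcases (abs_nonneg (k x)).eq_or_lt with h0 | h0
    · simp [← h0]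
    · rw [div_le_iff₀ h0]; linarith
  have hhw : ∀ᵐ x ∂μ, h x = k x * w x := by
    filter_upwards [hh] with x hx
    by_cases h0 : k x = 0
    · have : |h x| ≤ 0 := by simpa [h0] using hx
      rw [h0, zero_mul]; exact abs_eq_zero.1 (le_antisymm this (abs_nonneg _))
    · rw [hw]; field_simp
  have hconv : ∀ f : α → ℝ, AEStronglyMeasurable f μ →
      ∫⁻ x, ENNReal.ofReal (f x ^ 2) ∂ν = ∫⁻ x, ENNReal.ofReal (φ x * f x ^ 2) ∂μ := by
    intro f hf
    rw [hν, lintegral_withDensity_eq_lintegral_mul₀ hφm.aemeasurable.ennreal_ofReal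
      (hf.aemeasurable.pow_const 2).ennreal_ofReal]
    refine lintegral_congr_ae ?_
    filter_upwards [hφ] with x hx
    rw [Pi.mul_apply, ENNReal.ofReal_mul hx.le]
  have hpos : ∀ f : α → ℝ, 0 ≤ᵐ[μ] fun x => φ x * f x ^ 2 := fun f => by
    filter_upwards [hφ] with x hx
    exact mul_nonneg hx.le (sq_nonneg _)
  have hle := lintegral_sq_le_of_le_comp ENNReal.ofReal_ne_top hΦ
    (hP.aemeasurable.mono_ac hac) (hwm.aemeasurable.mono_ac hac) (hac hwP)
  rw [hconv w hwm, hconv P hP, ← ofReal_integral_eq_lintegral_ofReal hPi (hpos P),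
    ← ENNReal.ofReal_mul hκ] at hle
  have hwi : Integrable (fun x => φ x * w x ^ 2) μ := by
    refine ⟨hφm.mul (hwm.pow 2), ?_⟩
    rw [hasFiniteIntegral_iff_ofReal (hpos w)]
    exact hle.trans_lt ENNReal.ofReal_lt_top
  have hY : 0 ≤ ∫ x, φ x * P x ^ 2 ∂μ := integral_nonneg_of_ae (hpos P)
  rw [← ofReal_integral_eq_lintegral_ofReal hwi (hpos w),
    ENNReal.ofReal_le_ofReal_iff (mul_nonneg hκ hY)] at hle
  refine (abs_integral_le_sqrt_mul_sqrt hp hwi ?_ (hpos w) hm ?_).trans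
    (mul_le_mul_of_nonneg_left (Real.sqrt_le_sqrt hle) (Real.sqrt_nonneg _))
  · filter_upwards [hkp, hφ] with x hx hx0
    exact nonneg_of_mul_nonneg_left ((sq_nonneg (k x)).trans hx) hx0
  · filter_upwards [hkp, hhw] with x hx hx'
    rw [hx', mul_pow, ← mul_assoc]
    exact mul_le_mul_of_nonneg_right hx (sq_nonneg _)

end Measure

/-- The composition of a Carathéodory function with a measurable function is measurable. -/
theorem IsCaratheodory.aestronglyMeasurable_comp {d : ℕ} {S B : Type*} [TopologicalSpace S]
    [TopologicalSpace B] [TopologicalSpace.PseudoMetrizableSpace B] {Ω : Set (Pt d)}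
    {f : Pt d → S → B} (hf : IsCaratheodory Ω f) {U : Pt d → S}
    (hU : AEStronglyMeasurable U (leb Ω)) :
    AEStronglyMeasurable (fun x => f x (U x)) (leb Ω) := by
  have hsimple : ∀ g : SimpleFunc (Pt d) S,
      AEStronglyMeasurable (fun x => f x (g x)) (leb Ω) := by
    intro g
    have hfin : Countable g.range := g.range.countable_toSet.to_subtype
    have hcov : (⋃ s : g.range, g ⁻¹' {s.1}) = univ := by
      refine eq_univ_of_forall fun x => mem_iUnion.2 ⟨⟨g x, g.mem_range_self x⟩, rfl⟩
    rw [← Measure.restrict_univ (μ := leb Ω), ← hcov, aestronglyMeasurable_iUnion_iff]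
    intro s
    refine ((hf.1 s.1).mono_measure Measure.restrict_le_self).congr ?_
    filter_upwards [ae_restrict_mem (g.measurableSet_fiber s.1)] with x hx
    rw [show g x = s.1 from hx]
  have hmk := hU.stronglyMeasurable_mk
  refine aestronglyMeasurable_of_tendsto_ae Filter.atTop (fun n => hsimple (hmk.approx n)) ?_
  filter_upwards [hU.ae_eq_mk, hf.2] with x hx hc
  rw [hx]
  exact (hc.tendsto _).comp (hmk.tendsto_approx x)

theorem aestronglyMeasurable_clm_apply {α E E' : Type*} [MeasurableSpace α] {μ : Measure α}
    [NormedAddCommGroup E] [NormedSpace ℝ E] [NormedAddCommGroup E'] [NormedSpace ℝ E']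
    {f : α → E →L[ℝ] E'} {g : α → E} (hf : AEStronglyMeasurable f μ)
    (hg : AEStronglyMeasurable g μ) : AEStronglyMeasurable (fun x => f x (g x)) μ :=
  isBoundedBilinearMap_apply.continuous.comp_aestronglyMeasurable (hf.prodMk hg)

theorem Icc_le_of_ae_restrict_Ioo {T : ℝ} (hT : 0 < T) {f : ℝ → ℝ} (hf : ContinuousOn f (Icc 0 T))
    {a : ℝ} (h : ∀ᵐ s ∂volume.restrict (Ioo 0 T), a ≤ f s) : ∀ s ∈ Icc 0 T, a ≤ f s := by
  intro s hs
  have h1 := forall_le_of_ae_restrict (hf.mono Ioo_subset_Icc_self) isOpen_Ioo h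
  rw [← closure_Ioo hT.ne] at hs hf
  exact le_on_closure h1 continuousOn_const hf hs

/-! ### Bounds on the sampled source terms -/

section Sampling

variable {d : ℕ} {Ω : Set (Pt d)} {T : ℝ} {N : ℕ} {t : ℕ → ℝ}

theorem monotone_times (ht : ∀ n < N, t n < t (n + 1)) {m n : ℕ} (hmn : m ≤ n) (hn : n ≤ N) :
    t m ≤ t n := by
  induction n, hmn using Nat.le_induction with
  | base => rfl
  | succ k hk ih => exact (ih (by omega)).trans (ht k (by omega)).le

/-- Time samplings preserve pointwise a.e. bounds. -/
theorem IsTimeSampling.forall_ae (hT : 0 < T) (h0 : t 0 = 0) (hN : t N = T)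
    (ht : ∀ n < N, t n < t (n + 1)) {q : Pt d → ℝ → ℝ} {qn : ℕ → Pt d → ℝ}
    (hq : IsTimeSampling Ω T N t q qn) {p : ℝ → Prop}
    (havg : ∀ (a b : ℝ) (f : ℝ → ℝ), a < b → (∀ᵐ s ∂volume.restrict (Ioc a b), p (f s)) →
      p ((b - a)⁻¹ * ∫ s in a..b, f s))
    (hcont : ∀ f : ℝ → ℝ, ContinuousOn f (Icc 0 T) →
      (∀ᵐ s ∂volume.restrict (Ioo 0 T), p (f s)) → ∀ s ∈ Icc 0 T, p (f s))
    (hp : ∀ᵐ z ∂(leb Ω).prod (volume.restrict (Ioo (0 : ℝ) T)), p (q z.1 z.2)) :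
    ∀ n ≤ N, ∀ᵐ x ∂leb Ω, p (qn n x) := by
  have hp' : ∀ᵐ x ∂leb Ω, ∀ᵐ s ∂volume.restrict (Ioo (0 : ℝ) T), p (q x s) :=
    Measure.ae_ae_of_ae_prod hp
  intro n hn
  rcases hq with ⟨h1, h2⟩ | ⟨h1, h2⟩
  · have key : ∀ m < N, ∀ᵐ x ∂leb Ω, p (qn m x) := by
      intro m hm
      filter_upwards [hp', h1 m hm] with x hx hx'
      rw [hx']
      refine havg _ _ _ (ht m hm) ?_
      rw [Measure.restrict_congr_set Ioo_ae_eq_Ioc] at hx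
      refine ae_restrict_of_ae_restrict_of_subset (Ioc_subset_Ioc ?_ ?_) hx
      · rw [← h0]; exact monotone_times ht (Nat.zero_le m) hm.le
      · rw [← hN]; exact monotone_times ht hm le_rfl
    rcases hn.eq_or_lt with rfl | hlt
    · have hpos : 0 < n := by
        rcases Nat.eq_zero_or_pos n with h | h
        · rw [h, h0] at hN; exact absurd hN hT.ne
        · exact h
      filter_upwards [h2, key (n - 1) (by omega)] with x hx hx'
      rwa [hx]
    · exact key n hlt
  · filter_upwards [hp', h1, h2 n hn] with x hx hc hx'
    rw [hx']
    refine hcont _ hc hx _ ⟨?_, ?_⟩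
    · rw [← h0]; exact monotone_times ht (Nat.zero_le n) hn
    · rw [← hN]; exact monotone_times ht hn le_rfl

theorem IsTimeSampling.ae_abs_le (hT : 0 < T) (h0 : t 0 = 0) (hN : t N = T)
    (ht : ∀ n < N, t n < t (n + 1)) {q : Pt d → ℝ → ℝ} {qn : ℕ → Pt d → ℝ}
    (hq : IsTimeSampling Ω T N t q qn) {M : ℝ} (hM : IsBoundedSource Ω T M q) :
    ∀ n ≤ N, ∀ᵐ x ∂leb Ω, |qn n x| ≤ M := by
  refine hq.forall_ae hT h0 hN ht (p := fun y => |y| ≤ M) (fun a b f hab hf => ?_)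
    (fun f hf hae s hs => ?_) hM.2
  · have hb : 0 < b - a := sub_pos.2 hab
    have := intervalIntegral.norm_integral_le_of_norm_le_const_ae (f := f) (a := a) (b := b)
      (C := M) (by
        rw [uIoc_of_le hab.le]
        exact (ae_restrict_iff' measurableSet_Ioc).1 hf)
    rw [abs_of_pos hb, Real.norm_eq_abs] at this
    rw [abs_mul, abs_inv, abs_of_pos hb, inv_mul_le_iff₀ hb]
    linarith
  · have := Icc_le_of_ae_restrict_Ioo hT hf.abs.neg (a := -M) (hae.mono fun s hs => neg_le_neg hs)
      s hs
    exact neg_le_neg_iff.1 this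

theorem IsTimeSampling.ae_nonneg (hT : 0 < T) (h0 : t 0 = 0) (hN : t N = T)
    (ht : ∀ n < N, t n < t (n + 1)) {q : Pt d → ℝ → ℝ} {qn : ℕ → Pt d → ℝ}
    (hq : IsTimeSampling Ω T N t q qn)
    (hp : ∀ᵐ z ∂(leb Ω).prod (volume.restrict (Ioo (0 : ℝ) T)), 0 ≤ q z.1 z.2) :
    ∀ n ≤ N, ∀ᵐ x ∂leb Ω, 0 ≤ qn n x := by
  refine hq.forall_ae hT h0 hN ht (p := fun y => 0 ≤ y) (fun a b f hab hf => ?_)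
    (fun f hf hae s hs => Icc_le_of_ae_restrict_Ioo hT hf hae s hs) hp
  have hb : 0 < b - a := sub_pos.2 hab
  refine mul_nonneg (inv_nonneg.2 hb.le) ?_
  rw [intervalIntegral.integral_of_le hab.le]
  exact integral_nonneg_of_ae hf

end Sampling

end Ellam

/-! ### The energy estimate over one time step -/

namespace Ellam

variable {d : ℕ} {Ω : Set (Pt d)}

theorem IsMesh.aestronglyMeasurable {M : Set (Set (Pt d))} (hM : IsMesh Ω M) {φ : Pt d → ℝ}
    (hφ : PiecewiseSmooth M φ) : AEStronglyMeasurable φ (leb Ω) := by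
  obtain ⟨H, hH, hne, hc⟩ := hM.exists_hyperplanes
  have hopen : IsOpen (⋃₀ M) := isOpen_sUnion fun K hK => (hM.cell K hK).isOpen
  have hnull : volume (Ω \ ⋃₀ M) = 0 :=
    measure_mono_null hc ((measure_biUnion_null_iff hH.countable).2
      fun h hh => volume_hyperplane (hne h hh) h.2)
  have heq : volume.restrict (⋃₀ M) = leb Ω :=
    Measure.restrict_congr_set ((sUnion_subset hM.subset).eventuallyLE.antisymm
      (ae_le_set.2 hnull))
  rw [← heq, sUnion_eq_iUnion]
  refine ContinuousOn.aestronglyMeasurable ?_ (by rw [← sUnion_eq_iUnion]; exact hopen.measurableSet)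
  refine ContinuousOn.iUnion_of_isOpen (fun K => ?_) fun K => (hM.cell K.1 K.2).isOpen
  obtain ⟨g, hg, hgφ⟩ := hφ K.1 K.2
  exact hg.continuous.continuousOn.congr hgφ

theorem LInf.exists_ae_norm_le {B : Type} [NormedAddCommGroup B] (f : LInf Ω B) :
    ∃ R, 0 ≤ R ∧ ∀ᵐ x ∂leb Ω, ‖f x‖ ≤ R := by
  have hf := (Lp.memLp f).eLpNorm_lt_top
  rw [eLpNorm_exponent_top] at hf
  refine ⟨(eLpNormEssSup f (leb Ω)).toReal, ENNReal.toReal_nonneg, ?_⟩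
  filter_upwards [ae_le_eLpNormEssSup (f := f) (μ := leb Ω)] with x hx
  rw [← toReal_enorm]
  exact ENNReal.toReal_mono hf.ne hx

/-- The norm of `f` in `L²(Ω)` with weight `φ`. -/
noncomputable def weightedNorm (Ω : Set (Pt d)) (φ f : Pt d → ℝ) : ℝ := √(∫ x in Ω, φ x * f x ^ 2)

theorem weightedNorm_nonneg (φ f : Pt d → ℝ) : 0 ≤ weightedNorm Ω φ f := Real.sqrt_nonneg _

theorem sq_weightedNorm {φ f : Pt d → ℝ} (hφ : ∀ᵐ x ∂leb Ω, 0 ≤ φ x) :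
    weightedNorm Ω φ f ^ 2 = ∫ x in Ω, φ x * f x ^ 2 := by
  refine Real.sq_sqrt (integral_nonneg_of_ae ?_)
  filter_upwards [hφ] with x hx
  exact mul_nonneg hx (sq_nonneg _)

theorem integrable_mul_sq {φ : Pt d → ℝ} {lo hi : ℝ} (hb : Bornology.IsBounded Ω)
    (hφm : AEStronglyMeasurable φ (leb Ω)) (hlo : 0 < lo)
    (hφ : ∀ᵐ x ∂leb Ω, lo ≤ φ x ∧ φ x ≤ hi) (f : LInf Ω ℝ) :
    Integrable (fun x => φ x * f x ^ 2) (leb Ω) := by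
  have : IsFiniteMeasure (leb Ω) := isFiniteMeasure_restrict.2 hb.measure_lt_top.ne
  obtain ⟨R, hR0, hR⟩ := LInf.exists_ae_norm_le f
  refine Integrable.of_bound (hφm.mul ((Lp.aestronglyMeasurable f).pow 2)) (hi * R ^ 2) ?_
  filter_upwards [hφ, hR] with x hx hxR
  rw [norm_mul, norm_pow, Real.norm_of_nonneg (hlo.le.trans hx.1)]
  exact mul_le_mul hx.2 (pow_le_pow_left₀ (norm_nonneg _) hxR 2) (by positivity)
    (hlo.le.trans (hx.1.trans hx.2))

section Scheme

variable {T : ℝ} {XP XC : Type*}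
  [AddCommGroup XP] [Module ℝ XP] [AddCommGroup XC] [Module ℝ XC]
  {P : Data d Ω} {Mφ : Set (Set (Pt d))} {φlo φhi αA ΛA αD ΛD Mqp Mqm : ℝ}

theorem Data.Admissible.aestronglyMeasurable_discreteU
    (hP : P.Admissible Mφ T φlo φhi αA ΛA αD ΛD Mqp Mqm) (GP : SpaceGD Ω XP)
    (GC : SpaceTimeGD Ω T XC) (p : ℕ → XP) (c : ℕ → XC) (n : ℕ) :
    AEStronglyMeasurable (discreteU P GP GC p c n) (leb Ω) :=
  (aestronglyMeasurable_clm_apply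
    (hP.A_car.aestronglyMeasurable_comp (Lp.aestronglyMeasurable (GC.recon (c n))))
    (Lp.aestronglyMeasurable (GP.grad (p (n + 1))))).neg

theorem Data.Admissible.exists_norm_discreteU_le
    (hP : P.Admissible Mφ T φlo φhi αA ΛA αD ΛD Mqp Mqm) (GP : SpaceGD Ω XP)
    (GC : SpaceTimeGD Ω T XC) (p : ℕ → XP) (c : ℕ → XC) (n : ℕ) :
    ∃ R, 0 ≤ R ∧ ∀ᵐ x ∂leb Ω, ‖discreteU P GP GC p c n x‖ ≤ R := by
  obtain ⟨R, hR0, hR⟩ := LInf.exists_ae_norm_le (GP.grad (p (n + 1)))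
  refine ⟨|ΛA| * R, by positivity, ?_⟩
  filter_upwards [hR, hP.A_bounds] with x hx hA
  rw [discreteU, norm_neg]
  refine (ContinuousLinearMap.le_opNorm _ _).trans ?_
  exact mul_le_mul (((hA _ 0).2).trans (le_abs_self _)) hx (norm_nonneg _) (abs_nonneg _)

theorem Data.Admissible.integrable_dissipation (hb : Bornology.IsBounded Ω)
    (hP : P.Admissible Mφ T φlo φhi αA ΛA αD ΛD Mqp Mqm) (GP : SpaceGD Ω XP)
    (GC : SpaceTimeGD Ω T XC) (p : ℕ → XP) (c : ℕ → XC) (n : ℕ) (g : LInf Ω (Pt d)) :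
    Integrable (fun x => (1 + ‖discreteU P GP GC p c n x‖) * ‖g x‖ ^ 2) (leb Ω) := by
  have : IsFiniteMeasure (leb Ω) := isFiniteMeasure_restrict.2 hb.measure_lt_top.ne
  obtain ⟨R, hR0, hR⟩ := hP.exists_norm_discreteU_le GP GC p c n
  obtain ⟨R', hR0', hR'⟩ := LInf.exists_ae_norm_le g
  refine Integrable.of_bound ((aestronglyMeasurable_const.add
    (hP.aestronglyMeasurable_discreteU GP GC p c n).norm).mul
    ((Lp.aestronglyMeasurable g).norm.pow 2)) ((1 + R) * R' ^ 2) ?_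
  filter_upwards [hR, hR'] with x hx hx'
  rw [Real.norm_of_nonneg (by positivity)]
  gcongr

theorem Data.Admissible.le_integral_diffusion (hb : Bornology.IsBounded Ω)
    (hP : P.Admissible Mφ T φlo φhi αA ΛA αD ΛD Mqp Mqm) (GP : SpaceGD Ω XP)
    (GC : SpaceTimeGD Ω T XC) (p : ℕ → XP) (c : ℕ → XC) (n : ℕ) (g : LInf Ω (Pt d)) :
    αD * (∫ x in Ω, (1 + ‖discreteU P GP GC p c n x‖) * ‖g x‖ ^ 2)
      ≤ ∫ x in Ω, inner ℝ (P.D x (discreteU P GP GC p c n x) (g x)) (g x) := by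
  have hi := hP.integrable_dissipation hb GP GC p c n g
  have hm : AEStronglyMeasurable
      (fun x => inner ℝ (P.D x (discreteU P GP GC p c n x) (g x)) (g x)) (leb Ω) :=
    (aestronglyMeasurable_clm_apply (hP.D_car.aestronglyMeasurable_comp
      (hP.aestronglyMeasurable_discreteU GP GC p c n)) (Lp.aestronglyMeasurable g)).inner
      (Lp.aestronglyMeasurable g)
  have hint : Integrable
      (fun x => inner ℝ (P.D x (discreteU P GP GC p c n x) (g x)) (g x)) (leb Ω) := by
    refine (hi.const_mul ΛD).mono' hm ?_
    filter_upwards [hP.D_bounds] with x hx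
    refine (norm_inner_le_norm _ _).trans ?_
    have h1 := (hx 0 (discreteU P GP GC p c n x)).2
    calc _ ≤ (‖P.D x (discreteU P GP GC p c n x)‖ * ‖g x‖) * ‖g x‖ :=
          mul_le_mul_of_nonneg_right (ContinuousLinearMap.le_opNorm _ _) (norm_nonneg _)
      _ ≤ (ΛD * (1 + ‖discreteU P GP GC p c n x‖) * ‖g x‖) * ‖g x‖ := by gcongr
      _ = _ := by ring
  rw [← integral_const_mul]
  refine integral_mono_ae (hi.const_mul _) hint ?_
  filter_upwards [hP.D_bounds] with x hx
  have := (hx (g x) (discreteU P GP GC p c n x)).1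
  simpa only [mul_assoc] using this

theorem SpaceTimeGD.dt_mem (GC : SpaceTimeGD Ω T XC) {n : ℕ} (hn : n < GC.N) :
    0 < GC.dt n ∧ GC.dt n ≤ T := by
  have h1 := monotone_times GC.t_lt (Nat.zero_le n) hn.le
  have h2 := monotone_times GC.t_lt (Nat.succ_le_of_lt hn) le_rfl
  have h3 := GC.t_lt n hn
  rw [GC.t_zero] at h1
  rw [GC.t_last] at h2
  exact ⟨sub_pos.2 h3, by rw [SpaceTimeGD.dt]; linarith⟩

set_option maxHeartbeats 1000000 in
/-- The energy estimate over one time step, for a flow of compression at most `exp (2 λ dt)`. -/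
theorem ConcentrationStep.energy_le (hb : Bornology.IsBounded Ω) (hT : 0 < T) (hlo : 0 < φlo)
    (hM : IsMesh Ω Mφ) (hP : P.Admissible Mφ T φlo φhi αA ΛA αD ΛD Mqp Mqm) {GP : SpaceGD Ω XP}
    {GC : SpaceTimeGD Ω T XC} {w : ℝ} (hw : w ∈ Icc (0 : ℝ) 1) {qp qm : ℕ → Pt d → ℝ}
    (hqp : IsTimeSampling Ω T GC.N GC.t P.qp qp) (hqm : IsTimeSampling Ω T GC.N GC.t P.qm qm)
    {F : ℝ → Pt d → Pt d} {p : ℕ → XP} {c : ℕ → XC} {n : ℕ} (hn : n < GC.N) {lam : ℝ}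
    (hlam : 0 ≤ lam)
    (hF : ∀ B, porousMeasure Ω P.φ {x | F (GC.dt n) x ∈ B}
      ≤ ENNReal.ofReal (Real.exp (2 * lam * GC.dt n)) * porousMeasure Ω P.φ B)
    (hstep : ConcentrationStep P GP GC w qp qm F p c n) :
    weightedNorm Ω P.φ (GC.recon (c (n + 1))) ^ 2
      + GC.dt n * (αD * ∫ x in Ω,
        (1 + ‖discreteU P GP GC p c n x‖) * ‖GC.grad (c (n + 1)) x‖ ^ 2)
    ≤ Real.exp ((lam + |Mqm| / φlo) * GC.dt n) * weightedNorm Ω P.φ (GC.recon (c n))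
        * weightedNorm Ω P.φ (GC.recon (c (n + 1)))
      + |Mqp| * √(volume.real Ω / φlo) * Real.exp (lam * T) * GC.dt n
        * weightedNorm Ω P.φ (GC.recon (c (n + 1))) := by
  have hfin : IsFiniteMeasure (leb Ω) := isFiniteMeasure_restrict.2 hb.measure_lt_top.ne
  obtain ⟨hdt, hdtT⟩ := GC.dt_mem hn
  have hφm := hM.aestronglyMeasurable hP.φ_smooth
  have hφpos : ∀ᵐ x ∂leb Ω, 0 < P.φ x := hP.φ_bounds.mono fun x hx => hlo.trans_le hx.1
  have hφ0 : ∀ᵐ x ∂leb Ω, 0 ≤ P.φ x := hφpos.mono fun x hx => hx.le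
  have hint : ∀ m, Integrable (fun x => P.φ x * GC.recon (c m) x ^ 2) (leb Ω) := fun m =>
    integrable_mul_sq hb hφm hlo hP.φ_bounds _
  have hrm : ∀ m, AEStronglyMeasurable (GC.recon (c m)) (leb Ω) := fun m =>
    Lp.aestronglyMeasurable _
  have hqpM := hqp.ae_abs_le hT GC.t_zero GC.t_last GC.t_lt hP.qp_bdd
  have hqmM := hqm.ae_abs_le hT GC.t_zero GC.t_last GC.t_lt hP.qm_bdd
  have hqm0 := hqm.ae_nonneg hT GC.t_zero GC.t_last GC.t_lt hP.qm_nonneg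
  set a := weightedNorm Ω P.φ (GC.recon (c (n + 1))) with ha
  set b := weightedNorm Ω P.φ (GC.recon (c n)) with hb'
  have ha0 : 0 ≤ a := weightedNorm_nonneg _ _
  have hb0 : 0 ≤ b := weightedNorm_nonneg _ _
  set s := Real.exp (lam * GC.dt n) with hs
  have hs0 : 0 < s := Real.exp_pos _
  have hsT : s ≤ Real.exp (lam * T) := Real.exp_le_exp.2 (by gcongr)
  have hT1 : 1 ≤ Real.exp (lam * T) := Real.one_le_exp (by positivity)
  have hsa : √(Real.exp (2 * lam * GC.dt n) * ∫ x in Ω, P.φ x * GC.recon (c (n + 1)) x ^ 2)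
      = s * a := by
    rw [← sq_weightedNorm hφ0, Real.sqrt_mul (Real.exp_pos _).le, Real.sqrt_sq ha0,
      show 2 * lam * GC.dt n = lam * GC.dt n + lam * GC.dt n by ring, Real.exp_add,
      Real.sqrt_mul_self (Real.exp_pos _).le]
  have hsqb : √(∫ x in Ω, P.φ x * GC.recon (c n) x ^ 2) = b := rfl
  -- All integrals containing the transported function are treated alike: compression by `exp (2 *
  -- lam * dt)` for squares becomes the factor `s = exp (lam * dt)` on norms.
  have key : ∀ {h k r : Pt d → ℝ}, AEStronglyMeasurable k (leb Ω) → Integrable r (leb Ω) →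
      (∀ᵐ x ∂leb Ω, k x ^ 2 ≤ r x * P.φ x) →
      (∀ᵐ x ∂leb Ω, |h x| ≤ |k x| * |GC.recon (c (n + 1)) (F (GC.dt n) x)|) →
      |∫ x in Ω, h x| ≤ √(∫ x in Ω, r x) * (s * a) := by
    intro h k r hk hr hkr hh
    rw [← hsa]
    exact abs_integral_le_of_le_comp hφm hφpos (Real.exp_pos _).le hF (hrm _) (hint _) hk hr hkr hh
  have hconst : √(∫ _ in Ω, Mqp ^ 2 / φlo) = |Mqp| * √(volume.real Ω / φlo) := by
    rw [setIntegral_const, smul_eq_mul,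
      show volume.real Ω * (Mqp ^ 2 / φlo) = Mqp ^ 2 * (volume.real Ω / φlo) by ring,
      Real.sqrt_mul (sq_nonneg _), Real.sqrt_sq_eq_abs]
  have hconstle : ∀ᵐ x ∂leb Ω, Mqp ^ 2 ≤ Mqp ^ 2 / φlo * P.φ x := by
    filter_upwards [hP.φ_bounds] with x hx
    rw [div_mul_eq_mul_div, le_div_iff₀ hlo]
    exact mul_le_mul_of_nonneg_left hx.1 (sq_nonneg _)
  have hI := hstep (c (n + 1)) (fun x => GC.recon (c (n + 1)) (F (GC.dt n) x)) fun _ => rfl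
  have h1 : ∫ x in Ω, P.φ x * GC.recon (c (n + 1)) x * GC.recon (c (n + 1)) x = a ^ 2 := by
    rw [ha, sq_weightedNorm hφ0]
    refine integral_congr_ae (Filter.Eventually.of_forall fun x => ?_)
    ring
  have h2 : |∫ x in Ω, P.φ x * GC.recon (c n) x * GC.recon (c (n + 1)) (F (GC.dt n) x)|
      ≤ b * (s * a) := by
    rw [← hsqb]
    refine key (hφm.mul (hrm n)) (hint n) ?_ (Filter.Eventually.of_forall fun x => ?_)
    · exact Filter.Eventually.of_forall fun x => le_of_eq (by simp only [Pi.mul_apply]; ring)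
    · rw [Pi.mul_apply, ← abs_mul]
  have h4 : |∫ x in Ω, GC.recon (c n) x * GC.recon (c (n + 1)) (F (GC.dt n) x) * qm n x|
      ≤ |Mqm| / φlo * b * (s * a) := by
    have hr : √(∫ x in Ω, (|Mqm| / φlo) ^ 2 * (P.φ x * GC.recon (c n) x ^ 2))
        = |Mqm| / φlo * b := by
      rw [integral_const_mul, Real.sqrt_mul (sq_nonneg _), Real.sqrt_sq (by positivity)]
      rfl
    rw [← hr]
    -- The production term carries no weight `φ`. Bounding `1` by `φ² / φlo²` makes the weighted
    -- norm of `c n` appear, with the factor `|Mqm| / φlo`.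
    refine key (k := fun x => |Mqm| * GC.recon (c n) x) ((hrm n).const_mul _)
      ((hint n).const_mul _) ?_ ?_
    · filter_upwards [hP.φ_bounds] with x hx
      have h5 : φlo ^ 2 ≤ P.φ x ^ 2 := pow_le_pow_left₀ hlo.le hx.1 2
      calc (|Mqm| * GC.recon (c n) x) ^ 2
          = (|Mqm| / φlo) ^ 2 * GC.recon (c n) x ^ 2 * φlo ^ 2 := by field_simp
        _ ≤ (|Mqm| / φlo) ^ 2 * GC.recon (c n) x ^ 2 * P.φ x ^ 2 := by gcongr
        _ = _ := by ring
    · filter_upwards [hqmM n hn.le] with x hx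
      rw [abs_mul, abs_mul, abs_mul, abs_abs]
      have : |qm n x| ≤ |Mqm| := hx.trans (le_abs_self _)
      calc _ ≤ |GC.recon (c n) x| * |GC.recon (c (n + 1)) (F (GC.dt n) x)| * |Mqm| := by gcongr
        _ = _ := by ring
  have h5 : 0 ≤ ∫ x in Ω, GC.recon (c (n + 1)) x * GC.recon (c (n + 1)) x * qm (n + 1) x := by
    refine integral_nonneg_of_ae ?_
    filter_upwards [hqm0 (n + 1) hn] with x hx
    exact mul_nonneg (mul_self_nonneg _) hx
  have h6 : |∫ x in Ω, qp n x * GC.recon (c (n + 1)) (F (GC.dt n) x)|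
      ≤ |Mqp| * √(volume.real Ω / φlo) * (s * a) := by
    rw [← hconst]
    refine key (k := fun _ => Mqp) aestronglyMeasurable_const (integrable_const _) hconstle ?_
    filter_upwards [hqpM n hn.le] with x hx
    rw [abs_mul]
    exact mul_le_mul_of_nonneg_right (hx.trans (le_abs_self _)) (abs_nonneg _)
  have h7 : |∫ x in Ω, qp (n + 1) x * GC.recon (c (n + 1)) x|
      ≤ |Mqp| * √(volume.real Ω / φlo) * a := by
    -- No transport in the implicit source term: the same inequality is used with the identity map
    -- and compression `1`.
    have := abs_integral_le_of_le_comp (Φ := id) (κ := 1) (h := fun x => qp (n + 1) x * GC.recon (c (n + 1)) x)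
      (k := fun _ => Mqp)
      (p := fun _ => Mqp ^ 2 / φlo) hφm hφpos zero_le_one (fun B => by simp)
      (hrm (n + 1)) (hint (n + 1)) aestronglyMeasurable_const (integrable_const _) hconstle ?_
    · rw [hconst, one_mul] at this
      exact this
    · filter_upwards [hqpM (n + 1) hn] with x hx
      rw [abs_mul]
      exact mul_le_mul_of_nonneg_right (hx.trans (le_abs_self _)) (abs_nonneg _)
  have h3 := hP.le_integral_diffusion hb GP GC p c n (GC.grad (c (n + 1)))
  rw [h1] at hI
  have hw0 := hw.1
  have hw1 : 0 ≤ 1 - w := sub_nonneg.2 hw.2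
  set Q := |Mqp| * √(volume.real Ω / φlo) with hQ
  have hQ0 : 0 ≤ Q := by positivity
  have e2 := (le_abs_self _).trans h2
  have e3 := mul_le_mul_of_nonneg_left h3 hdt.le
  have e4 := mul_le_mul_of_nonneg_left ((neg_abs_le _).trans' (neg_le_neg h4))
    (mul_nonneg hw0 hdt.le)
  -- The explicit production term has no sign and is estimated in absolute value, unlike the
  -- implicit one, which is nonnegative by `h5` and discarded.
  have e4' : w * GC.dt n * (|Mqm| / φlo * b * (s * a)) ≤ GC.dt n * (|Mqm| / φlo * b * (s * a)) := by
    refine mul_le_mul_of_nonneg_right ?_ (by positivity)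
    nlinarith [hw.2]
  have e5 := mul_nonneg (mul_nonneg hw1 hdt.le) h5
  have e6 := mul_le_mul_of_nonneg_left ((le_abs_self _).trans h6) (mul_nonneg hw0 hdt.le)
  have e7 := mul_le_mul_of_nonneg_left ((le_abs_self _).trans h7) (mul_nonneg hw1 hdt.le)
  have e6' : w * GC.dt n * (Q * (s * a)) ≤ w * GC.dt n * (Q * (Real.exp (lam * T) * a)) := by
    gcongr
  have e7' : (1 - w) * GC.dt n * (Q * a)
      ≤ (1 - w) * GC.dt n * (Q * (Real.exp (lam * T) * a)) := by
    refine mul_le_mul_of_nonneg_left (mul_le_mul_of_nonneg_left ?_ hQ0)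
      (mul_nonneg hw1 hdt.le)
    exact le_mul_of_one_le_left ha0 hT1
  -- `1 + x ≤ exp x` merges the production term with the compression factor into one exponential, of
  -- rate `lam + |Mqm| / φlo`.
  have e8 : b * (s * a) + GC.dt n * (|Mqm| / φlo * b * (s * a))
      ≤ Real.exp ((lam + |Mqm| / φlo) * GC.dt n) * b * a := by
    have h9 : 1 + |Mqm| / φlo * GC.dt n ≤ Real.exp (|Mqm| / φlo * GC.dt n) := by
      rw [add_comm]; exact Real.add_one_le_exp _
    rw [add_mul, Real.exp_add]
    calc _ = s * (1 + |Mqm| / φlo * GC.dt n) * b * a := by ring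
      _ ≤ _ := by gcongr
  linarith

end Scheme

end Ellam

/-! ### Discrete Gronwall estimate and space-time norms -/

namespace Ellam

/-- Dropping `G` and dividing by `a (n + 1)` gives a linear recursion, whence the bound `S`. For the
sum of the `G n`, Young's inequality absorbs half of `a (n + 1) ^ 2`; the remaining squares
telescope up to `(exp(2 γ δ) - 1) a n ^ 2 / 2`, which is `O(δ)` and sums to `O(T)`. -/
theorem discrete_energy_bound {N : ℕ} {t a G : ℕ → ℝ} {T γ K : ℝ} (h0 : t 0 = 0) (hN : t N = T)
    (ht : ∀ n < N, t n < t (n + 1)) (hγ : 0 ≤ γ) (hK : 0 ≤ K) (ha : ∀ n, 0 ≤ a n)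
    (hstep : ∀ n < N, a (n + 1) ^ 2 + (t (n + 1) - t n) * G n
      ≤ Real.exp (γ * (t (n + 1) - t n)) * a n * a (n + 1) + K * (t (n + 1) - t n) * a (n + 1))
    (hG : ∀ n < N, 0 ≤ G n) {S : ℝ} (hS : S = Real.exp (γ * T) * (a 0 + K * T)) :
    (∀ n ≤ N, a n ≤ S) ∧
      ∑ n ∈ Finset.range N, (t (n + 1) - t n) * G n
        ≤ a 0 ^ 2 / 2 + T * (γ * Real.exp (2 * γ * T) * S ^ 2 + K * S) := by
  have htn : ∀ n ≤ N, 0 ≤ t n ∧ t n ≤ T := fun n hn =>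
    ⟨h0 ▸ monotone_times ht (Nat.zero_le n) hn, hN ▸ monotone_times ht hn le_rfl⟩
  have hgrow : ∀ n ≤ N, a n ≤ Real.exp (γ * t n) * (a 0 + K * t n) := by
    intro n
    induction n with
    | zero => intro _; simp [h0]
    | succ n ih =>
      intro hn
      have ih' := ih (by omega)
      have hdt : 0 ≤ t (n + 1) - t n := sub_nonneg.2 (ht n hn).le
      have h1 : a (n + 1) ≤ Real.exp (γ * (t (n + 1) - t n)) * a n + K * (t (n + 1) - t n) := by
        -- Division by `a (n + 1)` requires it to be positive; otherwise the bound is trivial.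
        rcases (ha (n + 1)).eq_or_lt with h | h
        · rw [← h]; have := ha n; positivity
        · have h2 := hstep n hn
          have h3 := mul_nonneg hdt (hG n hn)
          refine le_of_mul_le_mul_right ?_ h
          nlinarith
      have h2 : Real.exp (γ * t (n + 1))
          = Real.exp (γ * (t (n + 1) - t n)) * Real.exp (γ * t n) := by
        rw [← Real.exp_add]; ring_nf
      have h3 : 1 ≤ Real.exp (γ * t (n + 1)) :=
        Real.one_le_exp (mul_nonneg hγ (htn _ hn).1)
      calc a (n + 1) ≤ _ := h1
        _ ≤ Real.exp (γ * (t (n + 1) - t n)) * (Real.exp (γ * t n) * (a 0 + K * t n))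
            + Real.exp (γ * t (n + 1)) * (K * (t (n + 1) - t n)) := by
          refine add_le_add (mul_le_mul_of_nonneg_left ih' (Real.exp_pos _).le) ?_
          exact le_mul_of_one_le_left (by positivity) h3
        _ = _ := by rw [h2]; ring
  have hbd : ∀ n ≤ N, a n ≤ S := by
    intro n hn
    rw [hS]
    refine (hgrow n hn).trans ?_
    obtain ⟨h1, h2⟩ := htn n hn
    have h3 : 0 ≤ a 0 + K * t n := add_nonneg (ha 0) (mul_nonneg hK h1)
    gcongr
  refine ⟨hbd, ?_⟩
  have hS0 : 0 ≤ S := (ha 0).trans (hbd 0 (Nat.zero_le _))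
  set D := γ * Real.exp (2 * γ * T) * S ^ 2 + K * S with hD
  have hsum : ∀ n ≤ N, ∑ m ∈ Finset.range n, (t (m + 1) - t m) * G m
      ≤ a 0 ^ 2 / 2 - a n ^ 2 / 2 + t n * D := by
    intro n
    induction n with
    | zero => intro _; simp [h0]
    | succ n ih =>
      intro hn
      have ih' := ih (by omega)
      have hdt : 0 ≤ t (n + 1) - t n := sub_nonneg.2 (ht n hn).le
      have hdtT : t (n + 1) - t n ≤ T := by linarith [(htn (n + 1) hn).2, (htn n (by omega)).1]
      set δ := t (n + 1) - t n with hδ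
      have h2 := hstep n hn
      set E := Real.exp (γ * δ) with hE
      have hE2 : E ^ 2 = Real.exp (2 * γ * δ) := by
        rw [hE, ← Real.exp_nat_mul]; push_cast; ring_nf
      -- This is `exp x - 1 ≤ x * exp x` with `x = 2 * γ * δ`, that is `1 - x ≤ exp (-x)`.
      have h3 : E ^ 2 - 1 ≤ 2 * γ * δ * Real.exp (2 * γ * T) := by
        have h4 : 1 - 2 * γ * δ ≤ Real.exp (-(2 * γ * δ)) := by
          linarith [Real.add_one_le_exp (-(2 * γ * δ))]
        have h5 := mul_le_mul_of_nonneg_right h4 (Real.exp_pos (2 * γ * δ)).le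
        rw [← Real.exp_add, neg_add_cancel, Real.exp_zero] at h5
        have h6 : Real.exp (2 * γ * δ) ≤ Real.exp (2 * γ * T) := Real.exp_le_exp.2 (by gcongr)
        have h7 := mul_le_mul_of_nonneg_left h6 (by positivity : 0 ≤ 2 * γ * δ)
        rw [hE2]; linarith
      have h8 : (E ^ 2 - 1) * a n ^ 2 ≤ 2 * γ * δ * Real.exp (2 * γ * T) * S ^ 2 := by
        have h9 : a n ^ 2 ≤ S ^ 2 := pow_le_pow_left₀ (ha n) (hbd n (by omega)) 2
        calc _ ≤ 2 * γ * δ * Real.exp (2 * γ * T) * a n ^ 2 :=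
              mul_le_mul_of_nonneg_right h3 (sq_nonneg _)
          _ ≤ _ := by gcongr
      have h10 : K * δ * a (n + 1) ≤ K * δ * S := by
        have := hbd (n + 1) hn
        gcongr
      have h11 : E * a n * a (n + 1) ≤ E ^ 2 * a n ^ 2 / 2 + a (n + 1) ^ 2 / 2 := by
        nlinarith [sq_nonneg (E * a n - a (n + 1))]
      rw [Finset.sum_range_succ]
      have h12 : t (n + 1) * D = t n * D + δ * D := by rw [hδ]; ring
      have h13 : δ * D = γ * δ * Real.exp (2 * γ * T) * S ^ 2 + K * δ * S := by rw [hD]; ring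
      linarith
  have := hsum N le_rfl
  rw [hN] at this
  nlinarith [sq_nonneg (a N)]

theorem eLpNorm_two_eq {α E : Type*} [MeasurableSpace α] {μ : Measure α} [NormedAddCommGroup E]
    {f : α → E} (hf : Integrable (fun x => ‖f x‖ ^ 2) μ) :
    eLpNorm f 2 μ = ENNReal.ofReal √(∫ x, ‖f x‖ ^ 2 ∂μ) := by
  rw [eLpNorm_eq_lintegral_rpow_enorm_toReal two_ne_zero ENNReal.ofNat_ne_top, Real.sqrt_eq_rpow,
    ← ENNReal.ofReal_rpow_of_nonneg (integral_nonneg fun x => sq_nonneg _) (by norm_num),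
    ofReal_integral_eq_lintegral_ofReal hf (Filter.Eventually.of_forall fun x => sq_nonneg _)]
  simp only [ENNReal.toReal_ofNat, ENNReal.rpow_two]
  congr 1
  refine lintegral_congr fun x => ?_
  rw [ENNReal.ofReal_pow (norm_nonneg _), ofReal_norm]

section Times

variable {d : ℕ} {Ω : Set (Pt d)} {T : ℝ} {N : ℕ} {t : ℕ → ℝ}

theorem exists_mem_Ioc_times {s : ℝ} (hs : s ∈ Ioc (t 0) (t N)) :
    ∃ n < N, s ∈ Ioc (t n) (t (n + 1)) := by
  induction N with
  | zero => exact absurd (hs.1.trans_le hs.2) (lt_irrefl _)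
  | succ N ih =>
    by_cases h : s ≤ t N
    · obtain ⟨n, hn, h'⟩ := ih ⟨hs.1, h⟩
      exact ⟨n, hn.trans N.lt_succ_self, h'⟩
    · exact ⟨N, N.lt_succ_self, not_le.1 h, hs.2⟩

theorem inTime_eq {B : Type*} [AddCommMonoid B] (ht : ∀ n < N, t n < t (n + 1)) {n : ℕ}
    (hn : n < N) {s : ℝ} (hs : s ∈ Ioc (t n) (t (n + 1))) (a : ℕ → Pt d → B) :
    inTime N t a s = a n := by
  ext1 x
  rw [inTime, Finset.sum_eq_single n]
  · rw [indicator_of_mem hs]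
  · intro m hm hmn
    refine indicator_of_notMem (fun h => ?_) _
    have hm' := Finset.mem_range.1 hm
    rcases hmn.lt_or_gt with hlt | hlt
    · exact absurd (h.2.trans (monotone_times ht (Nat.succ_le_of_lt hlt) hn.le)) (not_le.2 hs.1)
    · exact absurd (hs.2.trans (monotone_times ht (Nat.succ_le_of_lt hlt) hm'.le)) (not_le.2 h.1)
  · intro h
    exact absurd (Finset.mem_range.2 hn) h

theorem normLrL2_top_le {B : Type*} [NormedAddCommGroup B] (h0 : t 0 = 0) (hN : t N = T)
    {f : ℝ → Pt d → B} {Z : ℝ≥0∞}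
    (hf : ∀ n < N, ∀ s ∈ Ioc (t n) (t (n + 1)), eLpNorm (f s) 2 (leb Ω) ≤ Z) :
    normLrL2 Ω T ⊤ f ≤ Z := by
  rw [normLrL2, eLpNorm_exponent_top]
  refine essSup_le_of_ae_le _ ?_
  filter_upwards [ae_restrict_mem measurableSet_Ioo] with s hs
  obtain ⟨n, hn, hsn⟩ := exists_mem_Ioc_times (t := t) (N := N) (s := s)
    (by rw [h0, hN]; exact Ioo_subset_Ioc_self hs)
  exact hf n hn s hsn

/-- The integrand in time is dominated by a step function, so no measurability of `f` in time is
involved. -/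
theorem normLrL2_two_le {B : Type*} [NormedAddCommGroup B] (h0 : t 0 = 0) (hN : t N = T)
    (ht : ∀ n < N, t n < t (n + 1)) {f : ℝ → Pt d → B} {G : ℕ → ℝ} {Z : ℝ}
    (hG : ∀ n < N, 0 ≤ G n)
    (hf : ∀ n < N, ∀ s ∈ Ioc (t n) (t (n + 1)),
      eLpNorm (f s) 2 (leb Ω) ≤ ENNReal.ofReal √(G n))
    (hZ : ∑ n ∈ Finset.range N, (t (n + 1) - t n) * G n ≤ Z) :
    normLrL2 Ω T 2 f ≤ ENNReal.ofReal √Z := by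
  have hsum0 : 0 ≤ ∑ n ∈ Finset.range N, (t (n + 1) - t n) * G n :=
    Finset.sum_nonneg fun n hn => mul_nonneg (sub_nonneg.2 (ht n (Finset.mem_range.1 hn)).le)
      (hG n (Finset.mem_range.1 hn))
  have key : ∫⁻ s in Ioo 0 T, eLpNorm (f s) 2 (leb Ω) ^ 2 ≤ ENNReal.ofReal Z := by
    calc ∫⁻ s in Ioo 0 T, eLpNorm (f s) 2 (leb Ω) ^ 2
        ≤ ∫⁻ s in Ioo 0 T, ∑ n ∈ Finset.range N,
          (Ioc (t n) (t (n + 1))).indicator (fun _ => ENNReal.ofReal (G n)) s := by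
          refine setLIntegral_mono' measurableSet_Ioo fun s hs => ?_
          obtain ⟨n, hn, hsn⟩ := exists_mem_Ioc_times (t := t) (N := N) (s := s)
            (by rw [h0, hN]; exact Ioo_subset_Ioc_self hs)
          refine le_trans ?_ (Finset.single_le_sum (fun _ _ => zero_le)
            (Finset.mem_range.2 hn))
          rw [indicator_of_mem hsn]
          calc eLpNorm (f s) 2 (leb Ω) ^ 2 ≤ ENNReal.ofReal √(G n) ^ 2 := by
                gcongr; exact hf n hn s hsn
            _ = ENNReal.ofReal (G n) := by
                rw [← ENNReal.ofReal_pow (Real.sqrt_nonneg _), Real.sq_sqrt (hG n hn)]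
      _ ≤ ∑ n ∈ Finset.range N, ENNReal.ofReal ((t (n + 1) - t n) * G n) := by
          rw [lintegral_finsetSum _ fun n _ => measurable_const.indicator measurableSet_Ioc]
          refine Finset.sum_le_sum fun n hn => ?_
          refine (setLIntegral_le_lintegral _ _).trans ?_
          rw [lintegral_indicator measurableSet_Ioc, setLIntegral_const, Real.volume_Ioc,
            mul_comm, ← ENNReal.ofReal_mul (sub_nonneg.2 (ht n (Finset.mem_range.1 hn)).le)]
      _ ≤ _ := by
          rw [← ENNReal.ofReal_sum_of_nonneg fun n hn =>
            mul_nonneg (sub_nonneg.2 (ht n (Finset.mem_range.1 hn)).le)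
              (hG n (Finset.mem_range.1 hn))]
          exact ENNReal.ofReal_le_ofReal hZ
  rw [normLrL2, eLpNorm_eq_lintegral_rpow_enorm_toReal two_ne_zero ENNReal.ofNat_ne_top,
    Real.sqrt_eq_rpow, ← ENNReal.ofReal_rpow_of_nonneg (hsum0.trans hZ) (by norm_num)]
  simp only [ENNReal.toReal_ofNat, ENNReal.rpow_two, enorm_eq_self]
  exact ENNReal.rpow_le_rpow key (by norm_num)

end Times

section Scheme

variable {d : ℕ} {Ω : Set (Pt d)} {T : ℝ} {XP XC : Type*}
  [AddCommGroup XP] [Module ℝ XP] [AddCommGroup XC] [Module ℝ XC]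

theorem reconST_eq {GC : SpaceTimeGD Ω T XC} {n : ℕ} (hn : n < GC.N) {s : ℝ}
    (hs : s ∈ Ioc (GC.t n) (GC.t (n + 1))) (c : ℕ → XC) :
    reconST GC c s = GC.recon (c (n + 1)) :=
  inTime_eq GC.t_lt hn hs _

theorem gradST_eq {GC : SpaceTimeGD Ω T XC} {n : ℕ} (hn : n < GC.N) {s : ℝ}
    (hs : s ∈ Ioc (GC.t n) (GC.t (n + 1))) (c : ℕ → XC) :
    gradST GC c s = GC.grad (c (n + 1)) :=
  inTime_eq GC.t_lt hn hs _

theorem velocityST_eq (P : Data d Ω) (GP : SpaceGD Ω XP) {GC : SpaceTimeGD Ω T XC} {n : ℕ}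
    (hn : n < GC.N) {s : ℝ} (hs : s ∈ Ioc (GC.t n) (GC.t (n + 1))) (p : ℕ → XP) (c : ℕ → XC) :
    velocityST P GP GC p c s = discreteU P GP GC p c n := by
  ext1 x
  rw [velocityST, reconDelayedST, inTime_eq GC.t_lt hn hs, inTime_eq GC.t_lt hn hs, discreteU]

theorem LInf.integrable_norm_sq {B : Type} [NormedAddCommGroup B] (hb : Bornology.IsBounded Ω)
    (f : LInf Ω B) : Integrable (fun x => ‖f x‖ ^ 2) (leb Ω) := by
  have : IsFiniteMeasure (leb Ω) := isFiniteMeasure_restrict.2 hb.measure_lt_top.ne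
  obtain ⟨R, hR0, hR⟩ := LInf.exists_ae_norm_le f
  refine Integrable.of_bound ((Lp.aestronglyMeasurable f).norm.pow 2) (R ^ 2) ?_
  filter_upwards [hR] with x hx
  rw [norm_pow, norm_norm]
  gcongr

theorem eLpNorm_le_weightedNorm {φ : Pt d → ℝ} {lo hi : ℝ} (hb : Bornology.IsBounded Ω)
    (hφm : AEStronglyMeasurable φ (leb Ω)) (hlo : 0 < lo)
    (hφ : ∀ᵐ x ∂leb Ω, lo ≤ φ x ∧ φ x ≤ hi) (f : LInf Ω ℝ) :
    eLpNorm f 2 (leb Ω) ≤ ENNReal.ofReal (weightedNorm Ω φ f / √lo) := by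
  have h1 := LInf.integrable_norm_sq hb f
  rw [eLpNorm_two_eq h1]
  refine ENNReal.ofReal_le_ofReal ?_
  rw [le_div_iff₀ (Real.sqrt_pos.2 hlo), ← Real.sqrt_mul (integral_nonneg fun x => sq_nonneg _),
    ← integral_mul_const]
  refine Real.sqrt_le_sqrt (integral_mono_ae (h1.mul_const _)
    (integrable_mul_sq hb hφm hlo hφ f) ?_)
  filter_upwards [hφ] with x hx
  rw [Real.norm_eq_abs, sq_abs, mul_comm]
  exact mul_le_mul_of_nonneg_right hx.1 (sq_nonneg _)

theorem weightedNorm_le_eLpNorm {φ : Pt d → ℝ} {lo hi : ℝ} (hb : Bornology.IsBounded Ω)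
    (hφm : AEStronglyMeasurable φ (leb Ω)) (hlo : 0 < lo) (hhi : 0 ≤ hi)
    (hφ : ∀ᵐ x ∂leb Ω, lo ≤ φ x ∧ φ x ≤ hi) (f : LInf Ω ℝ) :
    weightedNorm Ω φ f ≤ √hi * (eLpNorm f 2 (leb Ω)).toReal := by
  have h1 := LInf.integrable_norm_sq hb f
  rw [eLpNorm_two_eq h1, ENNReal.toReal_ofReal (Real.sqrt_nonneg _), ← Real.sqrt_mul hhi,
    ← integral_const_mul]
  refine Real.sqrt_le_sqrt (integral_mono_ae (integrable_mul_sq hb hφm hlo hφ f)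
    (h1.const_mul _) ?_)
  filter_upwards [hφ] with x hx
  rw [Real.norm_eq_abs, sq_abs]
  exact mul_le_mul_of_nonneg_right hx.2 (sq_nonneg _)

end Scheme

end Ellam

/-! ### The estimate and its constant -/

theorem lemma6p2 (vol T φlo φhi αD Mqp Mqm Mdiv : ℝ) (hT : 0 < T) (hφlo : 0 < φlo)
    (hφhi : 0 < φhi) (hαD : 0 < αD) :
    ∃ C : ℝ, 0 ≤ C ∧
      ∀ (d : ℕ) (Ω : Set (Ellam.Pt d)), IsOpen Ω → Bornology.IsBounded Ω → volume.real Ω = vol →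
      ∀ (αA ΛA ΛD : ℝ), 0 < αA →
      ∀ (P : Ellam.Data d Ω) (Mφ : Set (Set (Ellam.Pt d))), Ellam.IsMesh Ω Mφ →
        P.Admissible Mφ T φlo φhi αA ΛA αD ΛD Mqp Mqm →
      ∀ (XP XC : Type*) [AddCommGroup XP] [Module ℝ XP] [AddCommGroup XC] [Module ℝ XC]
        (GP : Ellam.SpaceGD Ω XP) (GC : Ellam.SpaceTimeGD Ω T XC)
        (w : ℝ), w ∈ Icc (0 : ℝ) 1 →
      ∀ (qp qm : ℕ → Ellam.Pt d → ℝ) (Mu : ℕ → Set (Set (Ellam.Pt d)))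
        (u : ℕ → Ellam.Pt d → Ellam.Pt d) (F : ℕ → ℝ → Ellam.Pt d → Ellam.Pt d)
        (p : ℕ → XP) (c : ℕ → XC),
        (∀ n < GC.N, Ellam.IsMesh Ω (Mu (n + 1)) ∧
          Ellam.IsAdmissibleVelocity Ω (Mu (n + 1)) Mdiv (u (n + 1))) →
        Ellam.IsSolution P Mφ GP GC w qp qm Mu u F p c →
        Ellam.normLrL2 Ω T ∞ (Ellam.reconST GC c)
            + Ellam.normLrL2 Ω T 2 (fun s x =>
                Real.sqrt (1 + ‖Ellam.velocityST P GP GC p c s x‖) • Ellam.gradST GC c s x)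
          ≤ ENNReal.ofReal C * (1 + eLpNorm (GC.recon (GC.interp P.cini)) 2 (Ellam.leb Ω)) ∧
        Ellam.normLrL2 Ω T 2 (Ellam.gradST GC c)
          ≤ ENNReal.ofReal C * (1 + eLpNorm (GC.recon (GC.interp P.cini)) 2 (Ellam.leb Ω)) := by
  -- `|Mdiv| / φlo` is the compression rate of the measure; `lam` is half of it, the rate for `L²`
  -- norms.
  obtain ⟨lam, hlam⟩ : ∃ lam, lam = |Mdiv| / φlo / 2 := ⟨_, rfl⟩
  obtain ⟨γ, hγ⟩ : ∃ γ, γ = lam + |Mqm| / φlo := ⟨_, rfl⟩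
  obtain ⟨K, hK⟩ : ∃ K, K = |Mqp| * √(vol / φlo) * Real.exp (lam * T) := ⟨_, rfl⟩
  -- `S₀` and `Z₀` are the bounds of `discrete_energy_bound` with `√φhi` in place of `a 0`. The
  -- actual bounds follow by scaling with `1 + l` and `(1 + l) ^ 2`, where `l` is the norm of the
  -- discrete initial condition, because `a 0 ≤ √φhi * (1 + l)`.
  obtain ⟨S₀, hS₀⟩ : ∃ S₀, S₀ = Real.exp (γ * T) * (√φhi + K * T) := ⟨_, rfl⟩
  obtain ⟨Z₀, hZ₀⟩ : ∃ Z₀, Z₀ = φhi / 2 + T * (γ * Real.exp (2 * γ * T) * S₀ ^ 2 + K * S₀) :=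
    ⟨_, rfl⟩
  have hlam0 : 0 ≤ lam := by rw [hlam]; positivity
  have hγ0 : 0 ≤ γ := by rw [hγ]; positivity
  have hK0 : 0 ≤ K := by rw [hK]; positivity
  have hS₀0 : 0 ≤ S₀ := by rw [hS₀]; positivity
  have hZ₀0 : 0 ≤ Z₀ := by rw [hZ₀]; positivity
  -- The first term bounds the norm of `Π_C c`, after removal of the weight `φ ≥ φlo`; the second
  -- one bounds both gradient norms, `αD` coming from the coercivity of `D`.
  refine ⟨S₀ / √φlo + √(Z₀ / αD), by positivity, ?_⟩
  intro d Ω hΩ hb hvol αA ΛA ΛD _ P Mφ hM hP XP XC _ _ _ _ GP GC w hw qp qm Mu u F p c hu hsol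
  have : IsFiniteMeasure (Ellam.leb Ω) := isFiniteMeasure_restrict.2 hb.measure_lt_top.ne
  have hφm := hM.aestronglyMeasurable hP.φ_smooth
  set L := eLpNorm (GC.recon (GC.interp P.cini)) 2 (Ellam.leb Ω) with hL
  have hLtop : L ≠ ⊤ := by
    rw [hL, Ellam.eLpNorm_two_eq (Ellam.LInf.integrable_norm_sq hb _)]
    exact ENNReal.ofReal_ne_top
  set l := L.toReal with hl
  have hl0 : 0 ≤ l := ENNReal.toReal_nonneg
  have h1L : 1 + L = ENNReal.ofReal (1 + l) := by
    rw [ENNReal.ofReal_add zero_le_one hl0, ENNReal.ofReal_one, ENNReal.ofReal_toReal hLtop]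
  set a : ℕ → ℝ := fun n => Ellam.weightedNorm Ω P.φ (GC.recon (c n)) with ha
  have ha0 : ∀ n, 0 ≤ a n := fun n => Ellam.weightedNorm_nonneg _ _
  set G : ℕ → ℝ := fun n => ∫ x in Ω,
    (1 + ‖Ellam.discreteU P GP GC p c n x‖) * ‖GC.grad (c (n + 1)) x‖ ^ 2 with hG
  have hG0 : ∀ n, 0 ≤ G n := fun n => integral_nonneg fun x => by positivity
  have hainit : a 0 ≤ √φhi * (1 + l) := by
    have := Ellam.weightedNorm_le_eLpNorm hb hφm hφlo hφhi.le hP.φ_bounds (GC.recon (c 0))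
    rw [hsol.initial, ← hL, ← hl, ← hsol.initial] at this
    exact this.trans (by gcongr; linarith)
  have hstep : ∀ n < GC.N, a (n + 1) ^ 2 + (GC.t (n + 1) - GC.t n) * (αD * G n)
      ≤ Real.exp (γ * (GC.t (n + 1) - GC.t n)) * a n * a (n + 1)
        + K * (GC.t (n + 1) - GC.t n) * a (n + 1) := by
    intro n hn
    obtain ⟨hdt, hdtT⟩ := GC.dt_mem hn
    have hF : ∀ B, Ellam.porousMeasure Ω P.φ {x | F (n + 1) (GC.dt n) x ∈ B}
        ≤ ENNReal.ofReal (Real.exp (2 * lam * GC.dt n)) * Ellam.porousMeasure Ω P.φ B := by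
      intro B
      rw [show 2 * lam = |Mdiv| / φlo by rw [hlam]; ring]
      exact (hsol.flow n hn).measure_preimage_le hΩ hb hM (hu n hn).1 hP.φ_smooth (hu n hn).2 hT
        hφlo hP.φ_bounds ⟨hdt.le, hdtT⟩ B
    have := (hsol.concentration n hn).energy_le hb hT hφlo hM hP hw hsol.qp_sampling
      hsol.qm_sampling hn hlam0 hF
    rw [hvol, ← hγ, ← hK] at this
    exact this
  obtain ⟨hbd, hsum⟩ := Ellam.discrete_energy_bound GC.t_zero GC.t_last GC.t_lt hγ0 hK0 ha0 hstep
    (fun n _ => mul_nonneg hαD.le (hG0 n)) rfl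
  set S := Real.exp (γ * T) * (a 0 + K * T) with hS
  have hS0 : 0 ≤ S := (ha0 0).trans (hbd 0 (Nat.zero_le _))
  have hSle : S ≤ S₀ * (1 + l) := by
    have h1 : K * T ≤ K * T * (1 + l) := le_mul_of_one_le_right (by positivity) (by linarith)
    calc S ≤ Real.exp (γ * T) * (√φhi * (1 + l) + K * T * (1 + l)) := by rw [hS]; gcongr
      _ = S₀ * (1 + l) := by rw [hS₀]; ring
  have hGsum : ∑ n ∈ Finset.range GC.N, (GC.t (n + 1) - GC.t n) * G n
      ≤ Z₀ / αD * (1 + l) ^ 2 := by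
    have h1 : ∑ n ∈ Finset.range GC.N, (GC.t (n + 1) - GC.t n) * (αD * G n)
        = αD * ∑ n ∈ Finset.range GC.N, (GC.t (n + 1) - GC.t n) * G n := by
      rw [Finset.mul_sum]
      exact Finset.sum_congr rfl fun n _ => by ring
    rw [h1] at hsum
    rw [div_mul_eq_mul_div, le_div_iff₀ hαD, mul_comm]
    refine hsum.trans ?_
    have h2 : a 0 ^ 2 ≤ φhi * (1 + l) ^ 2 := by
      calc a 0 ^ 2 ≤ (√φhi * (1 + l)) ^ 2 := pow_le_pow_left₀ (ha0 0) hainit 2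
        _ = _ := by rw [mul_pow, Real.sq_sqrt hφhi.le]
    have h3 : S ^ 2 ≤ S₀ ^ 2 * (1 + l) ^ 2 := by
      rw [← mul_pow]; exact pow_le_pow_left₀ hS0 hSle 2
    have h4 : S ≤ S₀ * (1 + l) ^ 2 := hSle.trans (by gcongr; nlinarith)
    calc _ ≤ φhi * (1 + l) ^ 2 / 2 + T * (γ * Real.exp (2 * γ * T) * (S₀ ^ 2 * (1 + l) ^ 2)
          + K * (S₀ * (1 + l) ^ 2)) := by gcongr
      _ = _ := by rw [hZ₀]; ring
  have hsqrtZ : √(Z₀ / αD * (1 + l) ^ 2) = √(Z₀ / αD) * (1 + l) := by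
    rw [Real.sqrt_mul (by positivity), Real.sqrt_sq (by positivity)]
  have hdiss : ∀ n, Integrable (fun x => (1 + ‖Ellam.discreteU P GP GC p c n x‖)
      * ‖GC.grad (c (n + 1)) x‖ ^ 2) (Ellam.leb Ω) := fun n =>
    hP.integrable_dissipation hb GP GC p c n _
  have hgrad : Ellam.normLrL2 Ω T 2 (Ellam.gradST GC c)
      ≤ ENNReal.ofReal (√(Z₀ / αD) * (1 + l)) := by
    rw [← hsqrtZ]
    refine Ellam.normLrL2_two_le GC.t_zero GC.t_last GC.t_lt (fun n _ => hG0 n)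
      (fun n hn s hs => ?_) hGsum
    have hi := Ellam.LInf.integrable_norm_sq hb (GC.grad (c (n + 1)))
    rw [Ellam.gradST_eq hn hs, Ellam.eLpNorm_two_eq hi]
    refine ENNReal.ofReal_le_ofReal (Real.sqrt_le_sqrt (integral_mono hi (hdiss n) fun x => ?_))
    exact le_mul_of_one_le_left (sq_nonneg _) (by linarith [norm_nonneg (Ellam.discreteU P GP GC p c n x)])
  have hwgrad : Ellam.normLrL2 Ω T 2 (fun s x =>
      Real.sqrt (1 + ‖Ellam.velocityST P GP GC p c s x‖) • Ellam.gradST GC c s x)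
      ≤ ENNReal.ofReal (√(Z₀ / αD) * (1 + l)) := by
    rw [← hsqrtZ]
    refine Ellam.normLrL2_two_le GC.t_zero GC.t_last GC.t_lt (fun n _ => hG0 n)
      (fun n hn s hs => ?_) hGsum
    have heq : (fun x => ‖Real.sqrt (1 + ‖Ellam.velocityST P GP GC p c s x‖)
        • Ellam.gradST GC c s x‖ ^ 2) = fun x => (1 + ‖Ellam.discreteU P GP GC p c n x‖)
          * ‖GC.grad (c (n + 1)) x‖ ^ 2 := by
      ext1 x
      rw [Ellam.gradST_eq hn hs, Ellam.velocityST_eq P GP hn hs, norm_smul, mul_pow,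
        Real.norm_of_nonneg (Real.sqrt_nonneg _), Real.sq_sqrt (by positivity)]
    rw [Ellam.eLpNorm_two_eq (by rw [heq]; exact hdiss n), heq]
  have hrec : Ellam.normLrL2 Ω T ⊤ (Ellam.reconST GC c)
      ≤ ENNReal.ofReal (S₀ / √φlo * (1 + l)) := by
    refine Ellam.normLrL2_top_le GC.t_zero GC.t_last fun n hn s hs => ?_
    rw [Ellam.reconST_eq hn hs]
    refine (Ellam.eLpNorm_le_weightedNorm hb hφm hφlo hP.φ_bounds _).trans
      (ENNReal.ofReal_le_ofReal ?_)
    rw [div_mul_eq_mul_div]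
    exact div_le_div_of_nonneg_right ((hbd (n + 1) hn).trans hSle) (Real.sqrt_nonneg _)
  rw [h1L, ← ENNReal.ofReal_mul (by positivity), add_mul]
  refine ⟨?_, hgrad.trans (ENNReal.ofReal_le_ofReal ?_)⟩
  · rw [ENNReal.ofReal_add (by positivity) (by positivity)]
    exact add_le_add hrec hwgrad
  · exact le_add_of_nonneg_left (by positivity)
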